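/- \textbf{Model.} Robots are points of $\mathbb R^2$ that are oblivious, anonymous (they all run the same algorithm) and asynchronous. Each robot repeats forever: it takes an instantaneous snapshot, i.e. it sees the unordered list of the positions of all robots within its visibility radius, itself included, in a local coordinate system that is centred at the robot and has a fixed but arbitrary orientation and handedness (the unit of length is common to all robots); from this snapshot alone it computes a destination; it then moves monotonically along the segment to the destination until its next snapshot. A scheduler chooses for every robot the times of the snapshots (infinitely many, tending to infinity), the speeds and the stops, but it must not stop a robot before it has reached its destination or has covered a distance of at least a constant $\delta>0$ (non-rigid robots). Destinations are computed by real RAM programs (arithmetic operations, square root, $\arctan$, $\tan$, comparisons, integer constants). \textbf{Basic TuringMobile.} Fix lengths $d,\mu,\lambda>0$. The machine consists of three robots, Commander, Number and Reference, located in $C,N,R$; the roles are recognized by $\overline{CR}<\overline{RN}<\overline{CN}$. It is \emph{at rest} if $\overline{CR}=d$, $\angle NRC=90^\circ$ and $2d-\lambda/2\le\overline{RN}\le 2d+\lambda/2$, and then it \emph{stores} the real number $r$ with $\overline{RN}=\alpha(r)=2d+\arctan(r)\lambda/\pi$. Let $e_1$ be the unit vector from $R$ to $N$ and $e_2$ the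 unit vector orthogonal to it on the side of $C$; the three directions of movement are $u_1=e_2$, $u_2=-\frac{\sqrt3}2e_1-\frac12e_2$, $u_3=\frac{\sqrt3}2e_1-\frac12e_2$, and $w_i$ is $u_i$ turned by $90^\circ$ in the sense that turns $e_1$ into $e_2$. The Virtual Commander based on $R,N$ is $C'=R+d\,e_2$. Put $A_i=C'+\frac{\mu-\lambda}2u_i$, $S_i=C'+\frac\mu2u_i$, $S'_i=S_i+\lambda w_i$, $B_i=C'+\frac{\mu+\lambda}2u_i$, $D_i=C'+\mu u_i$, $Q=R+(2d-\frac\lambda2)e_1$, $d'=\sqrt{d^2+\mu^2-d\mu}$. The algorithm depends on a function $g$ (update of the stored number) and on a function $r\mapsto i(r)\in\{1,2,3\}$ (choice of the direction); let $f$ be the function of $y=\overline{NQ}$ with $f(y)=\alpha(g(r))-(2d-\lambda/2)$ for $0<y<\lambda$ and $\alpha(r)=2d-\lambda/2+y$. \emph{Commander} applies the first rule that fits: in $C'$, move to $A_{i(r)}$; on $C'A_i$ but not in $A_i$, move to $A_i$; in $A_i$, move to the point of $S_iS'_i$ at distance $f(\overline{NQ})$ from $S_i$; in the triangle $A_iS_iS'_i$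 but not on $S_iS'_i$, move to the intersection of $S_iS'_i$ with the extension of $A_iC$; on $S_iS'_i$ with $\overline{NQ}=\overline{CS_i}$, move to $B_i$; in the triangle $B_iS_iS'_i$, but neither on $S_iS'_i$ nor in $B_i$, move to $B_i$; on $B_iD_i$ but not in $D_i$, move to $D_i$; otherwise stay. \emph{Number}: if $\overline{CR}=d+\mu$ (then $C$ is the first final destination) or $\overline{CR}=d'$ (then $C$ is the second one if $\angle NRC>90^\circ$ and the third one if $\angle NRC<90^\circ$), compute from $C$ and $R$ the corresponding Virtual Commander $C'$ and move to $N'+\overrightarrow{C'C}$, where $N'$ is the intersection of the line through $N$ parallel to $C'C$ with the line through $R$ perpendicular to $RC'$. If $\overline{CR}\notin\{d+\mu,d'\}$ and $C$ lies on some $S_iS'_i$, move to $Q+\overline{CS_i}\,e_1$. Otherwise stay. \emph{Reference}: if neither Commander nor Number is to move, move to the intersection closest to $R$ of the circle with centre $C$ and radius $d$ and the circle with diameter $CN$. Otherwise stay. \textbf{Theorem 4.} A basic TuringMobile consisting of three robots in $\mathbb R^2$ can explore the plane. More precisely, run the algorithm with $g(r)=r+1$ and with the direction function $i$ that, as a function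 of the number $\lfloor r\rfloor$ ($0$ if $r<0$) of moves already made, prescribes one move in direction $u_1$, then two in direction $u_2$, three in direction $u_3$, four in direction $u_1$, and so on cyclically. There is a constant $c>0$ such that the following holds whenever $0<\lambda\le c\mu$, $\mu\le cd$, $d\le c\varepsilon$, $\varepsilon\le cV$. (a) Let $\delta>0$ and consider any execution of three robots with visibility radius $V+\varepsilon$, the only robots in the plane, that starts with the machine at rest storing $0$. Then for every robot and every point $X\in\mathbb R^2$ the robot takes some snapshot from a position at distance at most $V+\varepsilon$ from $X$. Moreover, the stored number counts the moves along the spiral: there are times $0=T_0<T_1<\cdots\to\infty$ such that, at time $T_n$, the machine is at rest, Commander and Reference are at their initial positions translated by $\mu\sum_{j=0}^{n-1}u_{i(j)}$ (with the $u_i$ of the initial position), and Number is at $R+\alpha(n)e_1$, where $R$ is the position of Reference at time $T_n$ and $e_1$ is the initial direction from Reference to Number; so the stored number is $n$. (b) If $d,\mu,\lambda$ are rational, this algorithm (with a fixed convention for snapshots in which the roles or a point named in a rule are not defined, such as staying put if the roles cannot be recognized) is computed, on all snapshots of three points listed in any order, by a real RAM program. -/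

import Mathlib

noncomputable section

/-- The Euclidean plane. -/
abbrev Plane : Type := EuclideanSpace ℝ (Fin 2)

namespace Robots

/-! ### Asynchronous, non-rigid, oblivious, anonymous robots with limited visibility -/

/-- The snapshot of robot `i` when the robots are at `x`: the unordered list of the points that are
occupied by robots (itself included) within distance `vis`, in the local coordinates of robot `i`.
The origin is the position of robot `i`, the axes are given by the linear isometry `fr`
(arbitrary orientation and handedness); the unit of length is common to all robots. -/
def snapshot {n : ℕ} (vis : ℝ) (fr : Plane ≃ₗᵢ[ℝ] Plane) (x : Fin n → Plane) (i : Fin n) :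
    Multiset Plane :=
  open scoped Classical in
  (Finset.univ.filter fun j => dist (x i) (x j) ≤ vis).val.map fun j => fr (x j - x i)

/-- The destination, in absolute coordinates, that robot `i` computes when the robots are at `x`
and all robots run the algorithm `alg`, which maps a snapshot to a destination in local
coordinates and has no other input. -/
def target {n : ℕ} (alg : Multiset Plane → Plane) (vis : ℝ) (fr : Plane ≃ₗᵢ[ℝ] Plane)
    (x : Fin n → Plane) (i : Fin n) : Plane :=
  x i + fr.symm (alg (snapshot vis fr x i))

/-- An infinite execution. `x i t` is the position of robot `i` at time `t ≥ 0`, and `look i k` is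
the time of its `k`-th snapshot. Looks, delays, speeds and stops are chosen independently
for all robots by the scheduler, which may not stop a robot before it has either reached its
destination or covered a distance of at least `δ` in the current movement. -/
structure IsExecution {n : ℕ} (alg : Multiset Plane → Plane) (vis δ : ℝ)
    (fr : Fin n → Plane ≃ₗᵢ[ℝ] Plane) (x : Fin n → ℝ → Plane) (look : Fin n → ℕ → ℝ) : Prop where
  look_nonneg : ∀ i, 0 ≤ look i 0
  look_strictMono : ∀ i, StrictMono (look i)
  look_tendsto : ∀ i, Filter.Tendsto (look i) Filter.atTop Filter.atTop
  /-- A robot stands still before its first snapshot. -/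
  wait : ∀ i, ∀ t ∈ Set.Icc 0 (look i 0), x i t = x i 0
  /-- Between two snapshots a robot moves monotonically along the segment from the
  position of the first snapshot to the destination computed from it. -/
  move : ∀ i k, ∃ s : ℝ → ℝ,
    s (look i k) = 0 ∧
    ContinuousOn s (Set.Icc (look i k) (look i (k + 1))) ∧
    MonotoneOn s (Set.Icc (look i k) (look i (k + 1))) ∧
    ∀ t ∈ Set.Icc (look i k) (look i (k + 1)), s t ≤ 1 ∧
      x i t = AffineMap.lineMap (x i (look i k))
        (target alg vis (fr i) (fun j => x j (look i k)) i) (s t)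
  /-- Fairness of the stops. -/
  progress : ∀ i k,
    x i (look i (k + 1)) = target alg vis (fr i) (fun j => x j (look i k)) i ∨
      δ ≤ dist (x i (look i k)) (x i (look i (k + 1)))

/-- Every robot sees every point of the plane in one of its snapshots. -/
def Explores {n : ℕ} (vis : ℝ) (x : Fin n → ℝ → Plane) (look : Fin n → ℕ → ℝ) : Prop :=
  ∀ i, ∀ p : Plane, ∃ k, dist (x i (look i k)) p ≤ vis

end Robots

/-! ### Real random-access machines -/

namespace RealRAM

/-- Instructions of a real RAM with memory cells `0, 1, 2, …`, each holding a real number.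
Constant operands are integers. -/
inductive Instr : Type
  | const (a : ℕ) (z : ℤ)
  | add (a b c : ℕ)
  | sub (a b c : ℕ)
  | mul (a b c : ℕ)
  | div (a b c : ℕ)
  | sqrt (a b : ℕ)
  | arctan (a b : ℕ)
  | tan (a b : ℕ)
  | load (a b : ℕ)
  | store (a b : ℕ)
  | jump (l : ℕ)
  | jumpLT (a b l : ℕ)
  | halt

/-- A state: the index of the current instruction and the contents of the memory. -/
abbrev State : Type := ℕ × (ℕ → ℝ)

/-- Write a value to a cell and proceed to the next instruction. -/
def put (s : State) (a : ℕ) (v : ℝ) : State := (s.1 + 1, Function.update s.2 a v)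

/-- `Exec I s s'`: instruction `I` turns state `s` into `s'`. The machine is stuck
when it divides by zero, takes the root of a negative number or the tangent at a pole, or
uses as an address a number that is not a natural number. -/
inductive Exec : Instr → State → State → Prop
  | const (a z s) : Exec (.const a z) s (put s a (z : ℝ))
  | add (a b c s) : Exec (.add a b c) s (put s a (s.2 b + s.2 c))
  | sub (a b c s) : Exec (.sub a b c) s (put s a (s.2 b - s.2 c))
  | mul (a b c s) : Exec (.mul a b c) s (put s a (s.2 b * s.2 c))
  | div (a b c s) : s.2 c ≠ 0 → Exec (.div a b c) s (put s a (s.2 b / s.2 c))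
  | sqrt (a b s) : 0 ≤ s.2 b → Exec (.sqrt a b) s (put s a (Real.sqrt (s.2 b)))
  | arctan (a b s) : Exec (.arctan a b) s (put s a (Real.arctan (s.2 b)))
  | tan (a b s) : Real.cos (s.2 b) ≠ 0 → Exec (.tan a b) s (put s a (Real.tan (s.2 b)))
  | load (a b s) (n : ℕ) : s.2 b = (n : ℝ) → Exec (.load a b) s (put s a (s.2 n))
  | store (a b s) (n : ℕ) : s.2 a = (n : ℝ) → Exec (.store a b) s (put s n (s.2 b))
  | jump (l s) : Exec (.jump l) s (l, s.2)
  | jump_lt (a b l s) : s.2 a < s.2 b → Exec (.jumpLT a b l) s (l, s.2)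
  | jump_ge (a b l s) : s.2 b ≤ s.2 a → Exec (.jumpLT a b l) s (s.1 + 1, s.2)

/-- One step of the program `P`. -/
def Step (P : List Instr) (s s' : State) : Prop := ∃ I, P[s.1]? = some I ∧ Exec I s s'

/-- Started at its first instruction with memory `m`, the program `P` reaches a halting instruction
with memory `m'`. -/
def HaltsWith (P : List Instr) (m m' : ℕ → ℝ) : Prop :=
  ∃ l, Relation.ReflTransGen (Step P) (0, m) (l, m') ∧ P[l]? = some Instr.halt

/-- Memory holding a list of points: cell `0` holds their number, cells `2 j + 1` and
`2 j + 2` hold the coordinates of the `j`-th point, all other cells hold `0`. -/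
def input (L : List Plane) : ℕ → ℝ
  | 0 => L.length
  | n + 1 => if n % 2 = 0 then (L.getD (n / 2) 0) 0 else (L.getD (n / 2) 0) 1

/-- The program `P` computes the algorithm `alg` in swarms of `n` robots: from every
snapshot of `n` points, listed in any order, it computes in cells `0` and `1` the coordinates of
the destination. -/
def Computes (P : List Instr) (n : ℕ) (alg : Multiset Plane → Plane) : Prop :=
  ∀ L : List Plane, L.length = n → (0 : Plane) ∈ L →
    ∃ m, HaltsWith P (input L) m ∧
      m 0 = (alg (L : Multiset Plane)) 0 ∧ m 1 = (alg (L : Multiset Plane)) 1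

end RealRAM

/-! ### The basic TuringMobile -/

namespace TuringMobile

/-- The three fixed lengths of the machine: `d` is the distance of Commander and Reference at rest,
`mu` is the length of a move, `lam` is the length of the segment on which Number
records the stored value, and the base and the height of the midway triangles. -/
structure Params : Type where
  d : ℝ
  mu : ℝ
  lam : ℝ

/-- Rotation by a right angle. -/
def rot (v : Plane) : Plane := !₂[-v 1, v 0]

/-- `1` if `v` points to the side of the line spanned by `u` to which `rot u` points (or is on this
line), and `-1` otherwise. -/
def side (u v : Plane) : ℝ := if 0 ≤ u 0 * v 1 - u 1 * v 0 then 1 else -1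

/-- The unit vector in the direction of `v`. -/
def unit (v : Plane) : Plane := ‖v‖⁻¹ • v

/-- The unit vector from Reference towards Number. -/
def axis₁ (N R : Plane) : Plane := unit (N - R)

/-- The unit vector perpendicular to the line through Reference and Number that points to the
side of Commander. -/
def axis₂ (C N R : Plane) : Plane := side (axis₁ N R) (C - R) • rot (axis₁ N R)

/-- The three directions of movement, at `120°` from one another; the first is the one from
Reference to Commander at rest, the second leads away from Number, the third towards it. -/
def dirVec (e₁ e₂ : Plane) : Fin 3 → Plane :=
  ![e₂, (-(√3 / 2)) • e₁ - (1 / 2 : ℝ) • e₂, (√3 / 2) • e₁ - (1 / 2 : ℝ) • e₂]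

/-- The directions of the altitudes of the three midway triangles: `dirVec` turned by a
right angle in the sense that turns `e₁` into `e₂`. -/
def altVec (e₁ e₂ : Plane) : Fin 3 → Plane :=
  ![-e₁, (1 / 2 : ℝ) • e₁ - (√3 / 2) • e₂, (1 / 2 : ℝ) • e₁ + (√3 / 2) • e₂]

/-- The code of a number: the distance of Reference and Number that represents it. -/
def Params.code (p : Params) (r : ℝ) : ℝ := 2 * p.d + Real.arctan r * p.lam / Real.pi

/-- The machine is at rest. -/
structure AtRest (p : Params) (C N R : Plane) : Prop where
  dist_CR : dist C R = p.d
  right_angle : EuclideanGeometry.angle N R C = Real.pi / 2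
  le_dist : 2 * p.d - p.lam / 2 ≤ dist R N
  dist_le : dist R N ≤ 2 * p.d + p.lam / 2

/-- The distance `d'` of Reference from the second and the third final destination. -/
def Params.dmin (p : Params) : ℝ := √(p.d ^ 2 + p.mu ^ 2 - p.d * p.mu)

section Points

variable (p : Params) (C N R : Plane)

/-- Virtual Commander based on Reference and Number: the point closest to `C` among the two
points at distance `d` from `R` on the line through `R` perpendicular to `R N`. -/
def virt : Plane := R + p.d • axis₂ C N R

/-- The direction of the `i`-th move. -/
def uu (i : Fin 3) : Plane := dirVec (axis₁ N R) (axis₂ C N R) i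

/-- The direction of the altitude of the `i`-th midway triangle. -/
def ww (i : Fin 3) : Plane := altVec (axis₁ N R) (axis₂ C N R) i

/-- First vertex on the base of the `i`-th midway triangle. -/
def ptA (i : Fin 3) : Plane := virt p C N R + ((p.mu - p.lam) / 2) • uu C N R i

/-- Foot of the altitude of the `i`-th midway triangle. -/
def ptS (i : Fin 3) : Plane := virt p C N R + (p.mu / 2) • uu C N R i

/-- Apex of the `i`-th midway triangle. -/
def ptS' (i : Fin 3) : Plane := ptS p C N R i + p.lam • ww C N R i

/-- Second vertex on the base of the `i`-th midway triangle. -/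
def ptB (i : Fin 3) : Plane := virt p C N R + ((p.mu + p.lam) / 2) • uu C N R i

/-- The `i`-th final destination. -/
def ptD (i : Fin 3) : Plane := virt p C N R + p.mu • uu C N R i

/-- The end, closer to Reference, of the segment on which Number records the stored value. -/
def ptQ : Plane := R + (2 * p.d - p.lam / 2) • axis₁ N R

end Points

/-- The number stored by the machine when the distance of Number from `Q` is `y` (the inverse of
`Params.code`); arbitrarily `0` outside the range of the code. -/
def Params.decode (p : Params) (y : ℝ) : ℝ :=
  if 0 < y ∧ y < p.lam then Real.tan ((y - p.lam / 2) * Real.pi / p.lam) else 0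

/-- The new distance of Number from `Q` as a function of the old one, when `upd`
maps the stored number to the new number. -/
def Params.shift (p : Params) (upd : ℝ → ℝ) (y : ℝ) : ℝ :=
  p.code (upd (p.decode y)) - (2 * p.d - p.lam / 2)

open scoped Classical in
/-- Destination of Commander; `dir` maps the stored number to the index of the next direction.
The result is `C` if Commander is not tasked to move. -/
def commanderDest (p : Params) (upd : ℝ → ℝ) (dir : ℝ → Fin 3) (C N R : Plane) : Plane :=
  let C' := virt p C N R
  let A := ptA p C N R
  let S := ptS p C N R
  let S' := ptS' p C N R
  let B := ptB p C N R
  let D := ptD p C N R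
  let NQ := dist N (ptQ p N R)
  if C = C' then A (dir (p.decode NQ))
  else if h : ∃ i, C ∈ segment ℝ C' (A i) ∧ C ≠ A i then A h.choose
  else if h : ∃ i, C = A i then S h.choose + p.shift upd NQ • ww C N R h.choose
  else if h : ∃ i, C ∈ convexHull ℝ {A i, S i, S' i} ∧ C ∉ segment ℝ (S i) (S' i) then
    -- the point where the extension of the line from `A` through `C` meets the altitude
    let i := h.choose
    A i + (p.lam / 2 / inner ℝ (C - A i) (uu C N R i)) • (C - A i)
  else if h : ∃ i, C ∈ segment ℝ (S i) (S' i) ∧ NQ = dist C (S i) then B h.choose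
  else if h : ∃ i, C ∈ convexHull ℝ {B i, S i, S' i} ∧ C ∉ segment ℝ (S i) (S' i) ∧ C ≠ B i then
    B h.choose
  else if h : ∃ i, C ∈ segment ℝ (B i) (D i) ∧ C ≠ D i then D h.choose
  else C

/-- Virtual Commander when Commander is in the first final destination, at distance `d + mu`
from Reference. -/
def virtFar (p : Params) (C R : Plane) : Plane := R + (p.d / (p.d + p.mu)) • (C - R)

/-- Virtual Commander when Commander is in the second (`σ = 1`) or the third (`σ = -1`) final
destination, at distance `d'` from Reference: the point at distance `d` from Reference and
`mu` from Commander that is on the same side of the line `R C` as Number if `σ = 1`, and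
on the other side if `σ = -1`. -/
def virtNear (p : Params) (σ : ℝ) (C N R : Plane) : Plane :=
  R + (p.d * (p.d - p.mu / 2) / p.dmin ^ 2) • (C - R)
    + (σ * side (C - R) (N - R) * (√3 / 2 * p.d * p.mu / p.dmin ^ 2)) • rot (C - R)

/-- Final destination of Number, given the Virtual Commander `C'` and the final destination `C`
of Commander. The start of Number's move is where the line through `N` parallel to
`C' C` meets the line through `R` perpendicular to `R C'`; its end is the translate of the
start by the vector from `C'` to `C`. -/
def ptD' (C' C N R : Plane) : Plane :=
  N - (inner ℝ (N - R) (C' - R) / inner ℝ (C - C') (C' - R)) • (C - C') + (C - C')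

open scoped Classical in
/-- Destination of Number. The result is `N` if Number is not tasked to move. -/
def numberDest (p : Params) (C N R : Plane) : Plane :=
  if dist C R = p.d + p.mu ∨ dist C R = p.dmin then
    if dist C R = p.d + p.mu then ptD' (virtFar p C R) C N R
    else if Real.pi / 2 < EuclideanGeometry.angle N R C then ptD' (virtNear p 1 C N R) C N R
    else if EuclideanGeometry.angle N R C < Real.pi / 2 then ptD' (virtNear p (-1) C N R) C N R
    else N
  else if h : ∃ i, C ∈ segment ℝ (ptS p C N R i) (ptS' p C N R i) then
    ptQ p N R + dist C (ptS p C N R h.choose) • axis₁ N R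
  else N

/-- The intersection closest to `R` of the circle with center `C` and radius `d` and the circle with
diameter `C N` (where the two circles meet, that is, for `d ≤ dist C N`). -/
def circleMeet (p : Params) (C N R : Plane) : Plane :=
  C + (p.d ^ 2 / dist C N ^ 2) • (N - C)
    + (side (N - C) (R - C) * (p.d * √(dist C N ^ 2 - p.d ^ 2) / dist C N ^ 2)) • rot (N - C)

open scoped Classical in
/-- Destination of Reference. The result is `R` if Reference is not tasked to move. -/
def referenceDest (p : Params) (upd : ℝ → ℝ) (dir : ℝ → Fin 3) (C N R : Plane) : Plane :=
  if commanderDest p upd dir C N R = C ∧ numberDest p C N R = N ∧ p.d ≤ dist C N then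
    circleMeet p C N R
  else R

/-- The roles of the three robots in a snapshot: Commander and Reference are the two closest robots,
Commander and Number are the two farthest. -/
def Roles (s : Multiset Plane) (C N R : Plane) : Prop :=
  s = {C, N, R} ∧ dist C R < dist R N ∧ dist R N < dist C N

open scoped Classical in
/-- The algorithm of the basic TuringMobile, executed by each of its three members: the destination,
in local coordinates, as a function of the snapshot. The robot itself is at the origin. -/
def algorithm (p : Params) (upd : ℝ → ℝ) (dir : ℝ → Fin 3) (s : Multiset Plane) : Plane :=
  if h : ∃ q : Plane × Plane × Plane, Roles s q.1 q.2.1 q.2.2 then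
    let C := h.choose.1
    let N := h.choose.2.1
    let R := h.choose.2.2
    if C = 0 then commanderDest p upd dir C N R
    else if N = 0 then numberDest p C N R
    else if R = 0 then referenceDest p upd dir C N R
    else 0
  else 0

/-- The index of the direction of move number `n` (moves are counted from `0`) along the
spiral that consists of one move in the first direction, two moves in the second, three in
the third, four in the first, and so on. -/
def spiralDir (n : ℕ) : Fin 3 :=
  Fin.ofNat 3 (Nat.findGreatest (fun k => k * (k + 1) / 2 ≤ n) n)

/-- The exploration algorithm: the stored number is increased by one in each move and
determines the direction of the move. -/
def explore (p : Params) : Multiset Plane → Plane :=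
  algorithm p (fun r => r + 1) (fun r => spiralDir ⌊r⌋₊)

end TuringMobile

end

/-! Part (a) holds because a move is sequential although the robots are asynchronous. It splits into
seven stages: Commander goes to `A`, then to the altitude; Number records the new value; Commander
goes to `B`, then to `D`; Number follows; Reference follows. In each stage, at every point of the
mover's segment before its end, the rules send the mover to the same end and leave the other two
robots where they are. `IsExecution.stage` turns this static fact into dynamics: whatever the
scheduler does, every new snapshot confirms the old destination, each stop before arrival costs at
least `δ` of a finite distance, and when the mover arrives nobody is in motion any more. So stages
can be chained.

The static facts are computed in an orthonormal frame of either orientation, which makes the passage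
to a robot's local coordinates harmless. `Straight` describes the stages with Number on its axis,
`Shifted` those in which Commander and Number are displaced along the move. In coordinates along and
across a direction the rules of Commander become inequalities. Their regions lie in narrow cones
around three directions at 120° (`tt_neg`), so at most one direction is active, and strictly between
the distances `d'` and `d + mu` from Reference (`Params.Region.dist_bounds`), so they do not
interfere with the final destinations. While the stored number is replaced, the new one is
remembered by Commander, first as the slope of its path from `A` and then as its height on the
altitude.

The delicate stage is the last. When Reference moves, the observed axis from Reference to Number
turns, and so does the observed frame. By `wrong_side` Commander then has a negative coordinate,
along or across, for every direction; this is why each midway triangle lies on its particular side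
of the base. `complete_move` collects the stages, and induction gives the times `T n`. The spiral
visits every point of a triangular lattice of mesh `mu` (`exists_spiralPos_eq`), so Reference at
rest comes within `2 * mu` of every point of the plane, and each robot takes a snapshot within `4 *
d` of Reference's starting point during every move.

For part (b), `Comp` is a class of functions closed under arithmetic, case distinction and unbounded
search. The existential choices in the rules are removed by the uniqueness of the active direction,
segments and triangles become inequalities, and the spiral direction is found by two searches. -/

noncomputable section

/-! ### Relocatable code and functions computable by a real RAM -/

namespace RealRAM

/-- The instructions `l` occur in the program `P` from position `o` on. -/
def CodeAt (P : List Instr) (o : ℕ) (l : List Instr) : Prop :=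
  ∀ k < l.length, P[o + k]? = l[k]?

lemma CodeAt.left {P : List Instr} {o : ℕ} {l₁ l₂ : List Instr} (h : CodeAt P o (l₁ ++ l₂)) :
    CodeAt P o l₁ := by
  intro k hk
  rw [h k (by rw [List.length_append]; omega), List.getElem?_append_left hk]

lemma CodeAt.right {P : List Instr} {o : ℕ} {l₁ l₂ : List Instr} (h : CodeAt P o (l₁ ++ l₂)) :
    CodeAt P (o + l₁.length) l₂ := by
  intro k hk
  rw [add_assoc, h (l₁.length + k) (by rw [List.length_append]; omega),
    List.getElem?_append_right (by omega), Nat.add_sub_cancel_left]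

lemma CodeAt.head {P : List Instr} {o : ℕ} {I : Instr} {l : List Instr}
    (h : CodeAt P o (I :: l)) : P[o]? = some I := by
  simpa using h 0 (by simp)

lemma CodeAt.tail {P : List Instr} {o : ℕ} {I : Instr} {l : List Instr}
    (h : CodeAt P o (I :: l)) : CodeAt P (o + 1) l :=
  CodeAt.right (l₁ := [I]) h

/-- Some relocatable code fragment leads, from every memory `m` that satisfies `A`, to a memory `m'`
with `Φ m m'`. -/
def Realizes (A : (ℕ → ℝ) → Prop) (Φ : (ℕ → ℝ) → (ℕ → ℝ) → Prop) : Prop :=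
  ∃ n : ℕ, ∀ o : ℕ, ∃ l : List Instr, l.length = n ∧ ∀ P, CodeAt P o l → ∀ m, A m →
    ∃ m', Relation.ReflTransGen (Step P) (o, m) (o + n, m') ∧ Φ m m'

variable {A B : (ℕ → ℝ) → Prop} {Φ Ψ : (ℕ → ℝ) → (ℕ → ℝ) → Prop}

lemma Realizes.mono (h : Realizes A Φ) (hB : ∀ m, B m → A m)
    (hΨ : ∀ m m', B m → Φ m m' → Ψ m m') : Realizes B Ψ := by
  obtain ⟨n, h⟩ := h
  refine ⟨n, fun o => ?_⟩
  obtain ⟨l, hl, h⟩ := h o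
  refine ⟨l, hl, fun P hP m hm => ?_⟩
  obtain ⟨m', h1, h2⟩ := h P hP m (hB m hm)
  exact ⟨m', h1, hΨ m m' hm h2⟩

lemma Realizes.seq (h₁ : Realizes A Φ) (h₂ : Realizes B Ψ) (hB : ∀ m m', A m → Φ m m' → B m') :
    Realizes A fun m m'' => ∃ m', Φ m m' ∧ Ψ m' m'' := by
  obtain ⟨n₁, h₁⟩ := h₁
  obtain ⟨n₂, h₂⟩ := h₂
  refine ⟨n₁ + n₂, fun o => ?_⟩
  obtain ⟨l₁, hl₁, h₁⟩ := h₁ o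
  obtain ⟨l₂, hl₂, h₂⟩ := h₂ (o + n₁)
  refine ⟨l₁ ++ l₂, by simp [hl₁, hl₂], fun P hP m hm => ?_⟩
  obtain ⟨m', r1, p1⟩ := h₁ P hP.left m hm
  obtain ⟨m'', r2, p2⟩ := h₂ P (by simpa [hl₁] using hP.right) m' (hB m m' hm p1)
  exact ⟨m'', by rw [← add_assoc]; exact r1.trans r2, m', p1, p2⟩

lemma Realizes.instr (I : Instr) (h : ∀ o m, A m → ∃ m', Exec I (o, m) (o + 1, m') ∧ Φ m m') :
    Realizes A Φ := by
  refine ⟨1, fun o => ⟨[I], rfl, fun P hP m hm => ?_⟩⟩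
  obtain ⟨m', h1, h2⟩ := h o m hm
  exact ⟨m', Relation.ReflTransGen.single ⟨I, hP.head, h1⟩, h2⟩

/-- Layout: conditional jump, code of the negative case, jump to the end, code of the positive case.
Jump addresses are absolute, which is why a fragment may depend on its offset while its length may
not. -/
lemma Realizes.ite (a c : ℕ) (h₁ : Realizes (fun m => A m ∧ m a < m c) Φ)
    (h₂ : Realizes (fun m => A m ∧ m c ≤ m a) Φ) : Realizes A Φ := by
  obtain ⟨n₁, h₁⟩ := h₁
  obtain ⟨n₂, h₂⟩ := h₂
  refine ⟨1 + (n₂ + (1 + n₁)), fun o => ?_⟩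
  obtain ⟨l₂, hl₂, h₂⟩ := h₂ (o + 1)
  obtain ⟨l₁, hl₁, h₁⟩ := h₁ (o + 1 + n₂ + 1)
  refine ⟨.jumpLT a c (o + 1 + n₂ + 1) :: (l₂ ++ .jump (o + 1 + n₂ + 1 + n₁) :: l₁),
    by simp [hl₁, hl₂]; omega, fun P hP m hm => ?_⟩
  have c2 := hP.tail.left
  have c1 := hP.tail.right
  rw [hl₂] at c1
  rcases lt_or_ge (m a) (m c) with hlt | hge
  · obtain ⟨m', r, p⟩ := h₁ P c1.tail m ⟨hm, hlt⟩
    refine ⟨m', Relation.ReflTransGen.head ⟨_, hP.head, Exec.jump_lt _ _ _ _ hlt⟩ ?_, p⟩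
    convert r using 2
    omega
  · obtain ⟨m', r, p⟩ := h₂ P c2 m ⟨hm, hge⟩
    refine ⟨m', Relation.ReflTransGen.head ⟨_, hP.head, Exec.jump_ge _ _ _ _ hge⟩
      (r.tail ⟨_, c1.head, ?_⟩), p⟩
    have := Exec.jump (o + 1 + n₂ + 1 + n₁) (o + 1 + n₂, m')
    convert this using 2
    omega

/-- The test follows the body, so one backward jump suffices. `A` is the loop invariant and `v` a
variant that bounds the number of rounds; `Ψ` is carried backwards from the last round to the first.
-/
lemma Realizes.doWhile (a c : ℕ) (body : Realizes A Φ) (v : (ℕ → ℝ) → ℕ)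
    (again : ∀ m m', A m → Φ m m' → m' a < m' c → A m' ∧ v m' < v m)
    (stop_rel : ∀ m m', A m → Φ m m' → m' c ≤ m' a → Ψ m m')
    (again_rel : ∀ m m' m'', A m → Φ m m' → m' a < m' c → Ψ m' m'' → Ψ m m'') :
    Realizes A Ψ := by
  obtain ⟨n, body⟩ := body
  refine ⟨n + 1, fun o => ?_⟩
  obtain ⟨l, hl, body⟩ := body o
  refine ⟨l ++ [.jumpLT a c o], by simp [hl], fun P hP m hm => ?_⟩
  have hj := hP.right.head
  rw [hl] at hj
  induction hv : v m using Nat.strong_induction_on generalizing m with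
  | _ k ih =>
    obtain ⟨m', r, p⟩ := body P hP.left m hm
    rcases lt_or_ge (m' a) (m' c) with hlt | hge
    · obtain ⟨hA, hlt'⟩ := again m m' hm p hlt
      obtain ⟨m'', r', p'⟩ := ih (v m') (hv ▸ hlt') m' hA rfl
      exact ⟨m'', (r.tail ⟨_, hj, Exec.jump_lt _ _ _ _ hlt⟩).trans r',
        again_rel m m' m'' hm p hlt p'⟩
    · exact ⟨m', r.tail ⟨_, hj, Exec.jump_ge _ _ _ _ hge⟩, stop_rel m m' hm p hge⟩

/-- `Comp g`: the function `g` can be evaluated by a code fragment that finds the arguments in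
arbitrary cells below `b`, writes the value to cell `b` and leaves the cells below `b` alone. -/
def Comp {ι : Type} (g : (ι → ℝ) → ℝ) : Prop :=
  ∀ (loc : ι → ℕ) (b : ℕ), (∀ i, loc i < b) →
    Realizes (fun _ => True) fun m m' => m' b = g (fun i => m (loc i)) ∧ ∀ j < b, m' j = m j

open scoped Classical in
/-- A property that can be decided by a code fragment. -/
def CompP {ι : Type} (p : (ι → ℝ) → Prop) : Prop := Comp fun v => if p v then 1 else 0

variable {ι κ : Type} {f g : (ι → ℝ) → ℝ} {p q : (ι → ℝ) → Prop}

lemma Comp.var (i : ι) : Comp fun v : ι → ℝ => v i := by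
  intro loc b hb
  -- There is no copy instruction: cell `b` is cleared and the argument is added to it.
  refine Realizes.mono (A := fun _ => True) (Realizes.seq
    (Φ := fun m m' => m' = Function.update m b 0)
    (Ψ := fun m m' => m' = Function.update m b (m (loc i) + m b)) (B := fun _ => True)
    (Realizes.instr (.const b 0) fun o m _ => ⟨_, Exec.const _ _ _, by simp⟩)
    (Realizes.instr (.add b (loc i) b) fun o m _ => ⟨_, Exec.add _ _ _ _, rfl⟩)
    fun _ _ _ _ => trivial) (fun _ _ => trivial) ?_
  rintro m m'' - ⟨m', rfl, rfl⟩
  have := hb i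
  refine ⟨by simp [this.ne], fun j hj => by simp [hj.ne]⟩

lemma Comp.rename (h : Comp g) (r : ι → κ) : Comp fun v : κ → ℝ => g fun i => v (r i) :=
  fun loc b hb => h (fun i => loc (r i)) b fun i => hb (r i)

lemma Comp.int (z : ℤ) : Comp fun _ : ι → ℝ => (z : ℝ) := by
  intro loc b hb
  refine Realizes.instr (.const b z) fun o m _ => ⟨_, Exec.const _ _ _, by simp, ?_⟩
  intro j hj
  simp [hj.ne]

/-- Evaluation of one function, followed by an operation on its value. -/
lemma Comp.unary (F : ℝ → ℝ) (D : ℝ → Prop) (I : ℕ → Instr)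
    (hI : ∀ b o m, D (m b) → Exec (I b) (o, m) (o + 1, Function.update m b (F (m b))))
    (hf : Comp f) (hD : ∀ v, D (f v)) : Comp fun v => F (f v) := by
  intro loc b hb
  refine Realizes.mono (Realizes.seq (hf loc b hb)
    (Realizes.instr (A := fun m => D (m b)) (Φ := fun m m' => m' = Function.update m b (F (m b)))
      (I b) fun o m hm => ⟨_, hI b o m hm, rfl⟩) ?_) (fun _ _ => trivial) ?_
  · rintro m m' - ⟨h, -⟩
    rw [h]
    exact hD _
  · rintro m m'' - ⟨m', ⟨h1, h2⟩, rfl⟩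
    refine ⟨by simp [h1], fun j hj => by simp [hj.ne, h2 j hj]⟩

/-- The second evaluation works from cell `b + 1` on. It therefore keeps the first value, and it
finds the arguments unchanged because the first evaluation respected the cells below `b`. -/
lemma Comp.pair (hf : Comp f) (hg : Comp g) (loc : ι → ℕ) (b : ℕ) (hb : ∀ i, loc i < b) :
    Realizes (fun _ => True) fun m m' => m' b = f (fun i => m (loc i)) ∧
      m' (b + 1) = g (fun i => m (loc i)) ∧ ∀ j < b, m' j = m j := by
  refine Realizes.mono (Realizes.seq (hf loc b hb)
    (hg loc (b + 1) fun i => (hb i).trans b.lt_succ_self) fun _ _ _ _ => trivial)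
    (fun _ _ => trivial) ?_
  rintro m m'' - ⟨m', ⟨h1, h2⟩, h3, h4⟩
  refine ⟨by rw [h4 b (by omega), h1], ?_, fun j hj => by rw [h4 j (by omega), h2 j hj]⟩
  rw [h3]
  congr 1
  funext i
  exact h2 _ (hb i)

/-- Evaluation of two functions, followed by an operation on their values. -/
lemma Comp.binary (F : ℝ → ℝ → ℝ) (D : ℝ → Prop) (I : ℕ → Instr)
    (hI : ∀ b o m, D (m (b + 1)) →
      Exec (I b) (o, m) (o + 1, Function.update m b (F (m b) (m (b + 1)))))
    (hf : Comp f) (hg : Comp g) (hD : ∀ v, D (g v)) : Comp fun v => F (f v) (g v) := by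
  intro loc b hb
  refine Realizes.mono (Realizes.seq (Comp.pair hf hg loc b hb)
    (Realizes.instr (A := fun m => D (m (b + 1)))
      (Φ := fun m m' => m' = Function.update m b (F (m b) (m (b + 1))))
      (I b) fun o m hm => ⟨_, hI b o m hm, rfl⟩) ?_) (fun _ _ => trivial) ?_
  · rintro m m' - ⟨-, h, -⟩
    rw [h]
    exact hD _
  · rintro m m'' - ⟨m', ⟨h1, h2, h3⟩, rfl⟩
    refine ⟨by simp [h1, h2], fun j hj => by simp [hj.ne, h3 j hj]⟩

lemma Comp.add (hf : Comp f) (hg : Comp g) : Comp fun v => f v + g v :=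
  Comp.binary (· + ·) (fun _ => True) (fun b => .add b b (b + 1))
    (fun _ _ _ _ => Exec.add _ _ _ _) hf hg fun _ => trivial

lemma Comp.sub (hf : Comp f) (hg : Comp g) : Comp fun v => f v - g v :=
  Comp.binary (· - ·) (fun _ => True) (fun b => .sub b b (b + 1))
    (fun _ _ _ _ => Exec.sub _ _ _ _) hf hg fun _ => trivial

lemma Comp.mul (hf : Comp f) (hg : Comp g) : Comp fun v => f v * g v :=
  Comp.binary (· * ·) (fun _ => True) (fun b => .mul b b (b + 1))
    (fun _ _ _ _ => Exec.mul _ _ _ _) hf hg fun _ => trivial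

lemma Comp.arctan (hf : Comp f) : Comp fun v => Real.arctan (f v) :=
  Comp.unary Real.arctan (fun _ => True) (fun b => .arctan b b)
    (fun _ _ _ _ => Exec.arctan _ _ _) hf fun _ => trivial

open scoped Classical in
lemma Comp.ite_lt {f' g' : (ι → ℝ) → ℝ} (hf : Comp f) (hg : Comp g) (hf' : Comp f')
    (hg' : Comp g') : Comp fun v => if f v < g v then f' v else g' v := by
  intro loc b hb
  have hb2 : ∀ i, loc i < b + 2 := fun i => (hb i).trans (by omega)
  have copy : ∀ (k : (ι → ℝ) → ℝ), Comp k → Realizes (fun _ => True) fun m m' =>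
      m' b = k (fun i => m (loc i)) ∧ ∀ j < b, m' j = m j := fun k hk => hk loc b hb
  refine Realizes.mono (A := fun _ => True) (Realizes.seq
    (Φ := fun m m' => m' b = f (fun i => m (loc i)) ∧
      m' (b + 1) = g (fun i => m (loc i)) ∧ ∀ j < b, m' j = m j) (B := fun _ => True)
    (Ψ := fun m m' => (m' b = if m b < m (b + 1) then f' (fun i => m (loc i)) else
      g' (fun i => m (loc i))) ∧ ∀ j < b, m' j = m j)
    (Comp.pair hf hg loc b hb) ?_ fun _ _ _ _ => trivial) (fun _ _ => trivial) ?_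
  · refine Realizes.ite b (b + 1) ?_ ?_
    · refine (copy f' hf').mono (fun _ _ => trivial) ?_
      rintro m m' ⟨-, h⟩ ⟨h1, h2⟩
      exact ⟨by rw [if_pos h, h1], h2⟩
    · refine (copy g' hg').mono (fun _ _ => trivial) ?_
      rintro m m' ⟨-, h⟩ ⟨h1, h2⟩
      exact ⟨by rw [if_neg h.not_gt, h1], h2⟩
  · rintro m m'' - ⟨m', ⟨h1, h2, h3⟩, h4, h5⟩
    have : (fun i => m' (loc i)) = fun i => m (loc i) := funext fun i => h3 _ (hb i)
    exact ⟨by rw [h4, h1, h2, this], fun j hj => by rw [h5 j hj, h3 j hj]⟩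

lemma Comp.congr (hf : Comp f) (h : ∀ v, g v = f v) : Comp g := by
  rwa [show g = f from funext h]

lemma CompP.congr (hp : CompP p) (h : ∀ v, q v ↔ p v) : CompP q := by
  rwa [show q = p from funext fun v => propext (h v)]

lemma Comp.nat (n : ℕ) : Comp fun _ : ι → ℝ => (n : ℝ) := (Comp.int n).congr fun _ => by simp

lemma Comp.zero : Comp fun _ : ι → ℝ => (0 : ℝ) := (Comp.int 0).congr fun _ => by simp

lemma Comp.one : Comp fun _ : ι → ℝ => (1 : ℝ) := (Comp.int 1).congr fun _ => by simp

lemma Comp.ofNat (n : ℕ) [n.AtLeastTwo] : Comp fun _ : ι → ℝ => (OfNat.ofNat n : ℝ) :=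
  (Comp.nat n).congr fun _ => (Nat.cast_ofNat (R := ℝ)).symm

lemma Comp.neg (hf : Comp f) : Comp fun v => -f v := (Comp.zero.sub hf).congr fun _ => by simp

lemma CompP.lt (hf : Comp f) (hg : Comp g) : CompP fun v => f v < g v :=
  Comp.ite_lt hf hg Comp.one Comp.zero

open scoped Classical in
lemma Comp.ite (hp : CompP p) (hf : Comp f) (hg : Comp g) :
    Comp fun v => if p v then f v else g v :=
  (Comp.ite_lt Comp.zero hp hf hg).congr fun v => by by_cases h : p v <;> simp [h]

/-- Like `Comp.ite`, for conditions that are only known to be decidable. -/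
lemma Comp.ite' {_ : ∀ v, Decidable (p v)} (hp : CompP p) (hf : Comp f) (hg : Comp g) :
    Comp fun v => if p v then f v else g v :=
  (Comp.ite hp hf hg).congr fun v => by by_cases h : p v <;> simp [h]

lemma CompP.not (hp : CompP p) : CompP fun v => ¬ p v :=
  (Comp.one.sub hp).congr fun v => by by_cases h : p v <;> simp [h]

lemma CompP.and (hp : CompP p) (hq : CompP q) : CompP fun v => p v ∧ q v :=
  (Comp.mul hp hq).congr fun v => by by_cases h : p v <;> by_cases h' : q v <;> simp [h, h']

lemma CompP.or (hp : CompP p) (hq : CompP q) : CompP fun v => p v ∨ q v :=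
  (hp.not.and hq.not).not.congr fun v => by tauto

lemma CompP.le (hf : Comp f) (hg : Comp g) : CompP fun v => f v ≤ g v :=
  (CompP.lt hg hf).not.congr fun _ => not_lt.symm

lemma CompP.eq (hf : Comp f) (hg : Comp g) : CompP fun v => f v = g v :=
  ((CompP.le hf hg).and (CompP.le hg hf)).congr fun _ => le_antisymm_iff

/-- The machine is stuck on a zero divisor, whereas `/` is total with value `0` there. The divisor
is replaced by `1` where it vanishes, and the result is corrected afterwards. The same device serves
for `Comp.sqrt` and `Comp.tan`. -/
lemma Comp.div (hf : Comp f) (hg : Comp g) : Comp fun v => f v / g v := by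
  have hz := CompP.eq hg Comp.zero
  have h1 : Comp fun v => open scoped Classical in if g v = 0 then 1 else g v :=
    Comp.ite hz Comp.one hg
  have h2 := Comp.binary (· / ·) (fun x => x ≠ 0) (fun b => .div b b (b + 1))
    (fun _ _ _ h => Exec.div _ _ _ _ h) hf h1 fun v => by by_cases h : g v = 0 <;> simp [h]
  refine (Comp.ite hz Comp.zero h2).congr fun v => ?_
  by_cases h : g v = 0 <;> simp [h]

lemma Comp.inv (hf : Comp f) : Comp fun v => (f v)⁻¹ :=
  (Comp.one.div hf).congr fun _ => by simp

/-- Programs have only integer constants; this is the point where the rationality of the three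
lengths enters. -/
lemma Comp.rat (r : ℚ) : Comp fun _ : ι → ℝ => (r : ℝ) :=
  ((Comp.int r.num).div (Comp.nat r.den)).congr fun _ => by exact_mod_cast (Rat.num_div_den r).symm

lemma Comp.sqrt (hf : Comp f) : Comp fun v => √(f v) := by
  have h1 : Comp fun v => open scoped Classical in if 0 ≤ f v then f v else 0 :=
    Comp.ite (CompP.le Comp.zero hf) hf Comp.zero
  refine (Comp.unary Real.sqrt (fun x => 0 ≤ x) (fun b => .sqrt b b)
    (fun _ _ _ h => Exec.sqrt _ _ _ h) h1 fun v => ?_).congr fun v => ?_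
  · by_cases h : 0 ≤ f v <;> simp [h]
  · by_cases h : 0 ≤ f v
    · simp [h]
    · simp [h, Real.sqrt_eq_zero_of_nonpos (not_le.1 h).le]

lemma Comp.sq (hf : Comp f) : Comp fun v => f v ^ 2 := (hf.mul hf).congr fun _ => _root_.sq _

lemma Comp.pi : Comp fun _ : ι → ℝ => Real.pi :=
  ((Comp.ofNat 4).mul Comp.one.arctan).congr fun _ => by rw [Real.arctan_one]; ring

open scoped Classical in
lemma Comp.tan (hf : Comp f) :
    Comp fun v => if -(Real.pi / 2) < f v ∧ f v < Real.pi / 2 then Real.tan (f v) else 0 := by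
  have hp := (CompP.lt (Comp.pi.div (Comp.ofNat 2)).neg hf).and
    (CompP.lt hf (Comp.pi.div (Comp.ofNat 2)))
  refine (Comp.unary Real.tan (fun x => Real.cos x ≠ 0) (fun b => .tan b b)
    (fun _ _ _ h => Exec.tan _ _ _ h) (Comp.ite hp hf Comp.zero) fun v => ?_).congr fun v => ?_
  · by_cases h : -(Real.pi / 2) < f v ∧ f v < Real.pi / 2
    · rw [if_pos h]
      exact (Real.cos_pos_of_mem_Ioo h).ne'
    · simp [h]
  · by_cases h : -(Real.pi / 2) < f v ∧ f v < Real.pi / 2 <;> simp [h]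

/-- Extend an argument list by one value. -/
def cons (k : ℝ) (v : ι → ℝ) : Option ι → ℝ := fun o => o.elim k v

open scoped Classical in
/-- Unbounded search. -/
lemma Comp.find {T : (Option ι → ℝ) → Prop} (hT : CompP T)
    (hex : ∀ v : ι → ℝ, ∃ k : ℕ, T (cons k v)) :
    Comp fun v : ι → ℝ => (Nat.find (hex v) : ℝ) := by
  intro loc b hb
  set env : (ℕ → ℝ) → ι → ℝ := fun m i => m (loc i) with henv
  have env_congr : ∀ m m' : ℕ → ℝ, (∀ j < b, m' j = m j) → env m' = env m :=
    fun m m' h => funext fun i => h _ (hb i)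
  have incr : Realizes (fun _ => True) fun m m' => m' b = m b + 1 ∧ ∀ j < b, m' j = m j := by
    refine Realizes.mono (Realizes.seq (A := fun _ => True)
      (Realizes.instr (Φ := fun m m' => m' = Function.update m (b + 1) ((1 : ℤ) : ℝ))
        (.const (b + 1) 1) fun o m _ => ⟨_, Exec.const _ _ _, rfl⟩)
      (Realizes.instr (A := fun _ => True)
        (Φ := fun m m' => m' = Function.update m b (m b + m (b + 1)))
        (.add b b (b + 1)) fun o m _ => ⟨_, Exec.add _ _ _ _, rfl⟩)
      fun _ _ _ _ => trivial) (fun _ _ => trivial) ?_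
    rintro m m'' - ⟨m', rfl, rfl⟩
    refine ⟨by simp, fun j hj => ?_⟩
    have : j ≠ b + 1 := by omega
    simp [hj.ne, this]
  have test : Realizes (fun _ => True) fun m m' =>
      (m' (b + 1) = if T (cons (m b) (env m)) then 1 else 0) ∧ ∀ j < b + 1, m' j = m j := by
    refine (hT (fun o => o.elim b loc) (b + 1) ?_).mono (fun _ _ => trivial) ?_
    · rintro (_ | i)
      · exact b.lt_succ_self
      · exact (hb i).trans b.lt_succ_self
    · rintro m m' - ⟨h1, h2⟩
      refine ⟨?_, h2⟩
      rw [h1]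
      have : (fun i : Option ι => m (i.elim b loc)) = cons (m b) (env m) := by
        funext o
        cases o <;> rfl
      rw [this]
  have body : Realizes (fun m => ∃ k : ℕ, m b + 1 = k ∧ ∀ j < k, ¬ T (cons j (env m)))
      fun m m' => m' b = m b + 1 ∧
        (m' (b + 1) = if T (cons (m b + 1) (env m)) then 1 else 0) ∧
        m' (b + 2) = 1 ∧ ∀ j < b, m' j = m j := by
    refine Realizes.mono (Realizes.seq (incr.seq test fun _ _ _ _ => trivial)
      (Realizes.instr (A := fun _ => True)
        (Φ := fun m m' => m' = Function.update m (b + 2) ((1 : ℤ) : ℝ))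
        (.const (b + 2) 1) fun o m _ => ⟨_, Exec.const _ _ _, rfl⟩)
      fun _ _ _ _ => trivial) (fun _ _ => trivial) ?_
    rintro m m₃ - ⟨m₂, ⟨m₁, ⟨h1, h2⟩, h3, h4⟩, rfl⟩
    rw [h1, env_congr m m₁ h2] at h3
    refine ⟨?_, ?_, by simp, fun j hj => ?_⟩
    · simp [h4 b b.lt_succ_self, h1]
    · simp [h3]
    · have : j ≠ b + 2 := by omega
      simp [this, h4 j (by omega), h2 j hj]
  -- Invariant: the next candidate `m b + 1` is a natural number, and all smaller ones have failed
  -- the test. The variant is the distance from this candidate to the solution.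
  have loop : Realizes (fun m => ∃ k : ℕ, m b + 1 = k ∧ ∀ j < k, ¬ T (cons j (env m)))
      fun m m' => m' b = (Nat.find (hex (env m)) : ℝ) ∧ ∀ j < b, m' j = m j := by
    refine Realizes.doWhile (b + 1) (b + 2) body
      (fun m => Nat.find (hex (env m)) - ⌊m b + 1⌋₊) ?_ ?_ ?_
    · rintro m m' ⟨k, hk, hj⟩ ⟨h1, h2, h3, h4⟩ hlt
      have hT : ¬ T (cons (k : ℝ) (env m)) := by
        intro h
        rw [← hk] at h
        rw [h2, h3, if_pos h] at hlt
        exact lt_irrefl _ hlt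
      have hlt' : k < Nat.find (hex (env m)) := by
        rw [Nat.lt_find_iff]
        intro j hjk
        rcases hjk.lt_or_eq with h | rfl
        · exact hj j h
        · exact hT
      refine ⟨⟨k + 1, by rw [h1, hk]; push_cast; rfl, fun j hjk => ?_⟩, ?_⟩
      · rw [env_congr m m' h4]
        rcases (Nat.lt_succ_iff.1 hjk).lt_or_eq with h | rfl
        · exact hj j h
        · exact hT
      · simp only [env_congr m m' h4]
        have e1 : ⌊m b + 1⌋₊ = k := by rw [hk, Nat.floor_natCast]
        have e2 : ⌊m' b + 1⌋₊ = k + 1 := by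
          rw [h1, hk]; exact_mod_cast Nat.floor_natCast (R := ℝ) (k + 1)
        omega
    · rintro m m' ⟨k, hk, hj⟩ ⟨h1, h2, h3, h4⟩ hge
      refine ⟨?_, h4⟩
      have hT : T (cons (k : ℝ) (env m)) := by
        by_contra h
        rw [← hk] at h
        rw [h2, h3, if_neg h] at hge
        linarith
      have : Nat.find (hex (env m)) = k := (Nat.find_eq_iff _).2 ⟨hT, hj⟩
      rw [this, h1, hk]
    · rintro m m' m'' - ⟨-, -, -, h4⟩ - ⟨h5, h6⟩
      exact ⟨by simp only [h5, env_congr m m' h4], fun j hj => by rw [h6 j hj, h4 j hj]⟩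
  -- The counter starts at `-1` because the body increments it before testing.
  refine Realizes.mono (Realizes.seq (A := fun _ => True)
    (Realizes.instr (Φ := fun m m' => m' = Function.update m b ((-1 : ℤ) : ℝ))
      (.const b (-1)) fun o m _ => ⟨_, Exec.const _ _ _, rfl⟩)
    loop ?_) (fun _ _ => trivial) ?_
  · rintro m m' - rfl
    exact ⟨0, by simp, fun j hj => absurd hj (Nat.not_lt_zero j)⟩
  · rintro m m'' - ⟨m', rfl, h1, h2⟩
    have h : ∀ j < b, Function.update m b ((-1 : ℤ) : ℝ) j = m j := fun j hj => by simp [hj.ne]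
    refine ⟨?_, fun j hj => by rw [h2 j hj, h j hj]⟩
    rw [h1]
    simp only [env_congr m _ h]

/-- A pair of computable functions of the six coordinates of three points is computed by a
program that finds the coordinates in cells `1` to `6`. -/
lemma exists_program {f g : (Fin 6 → ℝ) → ℝ} (hf : Comp f) (hg : Comp g) :
    ∃ P : List Instr, ∀ m : ℕ → ℝ, ∃ m', HaltsWith P m m' ∧
      m' 0 = f (fun i => m (i + 1)) ∧ m' 1 = g (fun i => m (i + 1)) := by
  have key : Realizes (fun _ => True) fun m m' =>
      m' 0 = f (fun i : Fin 6 => m (i + 1)) ∧ m' 1 = g (fun i : Fin 6 => m (i + 1)) := by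
    -- The values arise in cells `7` and `8`, above the input. They are copied to cells `0` and `1`
    -- only at the end, with cell `9` as a zero summand.
    have h1 := Comp.pair hf hg (fun i : Fin 6 => (i : ℕ) + 1) 7 fun i => by omega
    have zero : Realizes (fun _ => True) fun m m' => m' = Function.update m 9 0 :=
      Realizes.instr (.const 9 0) fun o m _ => ⟨_, Exec.const _ _ _, by simp⟩
    have copy : ∀ a c : ℕ, Realizes (fun _ => True) fun m m' =>
        m' = Function.update m a (m c + m 9) := fun a c =>
      Realizes.instr (.add a c 9) fun o m _ => ⟨_, Exec.add _ _ _ _, rfl⟩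
    refine Realizes.mono (((h1.seq zero fun _ _ _ _ => trivial).seq (copy 0 7)
      fun _ _ _ _ => trivial).seq (copy 1 8) fun _ _ _ _ => trivial) (fun _ _ => trivial) ?_
    rintro m m₄ - ⟨m₃, ⟨m₂, ⟨m₁, ⟨h1, h2, -⟩, rfl⟩, rfl⟩, rfl⟩
    constructor
    · simpa using h1
    · simpa using h2
  obtain ⟨n, h⟩ := key
  obtain ⟨l, hl, h⟩ := h 0
  refine ⟨l ++ [.halt], fun m => ?_⟩
  obtain ⟨m', r, p1, p2⟩ := h (l ++ [.halt]) (fun k hk => by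
    rw [zero_add, List.getElem?_append_left hk]) m trivial
  exact ⟨m', ⟨0 + n, r, by simp [← hl]⟩, p1, p2⟩

end RealRAM

end

/-! ### The spiral in the triangular lattice -/

noncomputable section

namespace TuringMobile

/-- The legs begin at the triangular numbers, which increase, so the two bounds single out the leg.
`findGreatest` searches only up to `n`, so `k ≤ n` has to be checked as well. -/
lemma spiralDir_eq {n k : ℕ} (h₁ : k * (k + 1) / 2 ≤ n) (h₂ : n < (k + 1) * (k + 2) / 2) :
    spiralDir n = Fin.ofNat 3 k := by
  have mono : Monotone fun j : ℕ => j * (j + 1) / 2 := fun a b h => by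
    exact Nat.div_le_div_right (Nat.mul_le_mul h (Nat.succ_le_succ h))
  have hk : k ≤ n := by
    refine le_trans ?_ h₁
    rw [Nat.le_div_iff_mul_le (by norm_num)]
    rcases Nat.eq_zero_or_pos k with rfl | hk
    · simp
    · exact Nat.mul_le_mul_left k (by omega)
  have : Nat.findGreatest (fun j => j * (j + 1) / 2 ≤ n) n = k := by
    rw [Nat.findGreatest_eq_iff]
    refine ⟨hk, fun _ => h₁, fun j hj _ hle => ?_⟩
    have := mono (show k + 1 ≤ j from hj)
    simp only at this
    have e : (k + 1) * (k + 1 + 1) / 2 = (k + 1) * (k + 2) / 2 := rfl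
    omega
  rw [spiralDir, this]

/-- The position on the spiral after `n` moves of length one. -/
def spiralPos (u : Fin 3 → Plane) (n : ℕ) : Plane := ∑ j ∈ Finset.range n, u (spiralDir j)

lemma triangle_succ (k : ℕ) : (k + 1) * (k + 2) / 2 = k * (k + 1) / 2 + (k + 1) := by
  rw [show (k + 1) * (k + 2) = k * (k + 1) + (k + 1) * 2 by ring,
    Nat.add_mul_div_right _ _ (by norm_num)]

lemma spiralPos_leg (u : Fin 3 → Plane) (k t : ℕ) (ht : t ≤ k + 1) :
    spiralPos u (k * (k + 1) / 2 + t) =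
      spiralPos u (k * (k + 1) / 2) + (t : ℝ) • u (Fin.ofNat 3 k) := by
  induction t with
  | zero => simp
  | succ t ih =>
    have := triangle_succ k
    rw [← add_assoc, spiralPos, Finset.sum_range_succ, ← spiralPos, ih (by omega),
      spiralDir_eq (k := k) (by omega) (by omega)]
    push_cast
    module

/-- The legs `3m`, `3m + 1`, `3m + 2` have `3m + 1`, `3m + 2`, `3m + 3` moves. As the three
directions add up to zero, the net effect of such a round is `-2 u₀ - u₁`, independently of `m`. -/
lemma spiralPos_round (u : Fin 3 → Plane) (hu : u 0 + u 1 + u 2 = 0) (m : ℕ) :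
    spiralPos u (3 * m * (3 * m + 1) / 2) = (-2 * m : ℝ) • u 0 - (m : ℝ) • u 1 := by
  have h2 : u 2 = -u 0 - u 1 := by
    rw [eq_sub_iff_add_eq, eq_neg_iff_add_eq_zero, ← hu]
    abel
  induction m with
  | zero => simp [spiralPos]
  | succ m ih =>
    have e0 : Fin.ofNat 3 (3 * m) = 0 := by
      apply Fin.ext; simp
    have e1 : Fin.ofNat 3 (3 * m + 1) = 1 := by
      apply Fin.ext; simp [Fin.ofNat]
    have e2 : Fin.ofNat 3 (3 * m + 2) = 2 := by
      apply Fin.ext; simp [Fin.ofNat]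
    have s0 := spiralPos_leg u (3 * m) (3 * m + 1) le_rfl
    have s1 := spiralPos_leg u (3 * m + 1) (3 * m + 2) le_rfl
    have s2 := spiralPos_leg u (3 * m + 2) (3 * m + 3) le_rfl
    rw [← triangle_succ, ih, e0] at s0
    rw [← triangle_succ, s0, e1] at s1
    rw [← triangle_succ, s1, e2] at s2
    rw [show 3 * (m + 1) * (3 * (m + 1) + 1) / 2 = (3 * m + 2 + 1) * (3 * m + 2 + 2) / 2 by
      ring_nf, s2, h2]
    push_cast
    module

/-- The spiral visits every point of the triangular lattice. -/
lemma exists_spiralPos_eq (u : Fin 3 → Plane) (hu : u 0 + u 1 + u 2 = 0) (a b : ℤ) :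
    ∃ n, spiralPos u n = (a : ℝ) • u 0 + (b : ℝ) • u 1 := by
  have h2 : u 2 = -u 0 - u 1 := by
    rw [eq_sub_iff_add_eq, eq_neg_iff_add_eq_zero, ← hu]
    abel
  have row : ∀ m t : ℕ, t ≤ 3 * m + 1 → ∃ n, spiralPos u n =
      (-2 * m + t : ℝ) • u 0 - (m : ℝ) • u 1 := fun m t ht => by
    refine ⟨_, (spiralPos_leg u (3 * m) t ht).trans ?_⟩
    rw [spiralPos_round u hu, show Fin.ofNat 3 (3 * m) = 0 by apply Fin.ext; simp]
    module
  have s0 : ∀ m : ℕ, spiralPos u ((3 * m + 1) * (3 * m + 1 + 1) / 2) =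
      (m + 1 : ℝ) • u 0 - (m : ℝ) • u 1 := fun m => by
    have := spiralPos_leg u (3 * m) (3 * m + 1) le_rfl
    rw [← triangle_succ] at this
    refine this.trans ?_
    rw [spiralPos_round u hu, show Fin.ofNat 3 (3 * m) = 0 by apply Fin.ext; simp]
    push_cast
    module
  have col : ∀ m t : ℕ, t ≤ 3 * m + 2 → ∃ n, spiralPos u n =
      (m + 1 : ℝ) • u 0 + (-m + t : ℝ) • u 1 := fun m t ht => by
    refine ⟨_, (spiralPos_leg u (3 * m + 1) t ht).trans ?_⟩
    rw [s0, show Fin.ofNat 3 (3 * m + 1) = 1 by apply Fin.ext; simp [Fin.ofNat]]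
    module
  have diag : ∀ m t : ℕ, t ≤ 3 * m + 3 → ∃ n, spiralPos u n =
      (m + 1 - t : ℝ) • u 0 + (2 * m + 2 - t : ℝ) • u 1 := fun m t ht => by
    refine ⟨_, (spiralPos_leg u (3 * m + 2) t ht).trans ?_⟩
    have := spiralPos_leg u (3 * m + 1) (3 * m + 2) le_rfl
    rw [← triangle_succ, s0,
      show Fin.ofNat 3 (3 * m + 1) = 1 by apply Fin.ext; simp [Fin.ofNat]] at this
    rw [show (3 * m + 2) * (3 * m + 2 + 1) / 2 = (3 * m + 1 + 1) * (3 * m + 1 + 2) / 2 by rfl,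
      this, show Fin.ofNat 3 (3 * m + 2) = 2 by apply Fin.ext; simp [Fin.ofNat], h2]
    push_cast
    module
  -- The forms `-b`, `a`, `b - a` add up to zero, so the largest is nonnegative. It is constant
  -- along the legs of one kind, with value `m` on `row` and `m + 1` on `col` and `diag`, and so it
  -- names the leg on which the point lies. The origin needs separate treatment in `col` and `diag`,
  -- where `m + 1 = 0` is impossible.
  rcases le_or_gt a (-b) with h1 | h1
  · rcases le_total (b - a) (-b) with h3 | h3
    · obtain ⟨n, hn⟩ := row (-b).toNat (a + 2 * (-b)).toNat (by omega)
      refine ⟨n, hn.trans ?_⟩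
      have e1 : (((-b).toNat : ℕ) : ℝ) = -b := by
        exact_mod_cast Int.toNat_of_nonneg (show 0 ≤ -b by omega)
      have e2 : (((a + 2 * (-b)).toNat : ℕ) : ℝ) = a + 2 * (-b) := by
        exact_mod_cast Int.toNat_of_nonneg (show 0 ≤ a + 2 * (-b) by omega)
      rw [e1, e2]
      module
    · rcases (show b - a = 0 ∨ 0 < b - a by omega) with h | h
      · obtain ⟨n, hn⟩ := row 0 0 (by omega)
        have ha : a = 0 := by omega
        have hb : b = 0 := by omega
        exact ⟨n, hn.trans (by simp [ha, hb])⟩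
      · obtain ⟨n, hn⟩ := diag (b - a - 1).toNat (b - a - a).toNat (by omega)
        refine ⟨n, hn.trans ?_⟩
        have e1 : (((b - a - 1).toNat : ℕ) : ℝ) = b - a - 1 := by
          exact_mod_cast Int.toNat_of_nonneg (show 0 ≤ b - a - 1 by omega)
        have e2 : (((b - a - a).toNat : ℕ) : ℝ) = b - a - a := by
          exact_mod_cast Int.toNat_of_nonneg (show 0 ≤ b - a - a by omega)
        rw [e1, e2]
        module
  · rcases le_total (b - a) a with h3 | h3
    · rcases (show a = 0 ∨ 0 < a by omega) with h | h
      · obtain ⟨n, hn⟩ := row 0 0 (by omega)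
        have hb : b = 0 := by omega
        exact ⟨n, hn.trans (by simp [h, hb])⟩
      · obtain ⟨n, hn⟩ := col (a - 1).toNat (b + a - 1).toNat (by omega)
        refine ⟨n, hn.trans ?_⟩
        have e1 : (((a - 1).toNat : ℕ) : ℝ) = a - 1 := by
          exact_mod_cast Int.toNat_of_nonneg (show 0 ≤ a - 1 by omega)
        have e2 : (((b + a - 1).toNat : ℕ) : ℝ) = b + a - 1 := by
          exact_mod_cast Int.toNat_of_nonneg (show 0 ≤ b + a - 1 by omega)
        rw [e1, e2]
        module
    · rcases (show b - a = 0 ∨ 0 < b - a by omega) with h | h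
      · obtain ⟨n, hn⟩ := row 0 0 (by omega)
        have ha : a = 0 := by omega
        have hb : b = 0 := by omega
        exact ⟨n, hn.trans (by simp [ha, hb])⟩
      · obtain ⟨n, hn⟩ := diag (b - a - 1).toNat (b - a - a).toNat (by omega)
        refine ⟨n, hn.trans ?_⟩
        have e1 : (((b - a - 1).toNat : ℕ) : ℝ) = b - a - 1 := by
          exact_mod_cast Int.toNat_of_nonneg (show 0 ≤ b - a - 1 by omega)
        have e2 : (((b - a - a).toNat : ℕ) : ℝ) = b - a - a := by
          exact_mod_cast Int.toNat_of_nonneg (show 0 ≤ b - a - a by omega)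
        rw [e1, e2]
        module

end TuringMobile

end

/-! ### Executions in which only one robot is tasked to move -/

noncomputable section

namespace Robots

/-- At time `t` no robot is in motion or about to move before its next snapshot. -/
def Settled {n : ℕ} (x : Fin n → ℝ → Plane) (look : Fin n → ℕ → ℝ) (t : ℝ) : Prop :=
  ∀ i t', t ≤ t' → (∀ k, look i k ∉ Set.Ico t t') → x i t' = x i t

variable {n : ℕ} {alg : Multiset Plane → Plane} {vis δ : ℝ} {fr : Fin n → Plane ≃ₗᵢ[ℝ] Plane}
  {x : Fin n → ℝ → Plane} {look : Fin n → ℕ → ℝ}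

/-- The position of a robot at time `t` is governed by its last snapshot before `t`. If that one was
taken before `t₀`, or there is none, the robot is still as it was at time `t₀`, provided that the
swarm was settled then. The last snapshot exists because the times tend to infinity. -/
lemma IsExecution.last_look (ex : IsExecution alg vis δ fr x look) (i : Fin n) (t₀ t : ℝ) :
    (∀ k, look i k ∉ Set.Ico t₀ t) ∨
      ∃ k, look i k ∈ Set.Ico t₀ t ∧ t ≤ look i (k + 1) := by
  classical
  have hex : ∃ k, t ≤ look i k := ((ex.look_tendsto i).eventually_ge_atTop t).exists
  rcases h : Nat.find hex with _ | k
  · left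
    have h0 : t ≤ look i 0 := h ▸ Nat.find_spec hex
    intro k hk
    have := (ex.look_strictMono i).monotone (Nat.zero_le k)
    linarith [hk.2]
  · have h1 : t ≤ look i (k + 1) := h ▸ Nat.find_spec hex
    have h2 : look i k < t := not_le.1 (Nat.find_min hex (by omega))
    rcases le_or_gt t₀ (look i k) with h3 | h3
    · exact Or.inr ⟨k, ⟨h3, h2⟩, h1⟩
    · left
      intro j hj
      have h4 : look i k < look i j := lt_of_lt_of_le h3 hj.1
      have h5 : look i j < look i (k + 1) := lt_of_lt_of_le hj.2 h1
      have := (ex.look_strictMono i).lt_iff_lt.1 h4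
      have := (ex.look_strictMono i).lt_iff_lt.1 h5
      omega

/-- Induction along the snapshots after time `t₀`. -/
lemma IsExecution.event_induction (ex : IsExecution alg vis δ fr x look) {t₀ : ℝ}
    {Good : ℝ → Prop}
    (step : ∀ t, t₀ ≤ t → (∀ i k, look i k ∈ Set.Ico t₀ t → Good (look i k)) → Good t)
    (t : ℝ) (ht : t₀ ≤ t) : Good t := by
  -- Only finitely many snapshots fall into `[t₀, t)`, and strictly fewer before any one of them;
  -- the induction runs on their number.
  have fin : ∀ t, {p : Fin n × ℕ | look p.1 p.2 ∈ Set.Ico t₀ t}.Finite := by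
    intro t
    have h : ∀ i, {k | look i k < t}.Finite := fun i => by
      have := ((ex.look_tendsto i).eventually_ge_atTop t)
      rw [← Nat.cofinite_eq_atTop, Filter.eventually_cofinite] at this
      simpa using this
    refine ((Set.finite_univ (α := Fin n)).biUnion
      fun i _ => (h i).image fun k => (i, k)).subset ?_
    rintro ⟨i, k⟩ hk
    simp only [Set.mem_iUnion]
    exact ⟨i, trivial, k, hk.2, rfl⟩
  induction hN : {p : Fin n × ℕ | look p.1 p.2 ∈ Set.Ico t₀ t}.ncard using
    Nat.strong_induction_on generalizing t with
  | _ N ih =>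
    refine step t ht fun i k hk => ih _ ?_ (look i k) hk.1 rfl
    rw [← hN]
    refine Set.ncard_lt_ncard ?_ (fin t)
    rw [Set.ssubset_iff_of_subset]
    · exact ⟨(i, k), hk, fun h => lt_irrefl _ h.2⟩
    · exact fun p hp => ⟨hp.1, hp.2.trans hk.2⟩

lemma lineMap_lineMap_left (A B : Plane) (r s : ℝ) :
    AffineMap.lineMap (AffineMap.lineMap A B r) B s =
      AffineMap.lineMap A B (r + s * (1 - r)) := by
  simp only [AffineMap.lineMap_apply_module']
  module

/-- If only robot `a` is tasked to move as long as it has not reached `q`, then it reaches `q`. -/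
lemma IsExecution.stage (ex : IsExecution alg vis δ fr x look) (hδ : 0 < δ) (a : Fin n) {t₀ : ℝ}
    (hset : Settled x look t₀) (y : Fin n → Plane) (hy : ∀ j, x j t₀ = y j) (q : Plane)
    (hq : q ≠ y a)
    (htar : ∀ s ∈ Set.Ico (0 : ℝ) 1, ∀ j, target alg vis (fr j)
      (Function.update y a (AffineMap.lineMap (y a) q s)) j = Function.update y a q j) :
    ∃ t₁, t₀ < t₁ ∧ Settled x look t₁ ∧ (∀ j, x j t₁ = Function.update y a q j) ∧
      ∃ k, look a k ∈ Set.Ico t₀ t₁ ∧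
        ∃ s ∈ Set.Ico (0 : ℝ) 1, x a (look a k) = AffineMap.lineMap (y a) q s := by
  -- `OnSeg t`: robot `a` is on its way, strictly before `q`, and the others are in place. `Arr t`:
  -- robot `a` is at `q`, and every snapshot taken since `t₀` and before `t` saw a configuration on
  -- the way.
  set OnSeg : ℝ → Prop := fun t => ∃ s ∈ Set.Ico (0 : ℝ) 1,
    (fun j => x j t) = Function.update y a (AffineMap.lineMap (y a) q s) with hOn
  set Arr : ℝ → Prop := fun t => t₀ < t ∧ (∀ j, x j t = Function.update y a q j) ∧
    ∀ i k, look i k ∈ Set.Ico t₀ t → OnSeg (look i k) with hArr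
  have qne : ∀ s ∈ Set.Ico (0 : ℝ) 1, AffineMap.lineMap (y a) q s ≠ q := by
    intro s hs h
    rw [AffineMap.lineMap_eq_right_iff] at h
    rcases h with h | h
    · exact hq h.symm
    · exact hs.2.ne h
  -- the position of a robot after a snapshot of a configuration on the segment
  have after : ∀ i k, OnSeg (look i k) → ∀ t ∈ Set.Icc (look i k) (look i (k + 1)),
      i ≠ a → x i t = y i := by
    rintro i k ⟨s, hs, hx⟩ t ht hia
    obtain ⟨σ, -, -, -, h⟩ := ex.move i k
    rw [(h t ht).2, hx, htar s hs i, congrFun hx i, Function.update_of_ne hia,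
      Function.update_of_ne hia, AffineMap.lineMap_same_apply]
  have after_a : ∀ k, OnSeg (look a k) → ∃ r ∈ Set.Ico (0 : ℝ) 1, ∃ σ : ℝ → ℝ,
      x a (look a k) = AffineMap.lineMap (y a) q r ∧
      MonotoneOn σ (Set.Icc (look a k) (look a (k + 1))) ∧
      ∀ t ∈ Set.Icc (look a k) (look a (k + 1)), 0 ≤ σ t ∧ σ t ≤ 1 ∧
        x a t = AffineMap.lineMap (y a) q (r + σ t * (1 - r)) := by
    rintro k ⟨s, hs, hx⟩
    obtain ⟨σ, h0, -, hm, h⟩ := ex.move a k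
    have hxa : x a (look a k) = AffineMap.lineMap (y a) q s := by
      rw [congrFun hx a, Function.update_self]
    refine ⟨s, hs, σ, hxa, hm, fun t ht => ⟨?_, (h t ht).1, ?_⟩⟩
    · rw [← h0]
      exact hm ⟨le_rfl, ht.1.trans ht.2⟩ ht ht.1
    · rw [(h t ht).2, hx, htar s hs a, hxa, Function.update_self, lineMap_lineMap_left]
  have good : ∀ t, t₀ ≤ t → OnSeg t ∨ ∃ t₁, Arr t₁ := by
    refine ex.event_induction (Good := fun t => OnSeg t ∨ ∃ t₁, Arr t₁) fun t ht hg => ?_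
    by_cases hA : ∃ t₁, Arr t₁
    · exact Or.inr hA
    have hg' : ∀ i k, look i k ∈ Set.Ico t₀ t → OnSeg (look i k) := fun i k hk =>
      (hg i k hk).resolve_right hA
    have hothers : ∀ j, j ≠ a → x j t = y j := by
      intro j hj
      rcases ex.last_look j t₀ t with h | ⟨k, hk, hk'⟩
      · rw [hset j t ht h, hy]
      · exact after j k (hg' j k hk) t ⟨hk.2.le, hk'⟩ hj
    rcases ex.last_look a t₀ t with h | ⟨k, hk, hk'⟩
    · refine Or.inl ⟨0, ⟨le_rfl, one_pos⟩, funext fun j => ?_⟩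
      by_cases hj : j = a
      · subst hj
        simp [hset j t ht h, hy]
      · rw [Function.update_of_ne hj, hothers j hj]
    · obtain ⟨r, hr, σ, -, -, h⟩ := after_a k (hg' a k hk)
      obtain ⟨s0, s1, hx⟩ := h t ⟨hk.2.le, hk'⟩
      rcases s1.lt_or_eq with s1 | s1
      · refine Or.inl ⟨r + σ t * (1 - r), ⟨?_, ?_⟩, funext fun j => ?_⟩
        · nlinarith [hr.1, hr.2]
        · nlinarith [hr.1, hr.2]
        · by_cases hj : j = a
          · subst hj
            rw [Function.update_self, hx]
          · rw [Function.update_of_ne hj, hothers j hj]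
      · refine Or.inr ⟨t, hk.1.trans_lt hk.2, fun j => ?_, hg'⟩
        by_cases hj : j = a
        · subst hj
          rw [Function.update_self, hx, s1, one_mul, add_sub_cancel, AffineMap.lineMap_apply_one]
        · rw [Function.update_of_ne hj, hothers j hj]
  -- If `a` never arrived, every snapshot would show the same destination ahead, and by fairness the
  -- distance to it would drop by `δ` between successive snapshots, eventually below zero.
  have arrive : ∃ t₁, Arr t₁ := by
    by_contra hA
    have hg : ∀ t, t₀ ≤ t → OnSeg t := fun t ht => (good t ht).resolve_right hA
    obtain ⟨k₀, hk₀⟩ := ((ex.look_tendsto a).eventually_ge_atTop t₀).exists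
    have hle : ∀ m, t₀ ≤ look a (k₀ + m) := fun m =>
      hk₀.trans ((ex.look_strictMono a).monotone (Nat.le_add_right _ _))
    have decr : ∀ m : ℕ, dist (x a (look a (k₀ + m))) q ≤ dist (x a (look a k₀)) q - m * δ := by
      intro m
      induction m with
      | zero => simp
      | succ m ih =>
        set k := k₀ + m
        obtain ⟨r, hr, σ, hxr, -, h⟩ := after_a k (hg _ (hle m))
        have hlt := ex.look_strictMono a (Nat.lt_succ_self k)
        obtain ⟨s0, s1, hx⟩ := h (look a (k + 1)) ⟨hlt.le, le_rfl⟩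
        have hpr := ex.progress a k
        obtain ⟨s, hs, hxs⟩ := hg _ (hle m)
        obtain ⟨s', hs', hxs'⟩ := hg _ (hle (m + 1))
        rw [hxs, htar s hs a, Function.update_self] at hpr
        have hx' := congrFun hxs' a
        rw [Function.update_self] at hx'
        rcases hpr with hpr | hpr
        · exact absurd (hx'.symm.trans hpr) (qne s' hs')
        · have e : dist (x a (look a k)) (x a (look a (k + 1))) +
              dist (x a (look a (k + 1))) q = dist (x a (look a k)) q := by
            rw [hxr, hx]
            simp only [dist_lineMap_lineMap, dist_lineMap_right, Real.norm_eq_abs, Real.dist_eq]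
            rw [abs_of_nonpos (by nlinarith [hr.2]), abs_of_nonneg (by nlinarith [hr.2]),
              abs_of_nonneg (by linarith [hr.2])]
            ring
          push_cast
          rw [← add_assoc]
          change dist (x a (look a (k + 1))) q ≤ _
          linarith
    obtain ⟨m, hm⟩ := exists_nat_gt (dist (x a (look a k₀)) q / δ)
    rw [div_lt_iff₀ hδ] at hm
    have := decr m
    have := dist_nonneg (x := x a (look a (k₀ + m))) (y := q)
    linarith
  obtain ⟨t₁, h01, hfin, hlook⟩ := arrive
  have hxa : x a t₁ = q := by rw [hfin, Function.update_self]
  refine ⟨t₁, h01, ?_, hfin, ?_⟩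
  · intro i t' ht' hno
    rcases ex.last_look i t₀ t' with h | ⟨k, hk, hk'⟩
    · rw [hset i t' (h01.le.trans ht') h, hset i t₁ h01.le fun k hk => h k ⟨hk.1, hk.2.trans_le ht'⟩]
    · have hlt : look i k < t₁ := by
        by_contra hge
        exact hno k ⟨not_lt.1 hge, hk.2⟩
      have hOnk := hlook i k ⟨hk.1, hlt⟩
      -- The mover may still be within the movement that brought it to `q`. Its parameter is `1` at
      -- time `t₁` and monotone, so it stays `1`. The other robots can only be in a movement whose
      -- destination is their own position.
      by_cases hi : i = a
      · subst hi
        obtain ⟨r, hr, σ, -, hm, h⟩ := after_a k hOnk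
        obtain ⟨-, s1, hx1⟩ := h t₁ ⟨hlt.le, ht'.trans hk'⟩
        obtain ⟨-, s1', hx'⟩ := h t' ⟨hk.2.le, hk'⟩
        have hmono := hm ⟨hlt.le, ht'.trans hk'⟩ ⟨hk.2.le, hk'⟩ ht'
        have e1 : σ t₁ = 1 := by
          rw [hxa] at hx1
          rcases AffineMap.lineMap_eq_right_iff.1 hx1.symm with h | h
          · exact absurd h.symm hq
          · have h1r : 1 - r ≠ 0 := by linarith [hr.2]
            have : σ t₁ * (1 - r) = 1 * (1 - r) := by linarith
            exact mul_right_cancel₀ h1r this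
        have e2 : σ t' = 1 := by linarith
        rw [hx1, hx', e1, e2]
      · rw [after i k hOnk t' ⟨hk.2.le, hk'⟩ hi, after i k hOnk t₁ ⟨hlt.le, ht'.trans hk'⟩ hi]
  -- Without a snapshot since `t₀` the mover would still be at `y a ≠ q`.
  · rcases ex.last_look a t₀ t₁ with h | ⟨k, hk, -⟩
    · exact absurd ((hset a t₁ h01.le h).symm.trans hxa) (by rw [hy]; exact hq.symm)
    · obtain ⟨s, hs, hx⟩ := hlook a k hk
      exact ⟨k, hk, s, hs, by rw [congrFun hx a, Function.update_self]⟩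

end Robots

end

/-! ### Orthonormal frames and coordinates of the named points -/

noncomputable section

namespace TuringMobile

lemma inner_plane (u v : Plane) : inner ℝ u v = u 0 * v 0 + u 1 * v 1 := by
  simp [PiLp.inner_apply, Fin.sum_univ_two, mul_comm]

lemma rot_apply_zero (v : Plane) : rot v 0 = -v 1 := by simp [rot]

lemma rot_apply_one (v : Plane) : rot v 1 = v 0 := by simp [rot]

/-- An orthonormal pair of vectors, of either orientation. -/
structure Frame (e₁ e₂ : Plane) : Prop where
  inner₁₁ : inner ℝ e₁ e₁ = (1 : ℝ)
  inner₂₂ : inner ℝ e₂ e₂ = (1 : ℝ)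
  inner₁₂ : inner ℝ e₁ e₂ = (0 : ℝ)

variable {e₁ e₂ : Plane}

/-- The sign is the determinant of the pair, whose square is `1` by the Lagrange identity. It
records the handedness of the frame. -/
lemma Frame.exists_sign (F : Frame e₁ e₂) :
    ∃ σ : ℝ, (σ = 1 ∨ σ = -1) ∧ e₂ = σ • rot e₁ ∧ rot e₂ = -σ • e₁ := by
  obtain ⟨h1, h2, h3⟩ := F
  rw [inner_plane] at h1 h2 h3
  refine ⟨e₁ 0 * e₂ 1 - e₁ 1 * e₂ 0, ?_, ?_, ?_⟩
  · have : (e₁ 0 * e₂ 1 - e₁ 1 * e₂ 0 - 1) * (e₁ 0 * e₂ 1 - e₁ 1 * e₂ 0 + 1) = 0 := by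
      linear_combination (e₂ 0 * e₂ 0 + e₂ 1 * e₂ 1) * h1 + h2 -
        (e₁ 0 * e₂ 0 + e₁ 1 * e₂ 1) * h3
    rcases mul_eq_zero.1 this with h | h
    · left; linarith
    · right; linarith
  · ext i
    fin_cases i
    · simp [rot]
      linear_combination (-e₂ 0) * h1 + e₁ 0 * h3
    · simp [rot]
      linear_combination (-e₂ 1) * h1 + e₁ 1 * h3
  · ext i
    fin_cases i
    · simp [rot]
      linear_combination e₂ 1 * h1 - e₁ 1 * h3
    · simp [rot]
      linear_combination (-e₂ 0) * h1 + e₁ 0 * h3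

lemma Frame.inner_comb (F : Frame e₁ e₂) (a b c d : ℝ) :
    inner ℝ (a • e₁ + b • e₂) (c • e₁ + d • e₂) = a * c + b * d := by
  simp only [inner_add_left, inner_add_right, real_inner_smul_left, real_inner_smul_right,
    F.inner₁₁, F.inner₂₂, F.inner₁₂, real_inner_comm e₁ e₂ ▸ F.inner₁₂]
  ring

lemma Frame.norm_comb (F : Frame e₁ e₂) (a b : ℝ) : ‖a • e₁ + b • e₂‖ = √(a ^ 2 + b ^ 2) := by
  rw [norm_eq_sqrt_real_inner, F.inner_comb, sq, sq]

lemma Frame.inner_comb_left (F : Frame e₁ e₂) (a b : ℝ) :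
    inner ℝ (a • e₁ + b • e₂) e₁ = a := by
  simpa using F.inner_comb a b 1 0

lemma Frame.inner_comb_right (F : Frame e₁ e₂) (a b : ℝ) :
    inner ℝ (a • e₁ + b • e₂) e₂ = b := by
  simpa using F.inner_comb a b 0 1

lemma Frame.comb_inj (F : Frame e₁ e₂) {a b c d : ℝ} :
    a • e₁ + b • e₂ = c • e₁ + d • e₂ ↔ a = c ∧ b = d := by
  refine ⟨fun h => ⟨?_, ?_⟩, fun h => by rw [h.1, h.2]⟩
  · rw [← F.inner_comb_left a b, h, F.inner_comb_left]
  · rw [← F.inner_comb_right a b, h, F.inner_comb_right]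

lemma Frame.expand (F : Frame e₁ e₂) (v : Plane) :
    v = (inner ℝ v e₁ : ℝ) • e₁ + (inner ℝ v e₂ : ℝ) • e₂ := by
  obtain ⟨σ, hσ, h, -⟩ := F.exists_sign
  have h1 := F.inner₁₁
  have hσ' : σ * σ = 1 := by rcases hσ with rfl | rfl <;> norm_num
  rw [h, inner_plane, inner_plane]
  rw [inner_plane] at h1
  ext i
  fin_cases i
  · simp [rot]
    linear_combination (-v 0) * h1 + (v 1 * e₁ 0 * e₁ 1 - v 0 * e₁ 1 * e₁ 1) * hσ'
  · simp [rot]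
    linear_combination (-v 1) * h1 + (v 0 * e₁ 0 * e₁ 1 - v 1 * e₁ 0 * e₁ 0) * hσ'

/-- In a left-handed frame both `side` and `rot` change sign, so their product does not. Hence
constructions with `side _ _ • rot _` have the same coordinates in frames of both orientations, and
the handedness of a robot's axes is irrelevant. -/
lemma Frame.side_smul_rot (F : Frame e₁ e₂) {a b c d : ℝ} (h : 0 < a * d - b * c) :
    side (a • e₁ + b • e₂) (c • e₁ + d • e₂) • rot (a • e₁ + b • e₂) = (-b) • e₁ + a • e₂ := by
  obtain ⟨σ, hσ, h2, h3⟩ := F.exists_sign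
  have h1 := F.inner₁₁
  rw [inner_plane] at h1
  have hrot : rot (a • e₁ + b • e₂) = a • rot e₁ + b • rot e₂ := by
    ext i; fin_cases i <;> simp [rot]; ring
  have hr1 : rot e₁ = σ • e₂ := by
    rw [h2, smul_smul, show σ * σ = 1 by rcases hσ with rfl | rfl <;> norm_num, one_smul]
  have hs : (a • e₁ + b • e₂) 0 * (c • e₁ + d • e₂) 1 - (a • e₁ + b • e₂) 1 *
      (c • e₁ + d • e₂) 0 = σ * (a * d - b * c) := by
    rw [h2]
    simp [rot]
    linear_combination σ * (a * d - b * c) * h1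
  rw [hrot, h3, hr1, side, hs]
  rcases hσ with rfl | rfl
  · rw [if_pos (by linarith)]
    module
  · rw [if_neg (by linarith)]
    module

lemma Frame.side_smul_rot_neg (F : Frame e₁ e₂) {a b c d : ℝ} (h : a * d - b * c < 0) :
    side (a • e₁ + b • e₂) (c • e₁ + d • e₂) • rot (a • e₁ + b • e₂) = b • e₁ + (-a) • e₂ := by
  obtain ⟨σ, hσ, h2, h3⟩ := F.exists_sign
  have h1 := F.inner₁₁
  rw [inner_plane] at h1
  have hrot : rot (a • e₁ + b • e₂) = a • rot e₁ + b • rot e₂ := by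
    ext i; fin_cases i <;> simp [rot]; ring
  have hr1 : rot e₁ = σ • e₂ := by
    rw [h2, smul_smul, show σ * σ = 1 by rcases hσ with rfl | rfl <;> norm_num, one_smul]
  have hs : (a • e₁ + b • e₂) 0 * (c • e₁ + d • e₂) 1 - (a • e₁ + b • e₂) 1 *
      (c • e₁ + d • e₂) 0 = σ * (a * d - b * c) := by
    rw [h2]
    simp [rot]
    linear_combination σ * (a * d - b * c) * h1
  rw [hrot, h3, hr1, side, hs]
  rcases hσ with rfl | rfl
  · rw [if_neg (by linarith)]
    module
  · rw [if_pos (by linarith)]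
    module

lemma side_sq (u v : Plane) : side u v * side u v = 1 := by
  unfold side; split_ifs <;> norm_num

lemma frame_axis {C N R : Plane} (h : N ≠ R) : Frame (axis₁ N R) (axis₂ C N R) := by
  have h1 : inner ℝ (axis₁ N R) (axis₁ N R) = (1 : ℝ) := by
    rw [axis₁, unit, real_inner_self_eq_norm_sq, norm_smul, norm_inv, norm_norm,
      inv_mul_cancel₀ (norm_ne_zero_iff.2 (sub_ne_zero.2 h)), one_pow]
  refine ⟨h1, ?_, ?_⟩
  · rw [axis₂, real_inner_smul_left, real_inner_smul_right, ← mul_assoc, side_sq, one_mul]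
    rw [inner_plane] at h1 ⊢
    rw [rot_apply_zero, rot_apply_one]
    linarith
  · rw [axis₂, real_inner_smul_right, inner_plane, rot_apply_zero, rot_apply_one]
    ring

/-- The coordinates of `dirVec`; those of `altVec` are `(-dirY i, dirX i)`. -/
def dirX : Fin 3 → ℝ := ![0, -(√3 / 2), √3 / 2]

def dirY : Fin 3 → ℝ := ![1, -(1 / 2), -(1 / 2)]

lemma dirVec_eq (e₁ e₂ : Plane) (i : Fin 3) :
    dirVec e₁ e₂ i = dirX i • e₁ + dirY i • e₂ := by
  fin_cases i <;> simp [dirVec, dirX, dirY]; module; module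

lemma altVec_eq (e₁ e₂ : Plane) (i : Fin 3) :
    altVec e₁ e₂ i = (-dirY i) • e₁ + dirX i • e₂ := by
  fin_cases i <;> simp [altVec, dirX, dirY]; module

lemma sq_sqrt_three : √3 * √3 = (3 : ℝ) := Real.mul_self_sqrt (by norm_num)

lemma sqrt_three_lt : √3 < 1.7321 := by
  rw [Real.sqrt_lt' (by norm_num)]; norm_num

lemma lt_sqrt_three : 1.732 < √3 := by
  rw [Real.lt_sqrt (by norm_num)]; norm_num

lemma dirX_sq_add (i : Fin 3) : dirX i ^ 2 + dirY i ^ 2 = 1 := by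
  have := sq_sqrt_three
  fin_cases i <;> simp [dirX, dirY] <;> linear_combination this / 4

lemma Frame.dir_alt (F : Frame e₁ e₂) (i : Fin 3) : Frame (dirVec e₁ e₂ i) (altVec e₁ e₂ i) := by
  have := dirX_sq_add i
  constructor
  · rw [dirVec_eq, F.inner_comb]; linear_combination this
  · rw [altVec_eq, F.inner_comb]; linear_combination this
  · rw [altVec_eq, dirVec_eq, F.inner_comb]; ring

/-- The frame in the current configuration, in terms of a fixed frame. -/
lemma Frame.axes_eq (F : Frame e₁ e₂) {C N R : Plane} {c₁ c₂ n₁ n₂ : ℝ}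
    (hC : C - R = c₁ • e₁ + c₂ • e₂) (hN : N - R = n₁ • e₁ + n₂ • e₂)
    (h : 0 < n₁ * c₂ - n₂ * c₁) :
    axis₁ N R = (n₁ / √(n₁ ^ 2 + n₂ ^ 2)) • e₁ + (n₂ / √(n₁ ^ 2 + n₂ ^ 2)) • e₂ ∧
      axis₂ C N R = (-n₂ / √(n₁ ^ 2 + n₂ ^ 2)) • e₁ + (n₁ / √(n₁ ^ 2 + n₂ ^ 2)) • e₂ := by
  have h1 : axis₁ N R =
      (n₁ / √(n₁ ^ 2 + n₂ ^ 2)) • e₁ + (n₂ / √(n₁ ^ 2 + n₂ ^ 2)) • e₂ := by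
    rw [axis₁, hN, unit, F.norm_comb, smul_add, smul_smul, smul_smul, inv_mul_eq_div,
      inv_mul_eq_div]
  refine ⟨h1, ?_⟩
  have hpos : 0 < √(n₁ ^ 2 + n₂ ^ 2) := by
    apply Real.sqrt_pos.2
    by_contra hn
    have a1 : n₁ = 0 := by nlinarith [sq_nonneg n₁, sq_nonneg n₂]
    have a2 : n₂ = 0 := by nlinarith [sq_nonneg n₁, sq_nonneg n₂]
    rw [a1, a2] at h
    linarith
  rw [axis₂, h1, hC, F.side_smul_rot, neg_div]
  rw [div_mul_eq_mul_div, div_mul_eq_mul_div, ← sub_div]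
  exact div_pos h hpos

lemma Frame.axes_eq_self (F : Frame e₁ e₂) {C N R : Plane} {c₁ c₂ ρ : ℝ}
    (hC : C - R = c₁ • e₁ + c₂ • e₂) (hN : N - R = ρ • e₁) (hρ : 0 < ρ) (hc : 0 < c₂) :
    axis₁ N R = e₁ ∧ axis₂ C N R = e₂ := by
  have := F.axes_eq (n₁ := ρ) (n₂ := 0) hC (by rw [hN, zero_smul, add_zero])
    (by have := mul_pos hρ hc; linarith)
  rw [show ρ ^ 2 + 0 ^ 2 = ρ ^ 2 by ring, Real.sqrt_sq hρ.le, div_self hρ.ne'] at this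
  simpa using this

/-- The lengths are of different orders of magnitude. -/
structure Params.Good (p : Params) : Prop where
  lam_pos : 0 < p.lam
  lam_le : 1000 * p.lam ≤ p.mu
  mu_le : 1000 * p.mu ≤ p.d

section Coordinates

variable (p : Params) (C N R : Plane)

/-- The coordinate of Commander in the direction of the `i`-th move. -/
def tt (i : Fin 3) : ℝ := inner ℝ (C - virt p C N R) (uu C N R i)

/-- The coordinate of Commander in the direction of the altitude of the `i`-th midway triangle. -/
def hh (i : Fin 3) : ℝ := inner ℝ (C - virt p C N R) (ww C N R i)

end Coordinates

variable {p : Params} {C N R : Plane}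

lemma frame_uu_ww (h : N ≠ R) (i : Fin 3) : Frame (uu C N R i) (ww C N R i) :=
  (frame_axis h).dir_alt i

lemma commander_eq (h : N ≠ R) (i : Fin 3) :
    C = virt p C N R + (tt p C N R i • uu C N R i + hh p C N R i • ww C N R i) := by
  rw [tt, hh, ← (frame_uu_ww h i).expand, add_sub_cancel]

section Membership

variable {u w : Plane} (F : Frame u w) (O : Plane) {a b l t h : ℝ}
include F

lemma Frame.eq_point_iff : O + (t • u + h • w) = O + a • u ↔ t = a ∧ h = 0 := by
  rw [add_right_inj, ← F.comb_inj, zero_smul, add_zero]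

lemma Frame.mem_segment_base_iff (hab : a ≤ b) :
    O + (t • u + h • w) ∈ segment ℝ (O + a • u) (O + b • u) ↔ h = 0 ∧ a ≤ t ∧ t ≤ b := by
  rw [segment_eq_image_lineMap, Set.mem_image]
  constructor
  · rintro ⟨θ, ⟨h0, h1⟩, hθ⟩
    have : O + (t • u + h • w) = O + (a + θ * (b - a)) • u := by
      rw [← hθ, AffineMap.lineMap_apply_module']; module
    obtain ⟨e1, e2⟩ := (F.eq_point_iff O).1 this
    exact ⟨e2, by nlinarith, by nlinarith⟩
  · rintro ⟨rfl, h1, h2⟩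
    rcases hab.eq_or_lt with rfl | hab
    · exact ⟨0, by simp, by rw [le_antisymm h2 h1]; simp⟩
    · refine ⟨(t - a) / (b - a), ⟨div_nonneg (by linarith) (by linarith),
        (div_le_one (by linarith)).2 (by linarith)⟩, ?_⟩
      have e : (t - a) / (b - a) * (b - a) = t - a := div_mul_cancel₀ _ (by linarith)
      have e' : AffineMap.lineMap (O + a • u) (O + b • u) ((t - a) / (b - a)) =
          O + (a + (t - a) / (b - a) * (b - a)) • u := by
        rw [AffineMap.lineMap_apply_module']; module
      rw [e', e]
      module

lemma Frame.mem_segment_altitude_iff (hl : 0 < l) :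
    O + (t • u + h • w) ∈ segment ℝ (O + a • u) (O + a • u + l • w) ↔ t = a ∧ 0 ≤ h ∧ h ≤ l := by
  rw [segment_eq_image_lineMap, Set.mem_image]
  have e : ∀ θ : ℝ, AffineMap.lineMap (O + a • u) (O + a • u + l • w) θ =
      O + (a • u + (θ * l) • w) := fun θ => by rw [AffineMap.lineMap_apply_module']; module
  constructor
  · rintro ⟨θ, ⟨h0, h1⟩, h⟩
    rw [e, add_right_inj, F.comb_inj] at h
    refine ⟨h.1.symm, ?_, ?_⟩ <;> rw [← h.2]
    · positivity
    · nlinarith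
  · rintro ⟨rfl, h1, h2⟩
    exact ⟨h / l, ⟨by positivity, (div_le_one hl).2 h2⟩, by rw [e, div_mul_cancel₀ _ hl.ne']⟩

/-- `θ` is the fraction of the base covered from the acute vertex to the foot of the altitude.
Nothing is assumed on the order of `a` and `b`, so both halves of a midway triangle are covered. -/
lemma Frame.mem_triangle_iff (hl : 0 < l) :
    O + (t • u + h • w) ∈ convexHull ℝ {O + a • u, O + b • u, O + b • u + l • w} ↔
      ∃ θ ∈ Set.Icc (0 : ℝ) 1, t = a + θ * (b - a) ∧ 0 ≤ h ∧ h ≤ θ * l := by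
  rw [convexHull_insert (Set.insert_nonempty _ _), convexHull_pair, mem_convexJoin]
  simp only [Set.mem_singleton_iff, exists_eq_left]
  have e : ∀ θ φ : ℝ, AffineMap.lineMap (O + a • u)
      (AffineMap.lineMap (O + b • u) (O + b • u + l • w) φ) θ =
      O + ((a + θ * (b - a)) • u + (θ * φ * l) • w) := fun θ φ => by
    simp only [AffineMap.lineMap_apply_module']; module
  constructor
  · rintro ⟨Z, hZ, hC⟩
    rw [segment_eq_image_lineMap] at hZ hC
    obtain ⟨φ, ⟨f0, f1⟩, rfl⟩ := hZ
    obtain ⟨θ, ⟨h0, h1⟩, hθ⟩ := hC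
    rw [e, add_right_inj, F.comb_inj] at hθ
    refine ⟨θ, ⟨h0, h1⟩, hθ.1.symm, ?_, ?_⟩ <;> rw [← hθ.2]
    · positivity
    · have := mul_nonneg h0 hl.le
      nlinarith
  · rintro ⟨θ, ⟨h0, h1⟩, rfl, h2, h3⟩
    rcases h0.eq_or_lt with rfl | h0
    · refine ⟨O + b • u, left_mem_segment ℝ _ _, ?_⟩
      have : h = 0 := by linarith
      subst this
      convert left_mem_segment ℝ _ _ using 1
      module
    · have hp : 0 < θ * l := by positivity
      refine ⟨AffineMap.lineMap (O + b • u) (O + b • u + l • w) (h / (θ * l)), ?_, ?_⟩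
      · rw [segment_eq_image_lineMap]
        exact ⟨_, ⟨by positivity, (div_le_one hp).2 h3⟩, rfl⟩
      · rw [segment_eq_image_lineMap]
        refine ⟨θ, ⟨h0.le, h1⟩, ?_⟩
        rw [e, mul_right_comm, mul_div_cancel₀ _ hp.ne']

end Membership

end TuringMobile

end

/-! ### The regions of Commander's rules -/

noncomputable section

namespace TuringMobile

/-! The regions of the rules of Commander, in coordinates along and across the move. -/

def Params.Approach (p : Params) (t h : ℝ) : Prop := h = 0 ∧ 0 ≤ t ∧ t < (p.mu - p.lam) / 2

def Params.Start (p : Params) (t h : ℝ) : Prop := t = (p.mu - p.lam) / 2 ∧ h = 0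

def Params.First (p : Params) (t h : ℝ) : Prop :=
  t < p.mu / 2 ∧ 0 ≤ h ∧ h ≤ 2 * (t - (p.mu - p.lam) / 2)

def Params.Altitude (p : Params) (t h : ℝ) : Prop := t = p.mu / 2 ∧ 0 ≤ h ∧ h ≤ p.lam

def Params.Second (p : Params) (t h : ℝ) : Prop :=
  p.mu / 2 < t ∧ 0 ≤ h ∧ h ≤ 2 * ((p.mu + p.lam) / 2 - t) ∧ t ≠ (p.mu + p.lam) / 2

def Params.Leave (p : Params) (t h : ℝ) : Prop := h = 0 ∧ (p.mu + p.lam) / 2 ≤ t ∧ t < p.mu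

/-- A set that contains all regions. -/
def Params.Region (p : Params) (t h : ℝ) : Prop :=
  (h = 0 ∧ 0 ≤ t ∧ t < p.mu) ∨
    ((p.mu - p.lam) / 2 ≤ t ∧ t ≤ (p.mu + p.lam) / 2 ∧ 0 ≤ h ∧ h ≤ p.lam)

variable {p : Params} {C N R : Plane} {t h : ℝ}

section Regions

variable (hp : p.Good)
include hp

lemma Params.Approach.region (H : p.Approach t h) : p.Region t h := by
  have := hp.lam_pos; have := hp.lam_le
  exact Or.inl ⟨H.1, H.2.1, by linarith [H.2.2]⟩

lemma Params.Start.region (H : p.Start t h) : p.Region t h := by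
  have := hp.lam_pos; have := hp.lam_le
  exact Or.inl ⟨H.2, by linarith [H.1], by linarith [H.1]⟩

lemma Params.First.region (H : p.First t h) : p.Region t h := by
  have := hp.lam_pos; have := hp.lam_le
  obtain ⟨h1, h2, h3⟩ := H
  exact Or.inr ⟨by linarith, by linarith, h2, by linarith⟩

lemma Params.Altitude.region (H : p.Altitude t h) : p.Region t h := by
  have := hp.lam_pos; have := hp.lam_le
  obtain ⟨h1, h2, h3⟩ := H
  exact Or.inr ⟨by linarith, by linarith, h2, h3⟩

lemma Params.Second.region (H : p.Second t h) : p.Region t h := by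
  have := hp.lam_pos; have := hp.lam_le
  obtain ⟨h1, h2, h3, -⟩ := H
  exact Or.inr ⟨by linarith, by linarith, h2, by linarith⟩

lemma Params.Leave.region (H : p.Leave t h) : p.Region t h := by
  have := hp.lam_pos; have := hp.lam_le
  exact Or.inl ⟨H.1, by linarith [H.2.1], H.2.2⟩

/-- All regions of one direction lie in a cone around it that is narrow enough to avoid the cones of
the other two. It suffices that the triangles are small and far from the Virtual Commander. -/
lemma Params.Region.cone (H : p.Region t h) : 0 ≤ t ∧ 0 ≤ h ∧ h ≤ t / 2 := by
  have := hp.lam_pos; have := hp.lam_le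
  rcases H with ⟨h1, h2, h3⟩ | ⟨h1, h2, h3, h4⟩
  · exact ⟨h2, h1.ge, by linarith⟩
  · exact ⟨by linarith, h3, by linarith⟩

/-- Bounds for the distance of Commander from Reference. -/
lemma Params.Region.dist_bounds (i : Fin 3) (H : p.Region t h) :
    p.d ^ 2 + p.mu ^ 2 - p.d * p.mu <
      (t * dirX i - h * dirY i) ^ 2 + (p.d + (t * dirY i + h * dirX i)) ^ 2 ∧
      (t * dirX i - h * dirY i) ^ 2 + (p.d + (t * dirY i + h * dirX i)) ^ 2 <
        (p.d + p.mu) ^ 2 := by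
  obtain ⟨l1, l2, l3⟩ := hp
  have e := dirX_sq_add i
  have expand : (t * dirX i - h * dirY i) ^ 2 + (p.d + (t * dirY i + h * dirX i)) ^ 2 =
      p.d ^ 2 + t ^ 2 + h ^ 2 + 2 * p.d * t * dirY i + 2 * p.d * h * dirX i := by
    linear_combination (t ^ 2 + h ^ 2) * e
  rw [expand]
  have s1 := sqrt_three_lt
  have s2 : 0 ≤ √(3 : ℝ) := Real.sqrt_nonneg 3
  have hx : -0.9 ≤ dirX i ∧ dirX i ≤ 0.9 := by
    fin_cases i <;> simp [dirX] <;> norm_num <;> constructor <;> linarith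
  have hy : -(1 / 2) ≤ dirY i ∧ dirY i ≤ 1 := by
    fin_cases i <;> simp [dirY] <;> norm_num
  have hm : 0 < p.mu := by linarith
  have hd : 0 < p.d := by linarith
  rcases H with ⟨rfl, h2, h3⟩ | ⟨h1, h2, h3, h4⟩
  · have a1 := mul_nonneg (mul_nonneg hd.le h2) (sub_nonneg.2 hy.1)
    have a2 := mul_nonneg (mul_nonneg hd.le h2) (sub_nonneg.2 hy.2)
    -- This product is the difference of `d² + t² - d t` and `d² + mu² - d mu`. It settles the lower
    -- bound, since `dirY i ≥ -1/2`.
    have a3 := mul_pos (sub_pos.2 h3) (show 0 < p.d - p.mu - t by linarith)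
    have a4 := mul_pos hd (sub_pos.2 h3)
    constructor <;> nlinarith
  · have ht : 0 ≤ t := by linarith
    have a1 := mul_nonneg (mul_nonneg hd.le ht) (sub_nonneg.2 hy.1)
    have a2 := mul_nonneg (mul_nonneg hd.le ht) (sub_nonneg.2 hy.2)
    have a3 := mul_nonneg (mul_nonneg hd.le h3) (sub_nonneg.2 hx.1)
    have a4 := mul_nonneg (mul_nonneg hd.le h3) (sub_nonneg.2 hx.2)
    have b1 := mul_nonneg hd.le (show 0 ≤ 0.6 * p.mu - t by linarith)
    have b2 := mul_nonneg hd.le (show 0 ≤ 0.001 * p.mu - h by linarith)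
    have b3 : t ^ 2 ≤ p.mu ^ 2 := by nlinarith
    have b4 : h ^ 2 ≤ p.mu ^ 2 := by nlinarith
    have b5 := mul_nonneg hm.le (sub_nonneg.2 l3)
    have b6 := mul_pos hm hm
    constructor <;> nlinarith

end Regions

lemma eq_virt_iff (hNR : N ≠ R) (i : Fin 3) : C = virt p C N R ↔ tt p C N R i = 0 ∧ hh p C N R i = 0 := by
  have := (frame_uu_ww (C := C) hNR i).eq_point_iff (virt p C N R) (a := 0) (t := tt p C N R i)
    (h := hh p C N R i)
  rwa [← commander_eq hNR i, zero_smul, add_zero] at this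

lemma mem_approach_iff (hp : p.Good) (hNR : N ≠ R) (i : Fin 3) :
    C ∈ segment ℝ (virt p C N R) (ptA p C N R i) ∧ C ≠ ptA p C N R i ↔
      p.Approach (tt p C N R i) (hh p C N R i) := by
  have F := frame_uu_ww (C := C) hNR i
  have := hp.lam_pos; have := hp.lam_le
  have h1 := F.mem_segment_base_iff (virt p C N R) (a := 0) (b := (p.mu - p.lam) / 2)
    (t := tt p C N R i) (h := hh p C N R i) (by linarith)
  have h2 := F.eq_point_iff (virt p C N R) (a := (p.mu - p.lam) / 2)
    (t := tt p C N R i) (h := hh p C N R i)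
  rw [← commander_eq hNR i] at h1 h2
  rw [zero_smul, add_zero] at h1
  rw [ptA, Params.Approach, h1, ne_eq, h2]
  constructor
  · rintro ⟨⟨a, b, c⟩, d⟩
    exact ⟨a, b, lt_of_le_of_ne c fun e => d ⟨e, a⟩⟩
  · rintro ⟨a, b, c⟩
    exact ⟨⟨a, b, c.le⟩, fun e => c.ne e.1⟩

lemma eq_ptA_iff (hNR : N ≠ R) (i : Fin 3) : C = ptA p C N R i ↔ p.Start (tt p C N R i) (hh p C N R i) := by
  have h2 := (frame_uu_ww (C := C) hNR i).eq_point_iff (virt p C N R) (a := (p.mu - p.lam) / 2)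
    (t := tt p C N R i) (h := hh p C N R i)
  rwa [← commander_eq hNR i] at h2

lemma mem_altitude_iff (hp : p.Good) (hNR : N ≠ R) (i : Fin 3) :
    C ∈ segment ℝ (ptS p C N R i) (ptS' p C N R i) ↔
      p.Altitude (tt p C N R i) (hh p C N R i) := by
  have h1 := (frame_uu_ww (C := C) hNR i).mem_segment_altitude_iff (virt p C N R) (a := p.mu / 2)
    (l := p.lam) (t := tt p C N R i) (h := hh p C N R i) hp.lam_pos
  rwa [← commander_eq hNR i] at h1

lemma mem_first_iff (hp : p.Good) (hNR : N ≠ R) (i : Fin 3) :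
    C ∈ convexHull ℝ {ptA p C N R i, ptS p C N R i, ptS' p C N R i} ∧
        C ∉ segment ℝ (ptS p C N R i) (ptS' p C N R i) ↔
      p.First (tt p C N R i) (hh p C N R i) := by
  have F := frame_uu_ww (C := C) hNR i
  have hl := hp.lam_pos
  have h1 := F.mem_triangle_iff (virt p C N R) (a := (p.mu - p.lam) / 2) (b := p.mu / 2)
    (l := p.lam) (t := tt p C N R i) (h := hh p C N R i) hp.lam_pos
  rw [← commander_eq hNR i] at h1
  rw [mem_altitude_iff hp hNR, ptS', ptS, ptA, h1, Params.Altitude, Params.First]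
  constructor
  · rintro ⟨⟨θ, ⟨a, b⟩, e, c, d⟩, hn⟩
    have hθ : θ * p.lam ≤ 1 * p.lam := mul_le_mul_of_nonneg_right b hl.le
    refine ⟨lt_of_le_of_ne (by linarith) fun e' => hn ⟨e', c, by linarith⟩, c, by linarith⟩
  · rintro ⟨a, b, c⟩
    refine ⟨⟨2 * (tt p C N R i - (p.mu - p.lam) / 2) / p.lam, ⟨?_, ?_⟩, ?_, b, ?_⟩, ?_⟩
    · exact div_nonneg (by linarith) hl.le
    · rw [div_le_one hl]; linarith
    · field_simp; ring
    · rw [div_mul_cancel₀ _ hl.ne']; exact c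
    · exact fun e => a.ne e.1

lemma mem_second_iff (hp : p.Good) (hNR : N ≠ R) (i : Fin 3) :
    (C ∈ convexHull ℝ {ptB p C N R i, ptS p C N R i, ptS' p C N R i} ∧
        C ∉ segment ℝ (ptS p C N R i) (ptS' p C N R i) ∧ C ≠ ptB p C N R i) ↔
      p.Second (tt p C N R i) (hh p C N R i) := by
  have F := frame_uu_ww (C := C) hNR i
  have hl := hp.lam_pos
  have h1 := F.mem_triangle_iff (virt p C N R) (a := (p.mu + p.lam) / 2) (b := p.mu / 2)
    (l := p.lam) (t := tt p C N R i) (h := hh p C N R i) hp.lam_pos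
  have h2 := F.eq_point_iff (virt p C N R) (a := (p.mu + p.lam) / 2)
    (t := tt p C N R i) (h := hh p C N R i)
  rw [← commander_eq hNR i] at h1 h2
  rw [mem_altitude_iff hp hNR, ptS', ptS, ptB, h1, ne_eq, h2, Params.Altitude, Params.Second]
  constructor
  · rintro ⟨⟨θ, ⟨a, b⟩, e, c, d⟩, hn, hB⟩
    have hθ : θ * p.lam ≤ 1 * p.lam := mul_le_mul_of_nonneg_right b hl.le
    refine ⟨lt_of_le_of_ne (by linarith) fun e' => hn ⟨e'.symm, c, by linarith⟩, c, by linarith,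
      fun e' => hB ⟨e', by linarith⟩⟩
  · rintro ⟨a, b, c, e⟩
    refine ⟨⟨2 * ((p.mu + p.lam) / 2 - tt p C N R i) / p.lam, ⟨?_, ?_⟩, ?_, b, ?_⟩, ?_, ?_⟩
    · exact div_nonneg (by linarith) hl.le
    · rw [div_le_one hl]; linarith
    · field_simp; ring
    · rw [div_mul_cancel₀ _ hl.ne']; exact c
    · exact fun e => a.ne' e.1
    · exact fun e' => e e'.1

lemma mem_leave_iff (hp : p.Good) (hNR : N ≠ R) (i : Fin 3) :
    C ∈ segment ℝ (ptB p C N R i) (ptD p C N R i) ∧ C ≠ ptD p C N R i ↔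
      p.Leave (tt p C N R i) (hh p C N R i) := by
  have F := frame_uu_ww (C := C) hNR i
  have := hp.lam_pos; have := hp.lam_le
  have h1 := F.mem_segment_base_iff (virt p C N R) (a := (p.mu + p.lam) / 2) (b := p.mu)
    (t := tt p C N R i) (h := hh p C N R i) (by linarith)
  have h2 := F.eq_point_iff (virt p C N R) (a := p.mu)
    (t := tt p C N R i) (h := hh p C N R i)
  rw [← commander_eq hNR i] at h1 h2
  rw [ptB, ptD, Params.Leave, h1, ne_eq, h2]
  constructor
  · rintro ⟨⟨a, b, c⟩, d⟩
    exact ⟨a, b, lt_of_le_of_ne c fun e => d ⟨e, a⟩⟩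
  · rintro ⟨a, b, c⟩
    exact ⟨⟨a, b, c.le⟩, fun e => c.ne e.1⟩

lemma dist_ptS (hNR : N ≠ R) (i : Fin 3) (H : p.Altitude (tt p C N R i) (hh p C N R i)) :
    dist C (ptS p C N R i) = hh p C N R i := by
  have F := frame_uu_ww (C := C) hNR i
  have e : C - ptS p C N R i = (0 : ℝ) • uu C N R i + hh p C N R i • ww C N R i := by
    have h1 : C - virt p C N R = tt p C N R i • uu C N R i + hh p C N R i • ww C N R i :=
      (frame_uu_ww hNR i).expand _
    rw [ptS, ← sub_sub, h1, H.1]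
    module
  rw [dist_eq_norm, e, F.norm_comb, show (0 : ℝ) ^ 2 + hh p C N R i ^ 2 = hh p C N R i ^ 2 by ring,
    Real.sqrt_sq H.2.1]


/-- Commander lies in at most one of the three directions of movement. -/
lemma tt_neg (h : N ≠ R) {i j : Fin 3} (hij : j ≠ i) (ht : 0 < tt p C N R i)
    (h0 : 0 ≤ hh p C N R i) (h1 : hh p C N R i ≤ tt p C N R i / 2) : tt p C N R j < 0 := by
  have F := frame_axis (C := C) h
  have Fi := F.dir_alt i
  have e : tt p C N R j = tt p C N R i * (dirX i * dirX j + dirY i * dirY j) +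
      hh p C N R i * (dirX i * dirY j - dirY i * dirX j) := by
    have : C - virt p C N R = tt p C N R i • uu C N R i + hh p C N R i • ww C N R i :=
      (frame_uu_ww h i).expand _
    rw [tt, this, uu, ww, uu, dirVec_eq, altVec_eq, dirVec_eq, inner_add_left,
      real_inner_smul_left, real_inner_smul_left, F.inner_comb, F.inner_comb]
    ring
  rw [e]
  have s1 := sqrt_three_lt
  have s2 := lt_sqrt_three
  have s3 := sq_sqrt_three
  -- `c1` is the cosine of `120°`, `c2` bounds the sine. The coordinate along `j` is then at most
  -- `-t / 2 + 0.9 h ≤ -t / 2 + 0.45 t`.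
  have c1 : dirX i * dirX j + dirY i * dirY j = -(1 / 2) := by
    fin_cases i <;> fin_cases j <;> simp [dirX, dirY] at hij ⊢ <;> linarith
  have c2 : dirX i * dirY j - dirY i * dirX j ≤ 0.9 := by
    fin_cases i <;> fin_cases j <;> simp [dirX, dirY] at hij ⊢ <;> norm_num <;> linarith
  rw [c1]
  nlinarith

end TuringMobile

end

/-! ### The rules evaluated in coordinates -/

noncomputable section

namespace TuringMobile

variable {p : Params} {C N R : Plane} {upd : ℝ → ℝ} {dir : ℝ → Fin 3}

/-- The rules choose an arbitrary index for which their condition holds. Once the only possible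
index is known, the choice becomes a test for this index. -/
lemma dite_choose_eq_ite {ι α : Sort*} {Q : ι → Prop} {i : ι} [Decidable (∃ j, Q j)]
    [Decidable (Q i)] (F : ι → α) (hQ : ∀ j, Q j → j = i) (G : α) : (if h : ∃ j, Q j then F h.choose else G) = if Q i then F i else G := by
  by_cases h : ∃ j, Q j
  · have e := hQ _ h.choose_spec
    rw [dif_pos h, e, if_pos]
    have := h.choose_spec
    rwa [e] at this
  · rw [dif_neg h, if_neg fun h' => h ⟨i, h'⟩]

open scoped Classical in
/-- The rules of Commander for a position in one of the three directions of movement. -/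
lemma commanderDest_of_cone (hp : p.Good) (hNR : N ≠ R) (i : Fin 3) (ht : 0 < tt p C N R i)
    (h0 : 0 ≤ hh p C N R i) (h1 : hh p C N R i ≤ tt p C N R i / 2) :
    commanderDest p upd dir C N R =
      if p.Approach (tt p C N R i) (hh p C N R i) then ptA p C N R i
      else if p.Start (tt p C N R i) (hh p C N R i) then
        ptS p C N R i + p.shift upd (dist N (ptQ p N R)) • ww C N R i
      else if p.First (tt p C N R i) (hh p C N R i) then
        ptA p C N R i + (p.lam / 2 / (tt p C N R i - (p.mu - p.lam) / 2)) • (C - ptA p C N R i)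
      else if p.Altitude (tt p C N R i) (hh p C N R i) ∧
        dist N (ptQ p N R) = hh p C N R i then ptB p C N R i
      else if p.Second (tt p C N R i) (hh p C N R i) then ptB p C N R i
      else if p.Leave (tt p C N R i) (hh p C N R i) then ptD p C N R i
      else C := by
  have uniq : ∀ j, p.Region (tt p C N R j) (hh p C N R j) → j = i := by
    intro j hj
    by_contra hne
    have := tt_neg (p := p) hNR hne ht h0 h1
    linarith [(hj.cone hp).1]
  have hA : ∀ j, inner ℝ (C - ptA p C N R j) (uu C N R j) =
      tt p C N R j - (p.mu - p.lam) / 2 := fun j => by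
    rw [ptA, ← sub_sub, inner_sub_left, real_inner_smul_left, (frame_uu_ww hNR j).inner₁₁, tt,
      mul_one]
  dsimp only [commanderDest]
  rw [if_neg (fun h => ht.ne' ((eq_virt_iff hNR i).1 h).1),
    dite_choose_eq_ite (fun j => ptA p C N R j) fun j hj =>
      uniq j (((mem_approach_iff hp hNR j).1 hj).region hp),
    dite_choose_eq_ite (fun j => ptS p C N R j + p.shift upd (dist N (ptQ p N R)) • ww C N R j)
      fun j hj => uniq j (((eq_ptA_iff hNR j).1 hj).region hp),
    dite_choose_eq_ite (fun j => ptA p C N R j +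
      (p.lam / 2 / inner ℝ (C - ptA p C N R j) (uu C N R j)) • (C - ptA p C N R j))
      fun j hj => uniq j (((mem_first_iff hp hNR j).1 hj).region hp),
    dite_choose_eq_ite (fun j => ptB p C N R j) fun j hj =>
      uniq j (((mem_altitude_iff hp hNR j).1 hj.1).region hp),
    dite_choose_eq_ite (fun j => ptB p C N R j) fun j hj =>
      uniq j (((mem_second_iff hp hNR j).1 hj).region hp),
    dite_choose_eq_ite (fun j => ptD p C N R j) fun j hj =>
      uniq j (((mem_leave_iff hp hNR j).1 hj).region hp)]
  have hdist : (C ∈ segment ℝ (ptS p C N R i) (ptS' p C N R i) ∧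
      dist N (ptQ p N R) = dist C (ptS p C N R i)) ↔
      p.Altitude (tt p C N R i) (hh p C N R i) ∧ dist N (ptQ p N R) = hh p C N R i := by
    rw [mem_altitude_iff hp hNR]
    refine and_congr_right fun h => ?_
    rw [dist_ptS hNR i h]
  simp only [mem_approach_iff hp hNR, eq_ptA_iff hNR, mem_first_iff hp hNR, hdist,
    mem_second_iff hp hNR, mem_leave_iff hp hNR, hA]

lemma commanderDest_of_eq_virt (h : C = virt p C N R) :
    commanderDest p upd dir C N R = ptA p C N R (dir (p.decode (dist N (ptQ p N R)))) := by
  dsimp only [commanderDest]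
  rw [if_pos h]

/-- Commander stays outside the regions of its rules. -/
lemma commanderDest_of_not_region (hp : p.Good) (hNR : N ≠ R)
    (h : ∀ i, ¬ p.Region (tt p C N R i) (hh p C N R i)) :
    commanderDest p upd dir C N R = C := by
  have hm : 0 < p.mu := by linarith [hp.lam_pos, hp.lam_le]
  have h0 : C ≠ virt p C N R := fun e => by
    obtain ⟨h1, h2⟩ := (eq_virt_iff hNR 0).1 e
    exact h 0 (Or.inl ⟨h2, h1.ge, h1.trans_lt hm⟩)
  have no : ∀ Q : Fin 3 → Prop, (∀ j, Q j → p.Region (tt p C N R j) (hh p C N R j)) →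
      ¬ ∃ j, Q j := fun Q hQ ⟨j, hj⟩ => h j (hQ j hj)
  dsimp only [commanderDest]
  rw [if_neg h0,
    dif_neg (no _ fun j hj => ((mem_approach_iff hp hNR j).1 hj).region hp),
    dif_neg (no _ fun j hj => ((eq_ptA_iff hNR j).1 hj).region hp),
    dif_neg (no _ fun j hj => ((mem_first_iff hp hNR j).1 hj).region hp),
    dif_neg (no _ fun j hj => ((mem_altitude_iff hp hNR j).1 hj.1).region hp),
    dif_neg (no _ fun j hj => ((mem_second_iff hp hNR j).1 hj).region hp),
    dif_neg (no _ fun j hj => ((mem_leave_iff hp hNR j).1 hj).region hp)]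

lemma Params.Good.mu_pos (hp : p.Good) : 0 < p.mu := by linarith [hp.lam_pos, hp.lam_le]

lemma Params.Good.d_pos (hp : p.Good) : 0 < p.d := by linarith [hp.mu_pos, hp.mu_le]

lemma Params.Good.dmin_sq (hp : p.Good) : p.dmin ^ 2 = p.d ^ 2 + p.mu ^ 2 - p.d * p.mu := by
  rw [Params.dmin, Real.sq_sqrt]
  have := mul_pos hp.mu_pos hp.d_pos
  nlinarith [sq_nonneg (p.d - p.mu)]

lemma Params.Good.dmin_pos (hp : p.Good) : 0 < p.dmin := by
  refine Real.sqrt_pos.2 ?_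
  nlinarith [sq_nonneg (p.d - p.mu), mul_pos hp.mu_pos hp.d_pos]

/-- The distance of Commander from Reference when Commander is in one of the regions. -/
lemma dist_bounds_of_region (hp : p.Good) (hNR : N ≠ R) {i : Fin 3}
    (h : p.Region (tt p C N R i) (hh p C N R i)) :
    p.dmin < dist C R ∧ dist C R < p.d + p.mu := by
  have F := frame_axis (C := C) hNR
  have e : C - R = (tt p C N R i * dirX i - hh p C N R i * dirY i) • axis₁ N R +
      (p.d + (tt p C N R i * dirY i + hh p C N R i * dirX i)) • axis₂ C N R := by
    have h1 : C - virt p C N R = tt p C N R i • uu C N R i + hh p C N R i • ww C N R i :=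
      (frame_uu_ww hNR i).expand _
    have h2 : C - R = (C - virt p C N R) + p.d • axis₂ C N R := by rw [virt]; abel
    rw [h2, h1, uu, ww, dirVec_eq, altVec_eq]
    module
  have hd := h.dist_bounds hp i
  rw [dist_eq_norm, e, F.norm_comb]
  constructor
  · rw [Real.lt_sqrt hp.dmin_pos.le, hp.dmin_sq]
    exact hd.1
  · rw [Real.sqrt_lt' (by linarith [hp.mu_pos, hp.d_pos])]
    exact hd.2

/-- Every region keeps strictly between these two distances from Reference. So no rule of Commander
fires in a final destination, even while Number's motion turns the frame that is read off from
Reference and Number. -/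
lemma commanderDest_of_dist (hp : p.Good) (hNR : N ≠ R)
    (h : dist C R = p.d + p.mu ∨ dist C R = p.dmin) : commanderDest p upd dir C N R = C := by
  refine commanderDest_of_not_region hp hNR fun i hi => ?_
  have := dist_bounds_of_region hp hNR hi
  rcases h with h | h <;> rw [h] at this
  · exact lt_irrefl _ this.2
  · exact lt_irrefl _ this.1

/-- Number stays while Commander is neither in a final destination nor on an altitude. -/
lemma numberDest_of_not_altitude (hp : p.Good) (hNR : N ≠ R) (h1 : dist C R ≠ p.d + p.mu)
    (h2 : dist C R ≠ p.dmin) (h : ∀ i, ¬ p.Altitude (tt p C N R i) (hh p C N R i)) :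
    numberDest p C N R = N := by
  simp only [numberDest]
  rw [if_neg (by tauto), dif_neg]
  rintro ⟨i, hi⟩
  exact h i ((mem_altitude_iff hp hNR i).1 hi)

/-- The destination of Number when Commander is on an altitude. -/
lemma numberDest_of_altitude (hp : p.Good) (hNR : N ≠ R) (i : Fin 3)
    (h : p.Altitude (tt p C N R i) (hh p C N R i)) :
    numberDest p C N R = ptQ p N R + hh p C N R i • axis₁ N R := by
  classical
  have hd := dist_bounds_of_region hp hNR (h.region hp)
  have hex : ∃ j, C ∈ segment ℝ (ptS p C N R j) (ptS' p C N R j) :=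
    ⟨i, (mem_altitude_iff hp hNR i).2 h⟩
  have e : hex.choose = i := by
    by_contra hne
    have h' := (mem_altitude_iff hp hNR _).1 hex.choose_spec
    have hc := (h.region hp).cone hp
    have hm := hp.mu_pos
    have := tt_neg (p := p) hNR hne (by rw [h.1]; linarith) hc.2.1 hc.2.2
    linarith [((h'.region hp).cone hp).1]
  simp only [numberDest]
  rw [if_neg (fun h => h.elim hd.2.ne hd.1.ne'), dif_pos hex, e, dist_ptS hNR i h]

lemma referenceDest_of_commander (h : commanderDest p upd dir C N R ≠ C) :
    referenceDest p upd dir C N R = R := by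
  rw [referenceDest, if_neg fun h' => h h'.1]

lemma referenceDest_of_number (h : numberDest p C N R ≠ N) :
    referenceDest p upd dir C N R = R := by
  rw [referenceDest, if_neg fun h' => h h'.2.1]

end TuringMobile

end

/-! ### Commander on its way, Number on its axis -/

noncomputable section

namespace TuringMobile

variable {p : Params} {C N R e₁ e₂ : Plane} {upd : ℝ → ℝ} {dir : ℝ → Fin 3}

/-- Number is at distance `y` from `Q`, the frame is given by `e₁` and `e₂`, and Commander has
the coordinates `t` and `h` along and across the `i`-th move. -/
structure Straight (p : Params) (e₁ e₂ C N R : Plane) (i : Fin 3) (t h y : ℝ) : Prop where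
  frame : Frame e₁ e₂
  eq_C : C - R = p.d • e₂ + (t • dirVec e₁ e₂ i + h • altVec e₁ e₂ i)
  eq_N : N - R = (2 * p.d - p.lam / 2 + y) • e₁
  t_nonneg : 0 ≤ t
  t_le : t ≤ p.mu
  h_nonneg : 0 ≤ h
  h_le : h ≤ p.lam
  y_pos : 0 < y

variable {i : Fin 3} {t h y : ℝ}

lemma abs_dirX_le (i : Fin 3) : |dirX i| ≤ 1 := by
  have := dirX_sq_add i
  exact abs_le_one_iff_mul_self_le_one.2 (by nlinarith [sq_nonneg (dirY i)])

lemma abs_dirY_le (i : Fin 3) : |dirY i| ≤ 1 := by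
  have := dirX_sq_add i
  exact abs_le_one_iff_mul_self_le_one.2 (by nlinarith [sq_nonneg (dirX i)])

section

variable (hp : p.Good) (S : Straight p e₁ e₂ C N R i t h y)
include hp S

lemma Straight.axes : axis₁ N R = e₁ ∧ axis₂ C N R = e₂ := by
  have hx := abs_le.1 (abs_dirX_le i)
  have hy := abs_le.1 (abs_dirY_le i)
  have h1 := hp.lam_pos; have h2 := hp.lam_le; have h3 := hp.mu_le
  refine S.frame.axes_eq_self (c₁ := t * dirX i - h * dirY i)
    (c₂ := p.d + (t * dirY i + h * dirX i)) ?_ S.eq_N ?_ ?_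
  · rw [S.eq_C, dirVec_eq, altVec_eq]; module
  · linarith [S.y_pos]
  · nlinarith [mul_nonneg S.t_nonneg (by linarith [hy.1] : 0 ≤ 1 + dirY i),
      mul_nonneg S.h_nonneg (by linarith [hx.1] : 0 ≤ 1 + dirX i), S.t_le, S.h_le]

lemma Straight.ne : N ≠ R := by
  intro h
  have h1 := hp.lam_pos; have h2 := hp.lam_le; have h3 := hp.mu_le
  have h4 := S.eq_N
  have h5 := S.frame.norm_comb (2 * p.d - p.lam / 2 + y) 0
  rw [zero_smul, add_zero, ← h4, h, sub_self, norm_zero] at h5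
  have := Real.sqrt_eq_zero'.1 h5.symm
  nlinarith [S.y_pos]

lemma Straight.uu_eq (j : Fin 3) : uu C N R j = dirVec e₁ e₂ j := by
  rw [uu, (S.axes hp).1, (S.axes hp).2]

lemma Straight.ww_eq (j : Fin 3) : ww C N R j = altVec e₁ e₂ j := by
  rw [ww, (S.axes hp).1, (S.axes hp).2]

lemma Straight.sub_virt :
    C - virt p C N R = t • dirVec e₁ e₂ i + h • altVec e₁ e₂ i := by
  rw [virt, (S.axes hp).2, ← sub_sub, S.eq_C, add_sub_cancel_left]

lemma Straight.virt_eq :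
    virt p C N R = C - (t • dirVec e₁ e₂ i + h • altVec e₁ e₂ i) := by
  rw [← S.sub_virt hp, sub_sub_cancel]

lemma Straight.tt_eq : tt p C N R i = t := by
  rw [tt, S.uu_eq hp, S.sub_virt hp, (S.frame.dir_alt i).inner_comb_left]

lemma Straight.hh_eq : hh p C N R i = h := by
  rw [hh, S.ww_eq hp, S.sub_virt hp, (S.frame.dir_alt i).inner_comb_right]

lemma Straight.dist_Q : dist N (ptQ p N R) = y := by
  have h1 : ‖e₁‖ = 1 := by rw [norm_eq_sqrt_real_inner, S.frame.inner₁₁, Real.sqrt_one]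
  rw [dist_eq_norm, ptQ, (S.axes hp).1, ← sub_sub, S.eq_N, ← sub_smul, norm_smul, h1, mul_one, Real.norm_eq_abs,
    add_sub_cancel_left, abs_of_pos S.y_pos]

lemma Straight.ptA_eq :
    ptA p C N R i = C + (((p.mu - p.lam) / 2 - t) • dirVec e₁ e₂ i + (-h) • altVec e₁ e₂ i) := by
  rw [ptA, S.uu_eq hp, S.virt_eq hp]; module

lemma Straight.ptS_eq :
    ptS p C N R i = C + ((p.mu / 2 - t) • dirVec e₁ e₂ i + (-h) • altVec e₁ e₂ i) := by
  rw [ptS, S.uu_eq hp, S.virt_eq hp]; module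

lemma Straight.ptB_eq :
    ptB p C N R i = C + (((p.mu + p.lam) / 2 - t) • dirVec e₁ e₂ i + (-h) • altVec e₁ e₂ i) := by
  rw [ptB, S.uu_eq hp, S.virt_eq hp]; module

lemma Straight.ptD_eq :
    ptD p C N R i = C + ((p.mu - t) • dirVec e₁ e₂ i + (-h) • altVec e₁ e₂ i) := by
  rw [ptD, S.uu_eq hp, S.virt_eq hp]; module

lemma Straight.region (hR : p.Region t h) : p.Region (tt p C N R i) (hh p C N R i) := by
  rwa [S.tt_eq hp, S.hh_eq hp]

/-- Number stays unless Commander is on the altitude of the midway triangle. -/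
lemma Straight.numberDest_eq (hR : p.Region t h) (hne : t ≠ p.mu / 2) :
    numberDest p C N R = N := by
  have hd := dist_bounds_of_region hp (S.ne hp) (S.region hp hR)
  refine numberDest_of_not_altitude hp (S.ne hp) hd.2.ne hd.1.ne' fun j hj => ?_
  have hm := hp.mu_pos
  rcases eq_or_ne j i with rfl | hji
  · exact hne (by rw [← hj.1, S.tt_eq hp])
  · have hc := ((hj.region hp).cone hp)
    have := tt_neg (p := p) (S.ne hp) hji.symm (by rw [hj.1]; linarith) hc.2.1 hc.2.2
    have := (hR.cone hp).1
    rw [S.tt_eq hp] at *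
    linarith

/-- The direction is read from the stored number only at the start, `t = 0`. From then on the
position of Commander itself shows it, which is what lets oblivious robots continue. -/
lemma Straight.commanderDest_approach (hd : t = 0 → dir (p.decode y) = i)
    (ht : t < (p.mu - p.lam) / 2) (hh : h = 0) :
    commanderDest p upd dir C N R = C + ((p.mu - p.lam) / 2 - t) • dirVec e₁ e₂ i := by
  subst hh
  have hA := S.ptA_eq hp
  rw [neg_zero, zero_smul, add_zero] at hA
  rcases S.t_nonneg.eq_or_lt with h0 | h0
  · rw [commanderDest_of_eq_virt, S.dist_Q hp, hd h0.symm, hA]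
    rw [← sub_eq_zero, S.sub_virt hp, ← h0]
    simp
  · rw [commanderDest_of_cone hp (S.ne hp) i (by rwa [S.tt_eq hp]) (by rw [S.hh_eq hp])
      (by rw [S.hh_eq hp, S.tt_eq hp]; positivity), S.tt_eq hp, S.hh_eq hp,
      if_pos ⟨rfl, h0.le, ht⟩, hA]

/-- Commander has covered the fraction `s` of the way from `A` to height `y'` on the altitude. At `s
= 0` it computes `y'` from the stored number; later it recovers the same end by extending the line
from `A`. The bound `y' < lam` keeps this path inside the triangle. -/
lemma Straight.commanderDest_first {s y' : ℝ} (hs : 0 ≤ s) (hs1 : s < 1)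
    (ht : t = (p.mu - p.lam) / 2 + s * (p.lam / 2)) (hh : h = s * y') (hy : p.shift upd y = y')
    (hy0 : 0 < y') (hy1 : y' < p.lam) :
    commanderDest p upd dir C N R =
      C + (1 - s) • ((p.lam / 2) • dirVec e₁ e₂ i + y' • altVec e₁ e₂ i) := by
  have l1 := hp.lam_pos; have l2 := hp.lam_le
  have a1 : 0 ≤ s * (p.lam / 2) := by positivity
  have a2 : s * y' ≤ 1 * y' := by gcongr
  have a3 : s * y' ≤ s * p.lam := by gcongr
  have a4 := S.h_nonneg
  rw [commanderDest_of_cone hp (S.ne hp) i (by rw [S.tt_eq hp]; linarith)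
    (by rw [S.hh_eq hp]; exact S.h_nonneg)
    (by rw [S.hh_eq hp, S.tt_eq hp]; linarith), S.tt_eq hp, S.hh_eq hp,
    if_neg fun H : p.Approach t h => by linarith [H.2.2]]
  rcases hs.eq_or_lt with rfl | h0
  · rw [if_pos (show p.Start t h from ⟨by linarith, by linarith⟩), S.dist_Q hp, hy, S.ptS_eq hp,
      S.ww_eq hp, ht, hh]
    module
  · have a5 : s * (p.lam / 2) < 1 * (p.lam / 2) := by gcongr
    have a6 : 0 < s * (p.lam / 2) := by positivity
    rw [if_neg fun H : p.Start t h => by linarith [H.1],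
      if_pos (show p.First t h from ⟨by linarith, by linarith, by linarith⟩), S.ptA_eq hp, ht, hh]
    have e : p.lam / 2 / ((p.mu - p.lam) / 2 + s * (p.lam / 2) - (p.mu - p.lam) / 2) = 1 / s := by
      rw [add_sub_cancel_left]; field_simp
    rw [e]
    have e2 : C - (C + (((p.mu - p.lam) / 2 - ((p.mu - p.lam) / 2 + s * (p.lam / 2))) •
        dirVec e₁ e₂ i + (-(s * y')) • altVec e₁ e₂ i)) =
        s • ((p.lam / 2) • dirVec e₁ e₂ i + y' • altVec e₁ e₂ i) := by module
    rw [e2, smul_smul, one_div_mul_cancel h0.ne']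
    module

/-- The height `h` is the message. Commander must hold it until Number has copied it, so every rule
has to fail here, in particular the one that compares `y` with `h`. -/
lemma Straight.commanderDest_wait (ht : t = p.mu / 2) (hy : y ≠ h) :
    commanderDest p upd dir C N R = C := by
  have l1 := hp.lam_pos; have l2 := hp.lam_le
  have a1 := S.h_le
  rw [commanderDest_of_cone hp (S.ne hp) i (by rw [S.tt_eq hp]; linarith)
    (by rw [S.hh_eq hp]; exact S.h_nonneg)
    (by rw [S.hh_eq hp, S.tt_eq hp]; linarith), S.tt_eq hp, S.hh_eq hp, S.dist_Q hp,
    if_neg fun H : p.Approach t h => by linarith [H.2.2],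
    if_neg fun H : p.Start t h => by linarith [H.1],
    if_neg fun H : p.First t h => by linarith [H.1], if_neg fun H => hy H.2,
    if_neg fun H : p.Second t h => by linarith [H.1],
    if_neg fun H : p.Leave t h => by linarith [H.2.1]]

lemma Straight.numberDest_altitude (ht : t = p.mu / 2) :
    numberDest p C N R = N + (h - y) • e₁ := by
  have hA : p.Altitude t h := ⟨ht, S.h_nonneg, S.h_le⟩
  rw [numberDest_of_altitude hp (S.ne hp) i (by rwa [S.tt_eq hp, S.hh_eq hp]), S.hh_eq hp, ptQ,
    (S.axes hp).1, eq_add_of_sub_eq S.eq_N]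
  module

lemma Straight.commanderDest_second {s y' : ℝ} (hs : 0 ≤ s) (hs1 : s < 1)
    (ht : t = p.mu / 2 + s * (p.lam / 2)) (hh : h = (1 - s) * y') (hy : y = y')
    (hy1 : y' < p.lam) :
    commanderDest p upd dir C N R =
      C + (1 - s) • ((p.lam / 2) • dirVec e₁ e₂ i + (-y') • altVec e₁ e₂ i) := by
  have l1 := hp.lam_pos; have l2 := hp.lam_le
  have hy0 := S.y_pos
  subst hy
  have a0 : 0 < 1 - s := by linarith
  have a1 : 0 ≤ s * (p.lam / 2) := by positivity
  have a3 : (1 - s) * y ≤ (1 - s) * p.lam := by gcongr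
  have a4 := S.h_nonneg
  have a5 : s * (p.lam / 2) < 1 * (p.lam / 2) := by gcongr
  have a6 := S.h_le
  rw [commanderDest_of_cone hp (S.ne hp) i (by rw [S.tt_eq hp]; linarith)
    (by rw [S.hh_eq hp]; exact S.h_nonneg)
    (by rw [S.hh_eq hp, S.tt_eq hp]; linarith), S.tt_eq hp, S.hh_eq hp, S.dist_Q hp,
    if_neg fun H : p.Approach t h => by linarith [H.2.2],
    if_neg fun H : p.Start t h => by linarith [H.1],
    if_neg fun H : p.First t h => by linarith [H.1]]
  have hB : ptB p C N R i =
      C + (1 - s) • ((p.lam / 2) • dirVec e₁ e₂ i + (-y) • altVec e₁ e₂ i) := by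
    rw [S.ptB_eq hp, ht, hh]; module
  rcases hs.eq_or_lt with rfl | h0
  · rw [if_pos (show p.Altitude t h ∧ y = h from ⟨⟨by linarith, a4, a6⟩, by linarith⟩), hB]
  · have a7 : 0 < s * (p.lam / 2) := by positivity
    rw [if_neg fun H : p.Altitude t h ∧ y = h => by linarith [H.1.1],
      if_pos (show p.Second t h from ⟨by linarith, a4, by linarith, by linarith⟩), hB]

lemma Straight.commanderDest_leave (ht : (p.mu + p.lam) / 2 ≤ t) (ht1 : t < p.mu) (hh : h = 0) :
    commanderDest p upd dir C N R = C + (p.mu - t) • dirVec e₁ e₂ i := by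
  subst hh
  have l1 := hp.lam_pos; have l2 := hp.lam_le
  rw [commanderDest_of_cone hp (S.ne hp) i (by rw [S.tt_eq hp]; linarith)
    (by rw [S.hh_eq hp])
    (by rw [S.hh_eq hp, S.tt_eq hp]; linarith), S.tt_eq hp, S.hh_eq hp,
    if_neg fun H : p.Approach t 0 => by linarith [H.2.2],
    if_neg fun H : p.Start t 0 => by linarith [H.1],
    if_neg fun H : p.First t 0 => by linarith [H.1],
    if_neg fun H : p.Altitude t 0 ∧ _ => by linarith [H.1.1],
    if_neg fun H : p.Second t 0 => H.2.2.2 (by linarith [H.2.2.1]),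
    if_pos ⟨rfl, ht, ht1⟩, S.ptD_eq hp, neg_zero, zero_smul, add_zero]

end

end TuringMobile

end

/-! ### Number's move to its final destination -/

noncomputable section

namespace TuringMobile

variable {p : Params} {C N R e₁ e₂ : Plane} {upd : ℝ → ℝ} {dir : ℝ → Fin 3}

lemma pi_div_two_lt_angle_iff :
    Real.pi / 2 < EuclideanGeometry.angle N R C ↔ inner ℝ (N - R) (C - R) < (0 : ℝ) := by
  rw [EuclideanGeometry.angle, InnerProductGeometry.angle, vsub_eq_sub, vsub_eq_sub,
    ← not_le, Real.arccos_le_pi_div_two, not_le]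
  constructor
  · intro h
    by_contra hn
    exact absurd h (not_lt.2 (div_nonneg (not_lt.1 hn) (by positivity)))
  · intro h
    refine div_neg_of_neg_of_pos h (mul_pos ?_ ?_) <;> rw [norm_pos_iff] <;> rintro h0 <;>
      simp [h0] at h

lemma angle_lt_pi_div_two_iff :
    EuclideanGeometry.angle N R C < Real.pi / 2 ↔ 0 < (inner ℝ (N - R) (C - R) : ℝ) := by
  rw [EuclideanGeometry.angle, InnerProductGeometry.angle, vsub_eq_sub, vsub_eq_sub,
    Real.arccos_lt_pi_div_two]
  constructor
  · intro h
    by_contra hn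
    exact absurd h (not_lt.2 (div_nonpos_of_nonpos_of_nonneg (not_lt.1 hn) (by positivity)))
  · intro h
    refine div_pos h (mul_pos ?_ ?_) <;> rw [norm_pos_iff] <;> rintro h0 <;>
      simp [h0] at h

/-- Commander is displaced by `a`, Number by `b` in the direction of the `i`-th move, with respect
to a machine at rest with the given Reference. -/
structure Shifted (p : Params) (e₁ e₂ C N R : Plane) (i : Fin 3) (y a b : ℝ) : Prop where
  frame : Frame e₁ e₂
  eq_C : C - R = p.d • e₂ + a • dirVec e₁ e₂ i
  eq_N : N - R = (2 * p.d - p.lam / 2 + y) • e₁ + b • dirVec e₁ e₂ i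
  y_pos : 0 < y
  y_lt : y < p.lam
  a_nonneg : 0 ≤ a
  a_le : a ≤ p.mu
  b_nonneg : 0 ≤ b
  b_le : b ≤ p.mu

variable {i : Fin 3} {y a b : ℝ}

section

variable (S : Shifted p e₁ e₂ C N R i y a b)
include S

lemma Shifted.eq_C' : C - R = (a * dirX i) • e₁ + (p.d + a * dirY i) • e₂ := by
  rw [S.eq_C, dirVec_eq]; module

lemma Shifted.eq_N' :
    N - R = (2 * p.d - p.lam / 2 + y + b * dirX i) • e₁ + (b * dirY i) • e₂ := by
  rw [S.eq_N, dirVec_eq]; module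

lemma Shifted.dist_CR : dist C R = √(p.d ^ 2 + a ^ 2 + 2 * p.d * a * dirY i) := by
  rw [dist_eq_norm, S.eq_C', S.frame.norm_comb]
  congr 1
  linear_combination a ^ 2 * dirX_sq_add i

lemma Shifted.inner_eq (ha : a = p.mu) : (inner ℝ (N - R) (C - R) : ℝ) =
    p.mu * dirX i * (2 * p.d - p.lam / 2 + y) + b * p.mu + b * p.d * dirY i := by
  rw [S.eq_C', S.eq_N', S.frame.inner_comb, ha]
  linear_combination b * p.mu * dirX_sq_add i

variable (hp : p.Good)
include hp

lemma Shifted.ne : N ≠ R := by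
  intro h
  have h1 := hp.lam_pos; have h2 := hp.lam_le; have h3 := hp.mu_le
  have hx := abs_le.1 (abs_dirX_le i)
  have h4 := S.frame.inner_comb_left (2 * p.d - p.lam / 2 + y + b * dirX i) (b * dirY i)
  rw [← S.eq_N', h, sub_self, inner_zero_left] at h4
  nlinarith [S.y_pos, mul_nonneg S.b_nonneg (by linarith [hx.1] : 0 ≤ 1 + dirX i), S.b_le]

lemma Shifted.dist_final (ha : a = p.mu) :
    (i = 0 ∧ dist C R = p.d + p.mu) ∨ (i ≠ 0 ∧ dist C R = p.dmin) := by
  rw [S.dist_CR, ha, Params.dmin]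
  have hm := hp.mu_pos; have hd := hp.d_pos
  by_cases hi : i = 0
  · left
    refine ⟨hi, ?_⟩
    rw [hi, show p.d ^ 2 + p.mu ^ 2 + 2 * p.d * p.mu * dirY 0 = (p.d + p.mu) ^ 2 by
      simp [dirY]; ring, Real.sqrt_sq (by linarith)]
  · right
    refine ⟨hi, ?_⟩
    congr 1
    fin_cases i
    · exact absurd rfl hi
    · simp [dirY]; ring
    · simp [dirY]; ring

lemma Shifted.commanderDest_final (ha : a = p.mu) : commanderDest p upd dir C N R = C :=
  commanderDest_of_dist hp (S.ne hp) ((S.dist_final hp ha).imp And.right And.right)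

/-- The line through Number parallel to the move meets the axis of the old position at Number's
starting point, because no direction is parallel to `e₁`. Number thus recovers where it started
however far it has come, and its destination does not depend on `b`. -/
lemma Shifted.ptD'_eq (ha : a = p.mu) :
    ptD' (R + p.d • e₂) C N R = N + (p.mu - b) • dirVec e₁ e₂ i := by
  have hm := hp.mu_pos; have hd := hp.d_pos
  have hy : dirY i ≠ 0 := by fin_cases i <;> simp [dirY]
  have e1 : C - (R + p.d • e₂) = p.mu • dirVec e₁ e₂ i := by
    rw [← sub_sub, S.eq_C, ha]; module
  have e2 : (inner ℝ (N - R) (p.d • e₂) : ℝ) = b * dirY i * p.d := by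
    rw [S.eq_N', real_inner_smul_right, S.frame.inner_comb_right]; ring
  have e3 : (inner ℝ (p.mu • dirVec e₁ e₂ i) (p.d • e₂) : ℝ) = p.mu * dirY i * p.d := by
    rw [dirVec_eq, real_inner_smul_right, real_inner_smul_left, S.frame.inner_comb_right]; ring
  rw [ptD', add_sub_cancel_left, e1, e2, e3, show b * dirY i * p.d / (p.mu * dirY i * p.d) =
    b / p.mu by field_simp, smul_smul, div_mul_cancel₀ _ hm.ne']
  module

/-- The old position of Commander is a vertex of the triangle with sides `d`, `mu`, `d'` over the
segment from Reference to Commander. Two such points exist, and `σ` selects the right one; the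
second and the third direction are mirror images and are treated at once. -/
lemma Shifted.virtNear_eq (ha : a = p.mu) (σ : ℝ) (hσ : σ * dirX i = -(√3 / 2))
    (hy : dirY i = -(1 / 2)) (hσ' : σ * σ = 1) : virtNear p σ C N R = R + p.d • e₂ := by
  subst ha
  have h1 := hp.lam_pos; have h2 := hp.lam_le; have h3 := hp.mu_le
  have hx := abs_le.1 (abs_dirX_le i)
  -- Number remains on the same side of the line through Reference and Commander during its whole
  -- move, so it is a reliable landmark for `side`.
  have hdet : p.mu * dirX i * (b * dirY i) - (p.d + p.mu * dirY i) *
      (2 * p.d - p.lam / 2 + y + b * dirX i) < 0 := by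
    rw [hy]
    have a1 : 0 ≤ b * (1 + dirX i) := mul_nonneg S.b_nonneg (by linarith)
    have a2 : p.d < 2 * p.d - p.lam / 2 + y + b * dirX i := by
      linarith [S.b_le, S.y_pos]
    have a3 : p.mu * dirX i * (b * -(1 / 2)) ≤ p.mu * p.mu := by
      have := mul_le_mul_of_nonneg_left (show -(1 / 2) * (b * dirX i) ≤ p.mu by
        linarith [S.b_le]) hp.mu_pos.le
      linarith
    have a4 : p.mu * p.mu < (p.d + p.mu * -(1 / 2)) * (2 * p.d - p.lam / 2 + y + b * dirX i) := by
      apply mul_lt_mul'' <;> linarith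
    linarith
  have hD := hp.dmin_sq
  have hD' : p.dmin ^ 2 ≠ 0 := by have := hp.dmin_pos; positivity
  have hX : dirX i = -(√3 / 2) * σ := by
    rw [← hσ, mul_right_comm, hσ', one_mul]
  have s3 := sq_sqrt_three
  have swap : ∀ (s k : ℝ) (v : Plane), (σ * s * k) • v = (σ * k) • (s • v) := fun s k v => by
    module
  rw [virtNear, swap, S.eq_C', S.eq_N', S.frame.side_smul_rot_neg hdet]
  have k1 : p.d * (p.d - p.mu / 2) / p.dmin ^ 2 * (p.mu * dirX i) +
      σ * (√3 / 2 * p.d * p.mu / p.dmin ^ 2) * (p.d + p.mu * dirY i) = 0 := by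
    rw [hX, hy]; field_simp; ring
  have k2 : p.d * (p.d - p.mu / 2) / p.dmin ^ 2 * (p.d + p.mu * dirY i) -
      σ * (√3 / 2 * p.d * p.mu / p.dmin ^ 2) * (p.mu * dirX i) = p.d := by
    rw [hX, hy, div_mul_eq_mul_div, ← mul_div_assoc, div_mul_eq_mul_div, ← sub_div,
      div_eq_iff hD', hD]
    linear_combination (p.d * p.mu ^ 2 / 4) * (σ * σ) * s3 + (p.d * p.mu ^ 2 * 3 / 4) * hσ'
  rw [show ∀ k l c c' : ℝ, R + k • (c • e₁ + c' • e₂) + l • (c' • e₁ + (-c) • e₂) =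
      R + ((k * c + l * c') • e₁ + (k * c' - l * c) • e₂) from fun k l c c' => by module, k1, k2,
    zero_smul, zero_add]

/-- Number moves to its final destination when Commander has reached its own. -/
lemma Shifted.numberDest_final (ha : a = p.mu) :
    numberDest p C N R = N + (p.mu - b) • dirVec e₁ e₂ i := by
  have h1 := hp.lam_pos; have h2 := hp.lam_le; have h3 := hp.mu_le
  have hm := hp.mu_pos; have hd := hp.d_pos
  have s1 := lt_sqrt_three
  have hin := S.inner_eq ha
  have hb := mul_le_mul S.b_le le_rfl hm.le hm.le
  have hb' := mul_le_mul S.b_le le_rfl hd.le hm.le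
  have hb0 := mul_nonneg S.b_nonneg hm.le
  have hb1 := mul_nonneg S.b_nonneg hd.le
  have hmm : 1000 * (p.mu * p.mu) ≤ p.mu * p.d := by nlinarith
  have hlow : p.mu * (p.d * 1.999) ≤ p.mu * (2 * p.d - p.lam / 2 + y) := by
    gcongr; linarith [S.y_pos]
  have hpos : 0 < p.mu * (2 * p.d - p.lam / 2 + y) :=
    lt_of_lt_of_le (by positivity) hlow
  -- The sign of the inner product, hence the type of the angle, is that of `dirX i`: the term with
  -- `dirX i` exceeds `1.7 mu d`, while the terms with `b` stay within about `mu d / 2`.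
  have hbig : 1.7 * (p.mu * p.d) < √3 / 2 * (p.mu * (2 * p.d - p.lam / 2 + y)) := by
    have := mul_lt_mul_of_pos_right (show (0.866 : ℝ) < √3 / 2 by linarith) hpos
    nlinarith [mul_pos hm hd]
  rw [numberDest, if_pos ((S.dist_final hp ha).imp And.right And.right)]
  by_cases hi : i = 0
  · have hdist : dist C R = p.d + p.mu := by
      rcases S.dist_final hp ha with h | h
      · exact h.2
      · exact absurd hi h.1
    rw [if_pos hdist]
    have : virtFar p C R = R + p.d • e₂ := by
      rw [virtFar, S.eq_C', hi, ha]
      simp only [dirX, dirY, Matrix.cons_val_zero, mul_zero, zero_smul, zero_add, mul_one,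
        smul_smul]
      rw [div_mul_cancel₀ _ (by linarith)]
    rw [this, S.ptD'_eq hp ha]
  · have hdist : dist C R ≠ p.d + p.mu := by
      rcases S.dist_final hp ha with h | h
      · exact absurd h.1 hi
      · rw [h.2]
        intro e
        have := hp.dmin_sq
        rw [e] at this
        nlinarith [mul_pos hm hd]
    rw [if_neg hdist]
    simp only [pi_div_two_lt_angle_iff, angle_lt_pi_div_two_iff, hin]
    fin_cases i
    · exact absurd rfl hi
    · rw [if_pos, S.virtNear_eq hp ha 1 (by simp [dirX]) (by simp [dirY]) (by norm_num),
        S.ptD'_eq hp ha]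
      simp only [dirX, dirY, Matrix.cons_val, Fin.mk_one]
      linarith
    · have : 0 < p.mu * dirX 2 * (2 * p.d - p.lam / 2 + y) + b * p.mu + b * p.d * dirY 2 := by
        simp only [dirX, dirY, Matrix.cons_val]
        linarith
      simp only [Fin.reduceFinMk] at *
      rw [if_neg this.not_gt, if_pos this, S.virtNear_eq hp ha (-1) (by simp [dirX])
        (by simp [dirY]) (by norm_num), S.ptD'_eq hp ha]

end

end TuringMobile

end

/-! ### Reference follows -/

noncomputable section

namespace TuringMobile

variable {p : Params} {C N R e₁ e₂ : Plane} {upd : ℝ → ℝ} {dir : ℝ → Fin 3}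
  {i : Fin 3} {y τ : ℝ}

/-- While Reference follows, Commander is on the wrong side of the directions of movement. -/
lemma wrong_side {d X Y : ℝ} (hd : 0 < d) (i j : Fin 3)
    (hX : |X - d * (2 * dirX i + dirY i)| ≤ d / 100) (hY : |Y - d * (2 * dirY i)| ≤ d / 100) :
    dirX j * X + dirY j * Y < 0 ∨ dirX j * Y - dirY j * X < 0 := by
  have s1 := lt_sqrt_three
  have s2 := sqrt_three_lt
  have hs := sq_sqrt_three
  rw [abs_le] at hX hY
  obtain ⟨x1, x2⟩ := hX
  obtain ⟨y1, y2⟩ := hY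
  have d1 := mul_lt_mul_of_pos_left s1 hd
  have d2 := mul_lt_mul_of_pos_left s2 hd
  have s1' := sub_pos.2 s1
  have s2' := sub_pos.2 s2
  -- `(X, Y)` is close to `d` times `(1, 2)`, `(-√3 - 1/2, -1)` or `(√3 - 1/2, -1)`. Compared with
  -- the direction `i` itself, each of these is tilted away from the altitude of its triangle, so
  -- the coordinate across is negative for `j = i`. For `j ≠ i` a coordinate is negative by a wide
  -- margin.
  fin_cases i
  · simp only [dirX, dirY, Fin.zero_eta, Matrix.cons_val_zero] at x1 x2 y1 y2
    have hX : 0 < X := by linarith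
    have hY : 0 < Y := by linarith
    have m1 := mul_pos s2' hX
    have m2 := mul_pos s1' hY
    fin_cases j <;> simp only [dirX, dirY, Fin.zero_eta, Fin.mk_one, Fin.reduceFinMk,
      Matrix.cons_val]
    · right; linarith
    · left; nlinarith
    · left; linarith
  · simp only [dirX, dirY, Fin.mk_one, Matrix.cons_val] at x1 x2 y1 y2
    have hX : X < 0 := by linarith
    have hY : Y < 0 := by linarith
    have m1 := mul_neg_of_pos_of_neg s1' hX
    have m2 := mul_neg_of_pos_of_neg s2' hY
    fin_cases j <;> simp only [dirX, dirY, Fin.zero_eta, Fin.mk_one, Fin.reduceFinMk,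
      Matrix.cons_val]
    · left; linarith
    · right; linarith
    · left; linarith
  · simp only [dirX, dirY, Fin.reduceFinMk, Matrix.cons_val] at x1 x2 y1 y2
    have hX : 0 < X := by linarith
    have hY : Y < 0 := by linarith
    have m1 := mul_pos s1' hX
    have m2 := mul_neg_of_pos_of_neg s1' hY
    fin_cases j <;> simp only [dirX, dirY, Fin.zero_eta, Fin.mk_one, Fin.reduceFinMk,
      Matrix.cons_val]
    · left; linarith
    · left; linarith
    · right; linarith

section

variable (S : Shifted p e₁ e₂ C N R i y τ τ) (hp : p.Good) (hτ : 0 < τ)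
include S hp hτ

/-- Number is off the old axis by `τ * dirY i` at a distance of about `2 d`, so the observed frame
is turned by about `τ * dirY i / (2 d)` and its Virtual Commander is carried along `e₁` by about `-τ
* dirY i / 2`. In the observed frame Commander has the coordinates `τ / ρ` times `(X, Y)`, which are
those of `wrong_side` up to errors of the size of `lam` and `mu`. The deviation `ρ - α - τ * dirX i`
is of second order, at most `τ ^ 2 / d`. -/
lemma Shifted.not_region (j : Fin 3) : ¬ p.Region (tt p C N R j) (hh p C N R j) := by
  have h1 := hp.lam_pos; have h2 := hp.lam_le; have h3 := hp.mu_le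
  have hm := hp.mu_pos; have hd := hp.d_pos
  have hx := abs_le.1 (abs_dirX_le i)
  have hy := abs_le.1 (abs_dirY_le i)
  have hτm := S.a_le
  have y1 := S.y_pos
  have y2 := S.y_lt
  have hxy := dirX_sq_add i
  have F := S.frame
  set α := 2 * p.d - p.lam / 2 + y with hα
  set ρ := √((α + τ * dirX i) ^ 2 + (τ * dirY i) ^ 2) with hρ
  have tx : |τ * dirX i| ≤ τ := by
    rw [abs_mul, abs_of_pos hτ]; exact mul_le_of_le_one_right hτ.le (abs_dirX_le i)
  have ty : |τ * dirY i| ≤ τ := by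
    rw [abs_mul, abs_of_pos hτ]; exact mul_le_of_le_one_right hτ.le (abs_dirY_le i)
  rw [abs_le] at tx ty
  have hn1 : p.d < α + τ * dirX i := by linarith
  have hdet : 0 < (α + τ * dirX i) * (p.d + τ * dirY i) - (τ * dirY i) * (τ * dirX i) := by
    have a1 : p.d * (p.d - p.mu) ≤ (α + τ * dirX i) * (p.d + τ * dirY i) := by
      apply mul_le_mul <;> linarith
    have a2 : (τ * dirY i) * (τ * dirX i) ≤ p.mu * p.mu := by
      nlinarith [sq_nonneg (τ * dirY i - τ * dirX i)]
    nlinarith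
  obtain ⟨f1, f2⟩ := F.axes_eq S.eq_C' S.eq_N' hdet
  rw [← hα, ← hρ] at f1 f2
  have ρ0 : α + τ * dirX i ≤ ρ := Real.le_sqrt_of_sq_le (by nlinarith [sq_nonneg (τ * dirY i)])
  have ρpos : 0 < ρ := by linarith
  have ρsq : ρ ^ 2 = (α + τ * dirX i) ^ 2 + (τ * dirY i) ^ 2 := Real.sq_sqrt (by positivity)
  have η0 : 0 ≤ ρ - α - τ * dirX i := by linarith
  have η1 : p.d * (ρ - α - τ * dirX i) ≤ τ ^ 2 := by
    have : (ρ - α - τ * dirX i) * (ρ + (α + τ * dirX i)) = (τ * dirY i) ^ 2 := by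
      linear_combination ρsq
    have a1 : (τ * dirY i) ^ 2 ≤ τ ^ 2 := by nlinarith
    have a2 := mul_le_mul_of_nonneg_left (show p.d ≤ ρ + (α + τ * dirX i) by linarith) η0
    linarith
  set X := α * dirX i + p.d * dirY i + τ with hX
  set Y := α * dirY i - p.d * (ρ - α - τ * dirX i) / τ with hY
  have hCv : C - virt p C N R = (τ * dirX i + p.d * (τ * dirY i) / ρ) • e₁ +
      (p.d + τ * dirY i - p.d * (α + τ * dirX i) / ρ) • e₂ := by
    rw [virt, ← sub_sub, S.eq_C', f2]; module
  have htt : ∀ a b : ℝ, (inner ℝ (C - virt p C N R) (a • axis₁ N R + b • axis₂ C N R) : ℝ) =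
      τ / ρ * (a * X + b * Y) := by
    intro a b
    rw [hCv, f1, f2, show a • (((α + τ * dirX i) / ρ) • e₁ + (τ * dirY i / ρ) • e₂) +
      b • ((-(τ * dirY i) / ρ) • e₁ + ((α + τ * dirX i) / ρ) • e₂) =
      (a * ((α + τ * dirX i) / ρ) + b * (-(τ * dirY i) / ρ)) • e₁ +
      (a * (τ * dirY i / ρ) + b * ((α + τ * dirX i) / ρ)) • e₂ by module, F.inner_comb, hX, hY]
    simp only [div_eq_mul_inv]
    have hr := mul_inv_cancel₀ ρpos.ne'
    have hη : τ * (p.d * (ρ - α - τ * dirX i) * τ⁻¹) = p.d * (ρ - α - τ * dirX i) := by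
      field_simp
    linear_combination a * ρ⁻¹ * τ ^ 2 * hxy + b * ρ⁻¹ * hη + b * p.d * ρ⁻¹ ^ 2 * ρsq -
      b * p.d * ρ⁻¹ * ρ * hr
  have hw := wrong_side hd i j (X := X) (Y := Y) (by
    rw [hX, abs_le]
    have b1 : |(α - 2 * p.d) * dirX i| ≤ p.lam / 2 := by
      rw [abs_mul]
      exact (mul_le_of_le_one_right (abs_nonneg _) (abs_dirX_le i)).trans
        (abs_le.2 ⟨by linarith, by linarith⟩)
    rw [abs_le] at b1
    constructor <;> linarith [b1.1, b1.2]) (by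
    have b1 : |(α - 2 * p.d) * dirY i| ≤ p.lam / 2 := by
      rw [abs_mul]
      exact (mul_le_of_le_one_right (abs_nonneg _) (abs_dirY_le i)).trans
        (abs_le.2 ⟨by linarith, by linarith⟩)
    have b2 : p.d * (ρ - α - τ * dirX i) / τ ≤ τ := by
      rw [div_le_iff₀ hτ]; linarith
    have b3 : 0 ≤ p.d * (ρ - α - τ * dirX i) / τ := by positivity
    rw [abs_le] at b1 ⊢
    rw [hY]
    constructor <;> linarith [b1.1, b1.2])
  intro hR
  have hc := hR.cone hp
  have e1 : tt p C N R j = τ / ρ * (dirX j * X + dirY j * Y) := by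
    rw [tt, uu, dirVec_eq, htt]
  have e2 : hh p C N R j = τ / ρ * (dirX j * Y - dirY j * X) := by
    rw [hh, ww, altVec_eq, htt]; ring
  have hpos : 0 < τ / ρ := by positivity
  rcases hw with hw | hw
  · have := mul_neg_of_pos_of_neg hpos hw
    linarith [hc.1]
  · have := mul_neg_of_pos_of_neg hpos hw
    linarith [hc.2.1]

lemma Shifted.commanderDest_follow : commanderDest p upd dir C N R = C :=
  commanderDest_of_not_region hp (S.ne hp) fun j => S.not_region hp hτ j

/-- At `τ = mu`, before Reference has moved, the rule for final destinations applies but yields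
Number's own position. For smaller `τ` Commander is strictly between the two critical distances and
on no altitude. -/
lemma Shifted.numberDest_follow : numberDest p C N R = N := by
  rcases S.a_le.eq_or_lt with h | h
  · rw [S.numberDest_final hp h, h, sub_self, zero_smul, add_zero]
  · have hd := Params.Region.dist_bounds hp i (Or.inl ⟨rfl, hτ.le, h⟩ : p.Region τ 0)
    have hCR : dist C R = √((τ * dirX i - 0 * dirY i) ^ 2 +
        (p.d + (τ * dirY i + 0 * dirX i)) ^ 2) := by
      rw [dist_eq_norm, S.eq_C', S.frame.norm_comb]; congr 1; ring
    refine numberDest_of_not_altitude hp (S.ne hp) ?_ ?_ fun j hj =>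
      S.not_region hp hτ j (hj.region hp)
    · rw [hCR]
      refine ((Real.sqrt_lt' ?_).2 hd.2).ne
      linarith [hp.mu_pos, hp.d_pos]
    · rw [hCR]
      refine ((Real.lt_sqrt hp.dmin_pos.le).2 ?_).ne'
      rw [hp.dmin_sq]
      exact hd.1

/-- By Thales, a point of the circle with diameter `C N` sees Commander and Number at a right angle.
Together with distance `d` from Commander this characterizes the new rest position up to reflection
in the line `C N`, and Reference stays on the correct side of that line. -/
lemma Shifted.referenceDest_follow :
    referenceDest p upd dir C N R = R + τ • dirVec e₁ e₂ i := by
  have h1 := hp.lam_pos; have h2 := hp.lam_le; have h3 := hp.mu_le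
  have hm := hp.mu_pos; have hd := hp.d_pos
  have hx := abs_le.1 (abs_dirX_le i)
  have hy := abs_le.1 (abs_dirY_le i)
  have hτm := S.a_le
  have y1 := S.y_pos
  have F := S.frame
  have eN := S.eq_N'
  set α := 2 * p.d - p.lam / 2 + y with hα
  have hαpos : 0 < α := by linarith
  have hNC : N - C = α • e₁ + (-p.d) • e₂ := by
    rw [← sub_sub_sub_cancel_right N C R, eN, S.eq_C']; module
  have hRC : R - C = (-(τ * dirX i)) • e₁ + (-(p.d + τ * dirY i)) • e₂ := by
    rw [← neg_sub, S.eq_C']; module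
  have hCN : dist C N = √(α ^ 2 + p.d ^ 2) := by
    rw [dist_comm, dist_eq_norm, hNC, F.norm_comb, neg_sq]
  have hCN2 : dist C N ^ 2 = α ^ 2 + p.d ^ 2 := by rw [hCN, Real.sq_sqrt (by positivity)]
  have hdle : p.d ≤ dist C N := by
    rw [hCN]; exact Real.le_sqrt_of_sq_le (by nlinarith)
  have hdet : α * -(p.d + τ * dirY i) - -p.d * -(τ * dirX i) < 0 := by
    have a1 : 0 ≤ τ * (1 + dirY i) := mul_nonneg hτ.le (by linarith)
    have a2 : 0 ≤ τ * (1 + dirX i) := mul_nonneg hτ.le (by linarith)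
    have a3 : α * (p.d - p.mu) ≤ α * (p.d + τ * dirY i) := by gcongr; linarith
    have a4 : p.d * -p.mu ≤ p.d * (τ * dirX i) := by gcongr; linarith
    have a5 : p.d * p.mu < α * (p.d - p.mu) := by
      apply mul_lt_mul'' <;> linarith
    linarith
  rw [referenceDest, if_pos ⟨S.commanderDest_follow hp hτ, S.numberDest_follow hp hτ, hdle⟩,
    circleMeet, hCN2, show α ^ 2 + p.d ^ 2 - p.d ^ 2 = α ^ 2 by ring, Real.sqrt_sq hαpos.le,
    mul_comm (side _ _), mul_smul, hNC, hRC, F.side_smul_rot_neg hdet]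
  have hD : α ^ 2 + p.d ^ 2 ≠ 0 := by positivity
  have k1 : p.d ^ 2 / (α ^ 2 + p.d ^ 2) * α + p.d * α / (α ^ 2 + p.d ^ 2) * (-p.d) = 0 := by
    field_simp; ring
  have k2 : p.d ^ 2 / (α ^ 2 + p.d ^ 2) * (-p.d) + p.d * α / (α ^ 2 + p.d ^ 2) * (-α) = -p.d := by
    field_simp; ring
  rw [show ∀ k l : ℝ, C + k • (α • e₁ + (-p.d) • e₂) + l • ((-p.d) • e₁ + (-α) • e₂) =
    C + ((k * α + l * (-p.d)) • e₁ + (k * (-p.d) + l * (-α)) • e₂) from fun k l => by module,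
    k1, k2, eq_add_of_sub_eq S.eq_C]
  module

end

end TuringMobile

end

/-! ### Recognition of the roles and passage to local coordinates -/

noncomputable section

namespace TuringMobile

variable {p : Params} {C N R e₁ e₂ : Plane} {upd : ℝ → ℝ} {dir : ℝ → Fin 3}

/-- Any other assignment permutes three distances that are strictly ordered, or repeats a point, and
so violates the required order. -/
lemma Roles.unique {s : Multiset Plane} {C N R C' N' R' : Plane} (h : Roles s C N R)
    (h' : Roles s C' N' R') : C' = C ∧ N' = N ∧ R' = R := by
  obtain ⟨hs, h1, h2⟩ := h
  obtain ⟨hs', h3, h4⟩ := h'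
  have mem : ∀ X ∈ s, X = C ∨ X = N ∨ X = R := fun X hX => by
    rw [hs] at hX; simpa using hX
  have mC := mem C' (by rw [hs']; simp)
  have mN := mem N' (by rw [hs']; simp)
  have mR := mem R' (by rw [hs']; simp)
  have a1 := dist_comm C R
  have a2 := dist_comm R N
  have a3 := dist_comm C N
  have b1 := dist_self C
  have b2 := dist_self N
  have b3 := dist_self R
  have c1 := dist_nonneg (x := C) (y := R)
  have c2 := dist_nonneg (x := R) (y := N)
  have c3 := dist_nonneg (x := C) (y := N)
  rcases mC with rfl | rfl | rfl <;> rcases mN with rfl | rfl | rfl <;>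
    rcases mR with rfl | rfl | rfl <;>
    first
      | exact ⟨rfl, rfl, rfl⟩
      | exact absurd h4 (by linarith)

open scoped Classical in
lemma algorithm_eq {s : Multiset Plane} (h : Roles s C N R) : algorithm p upd dir s =
    if C = 0 then commanderDest p upd dir C N R
    else if N = 0 then numberDest p C N R
    else if R = 0 then referenceDest p upd dir C N R
    else 0 := by
  have hex : ∃ q : Plane × Plane × Plane, Roles s q.1 q.2.1 q.2.2 := ⟨(C, N, R), h⟩
  obtain ⟨h1, h2, h3⟩ := h.unique hex.choose_spec
  rw [algorithm, dif_pos hex]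
  simp only [h1, h2, h3]

/-- Conditions under which the roles of three robots are recognized. -/
structure Recognized (vis : ℝ) (C N R : Plane) : Prop where
  lt₁ : dist C R < dist R N
  lt₂ : dist R N < dist C N
  le : dist C N ≤ vis

lemma Recognized.roles_snapshot {vis : ℝ} {x : Fin 3 → Plane}
    (h : Recognized vis (x 0) (x 1) (x 2)) (fr : Plane ≃ₗᵢ[ℝ] Plane) (i : Fin 3) :
    Roles (Robots.snapshot vis fr x i) (fr (x 0 - x i)) (fr (x 1 - x i)) (fr (x 2 - x i)) := by
  obtain ⟨h1, h2, h3⟩ := h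
  have hd : ∀ a b, dist (fr (x a - x i)) (fr (x b - x i)) = dist (x a) (x b) := fun a b => by
    rw [fr.dist_map, dist_sub_right]
  refine ⟨?_, by rw [hd, hd]; exact h1, by rw [hd, hd]; exact h2⟩
  have c1 := dist_comm (x 0) (x 1)
  have c2 := dist_comm (x 0) (x 2)
  have c3 := dist_comm (x 1) (x 2)
  have s0 : ∀ a, dist (x a) (x a) = 0 := fun a => dist_self _
  have hall : ∀ j, dist (x i) (x j) ≤ vis := by
    intro j
    have c4 := dist_nonneg (x := x 0) (y := x 2)
    fin_cases i <;> fin_cases j <;>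
      simp only [Fin.zero_eta, Fin.mk_one, Fin.reduceFinMk] <;>
      linarith [s0 0, s0 1, s0 2]
  rw [Robots.snapshot, Finset.filter_true_of_mem fun j _ => hall j]
  rfl

lemma Frame.map (F : Frame e₁ e₂) (fr : Plane ≃ₗᵢ[ℝ] Plane) : Frame (fr e₁) (fr e₂) := by
  obtain ⟨h1, h2, h3⟩ := F
  constructor <;> rwa [fr.inner_map_map]

lemma map_dirVec (fr : Plane ≃ₗᵢ[ℝ] Plane) (i : Fin 3) :
    dirVec (fr e₁) (fr e₂) i = fr (dirVec e₁ e₂ i) := by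
  simp only [dirVec_eq, map_add, map_smul]

lemma map_altVec (fr : Plane ≃ₗᵢ[ℝ] Plane) (i : Fin 3) :
    altVec (fr e₁) (fr e₂) i = fr (altVec e₁ e₂ i) := by
  simp only [altVec_eq, map_add, map_smul]

/-- The description holds in any frame and of either orientation, so a robot that uses its own
coordinates sees a machine of the same shape. This and `Shifted.map` take the place of a general
equivariance of the algorithm. -/
lemma Straight.map {i : Fin 3} {t h y : ℝ} (S : Straight p e₁ e₂ C N R i t h y)
    (fr : Plane ≃ₗᵢ[ℝ] Plane) (X : Plane) :
    Straight p (fr e₁) (fr e₂) (fr (C - X)) (fr (N - X)) (fr (R - X)) i t h y := by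
  obtain ⟨h1, h2, h3, h4, h5, h6, h7, h8⟩ := S
  refine ⟨h1.map fr, ?_, ?_, h4, h5, h6, h7, h8⟩
  · rw [map_dirVec, map_altVec, ← map_sub, sub_sub_sub_cancel_right, h2]
    simp only [map_add, map_smul]
  · rw [← map_sub, sub_sub_sub_cancel_right, h3, map_smul]

lemma Shifted.map {i : Fin 3} {y a b : ℝ} (S : Shifted p e₁ e₂ C N R i y a b)
    (fr : Plane ≃ₗᵢ[ℝ] Plane) (X : Plane) :
    Shifted p (fr e₁) (fr e₂) (fr (C - X)) (fr (N - X)) (fr (R - X)) i y a b := by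
  obtain ⟨h1, h2, h3, h4, h5, h6, h7, h8, h9⟩ := S
  refine ⟨h1.map fr, ?_, ?_, h4, h5, h6, h7, h8, h9⟩
  · rw [map_dirVec, ← map_sub, sub_sub_sub_cancel_right, h2]
    simp only [map_add, map_smul]
  · rw [map_dirVec, ← map_sub, sub_sub_sub_cancel_right, h3]
    simp only [map_add, map_smul]

section Targets

variable {vis : ℝ} {x : Fin 3 → Plane} (h : Recognized vis (x 0) (x 1) (x 2))
  (fr : Plane ≃ₗᵢ[ℝ] Plane)
include h

lemma Recognized.ne : x 0 ≠ x 1 ∧ x 0 ≠ x 2 ∧ x 1 ≠ x 2 := by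
  obtain ⟨h1, h2, -⟩ := h
  refine ⟨fun e => ?_, fun e => ?_, fun e => ?_⟩
  · rw [e, dist_self] at h2
    exact absurd h2 (not_lt.2 dist_nonneg)
  · rw [e] at h2
    exact lt_irrefl _ h2
  · rw [e, dist_self] at h1
    exact absurd h1 (not_lt.2 dist_nonneg)

lemma Recognized.target_commander {v : Plane}
    (hv : commanderDest p upd dir (fr (x 0 - x 0)) (fr (x 1 - x 0)) (fr (x 2 - x 0)) =
      fr (x 0 - x 0) + fr v) :
    Robots.target (algorithm p upd dir) vis fr x 0 = x 0 + v := by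
  rw [Robots.target, algorithm_eq (h.roles_snapshot fr 0), if_pos (by simp), hv]
  simp

lemma Recognized.target_number {v : Plane}
    (hv : numberDest p (fr (x 0 - x 1)) (fr (x 1 - x 1)) (fr (x 2 - x 1)) =
      fr (x 1 - x 1) + fr v) :
    Robots.target (algorithm p upd dir) vis fr x 1 = x 1 + v := by
  rw [Robots.target, algorithm_eq (h.roles_snapshot fr 1),
    if_neg (by simpa [sub_eq_zero] using h.ne.1), if_pos (by simp), hv]
  simp

lemma Recognized.target_reference {v : Plane}
    (hv : referenceDest p upd dir (fr (x 0 - x 2)) (fr (x 1 - x 2)) (fr (x 2 - x 2)) =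
      fr (x 2 - x 2) + fr v) :
    Robots.target (algorithm p upd dir) vis fr x 2 = x 2 + v := by
  rw [Robots.target, algorithm_eq (h.roles_snapshot fr 2),
    if_neg (by simpa [sub_eq_zero] using h.ne.2.1),
    if_neg (by simpa [sub_eq_zero] using h.ne.2.2), if_pos (by simp), hv]
  simp

end Targets

/-- The displacements are at most `2 mu ≤ d / 500` in each coordinate, so the three distances remain
near `d`, `2 d` and `√5 d < 3 d`. -/
lemma Frame.recognized (F : Frame e₁ e₂) (hp : p.Good) {c₁ c₂ n₁ n₂ vis : ℝ}
    (hC : C - R = c₁ • e₁ + c₂ • e₂) (hN : N - R = n₁ • e₁ + n₂ • e₂)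
    (h1 : |c₁| ≤ 2 * p.mu) (h2 : |c₂ - p.d| ≤ 2 * p.mu) (h3 : |n₁ - 2 * p.d| ≤ 2 * p.mu)
    (h4 : |n₂| ≤ 2 * p.mu) (hvis : 3 * p.d ≤ vis) : Recognized vis C N R := by
  have hm := hp.mu_pos; have hd := hp.d_pos; have h5 := hp.mu_le
  have eCR : dist C R = √(c₁ ^ 2 + c₂ ^ 2) := by rw [dist_eq_norm, hC, F.norm_comb]
  have eRN : dist R N = √(n₁ ^ 2 + n₂ ^ 2) := by
    rw [dist_comm, dist_eq_norm, hN, F.norm_comb]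
  have eCN : dist C N = √((c₁ - n₁) ^ 2 + (c₂ - n₂) ^ 2) := by
    rw [dist_eq_norm, ← sub_sub_sub_cancel_right C N R, hC, hN,
      show c₁ • e₁ + c₂ • e₂ - (n₁ • e₁ + n₂ • e₂) = (c₁ - n₁) • e₁ + (c₂ - n₂) • e₂ by module,
      F.norm_comb]
  rw [abs_le] at h1 h2 h3 h4
  have q1 : c₁ ^ 2 ≤ (p.d / 500) ^ 2 := by apply sq_le_sq' <;> linarith
  have q2 : c₂ ^ 2 ≤ (1.002 * p.d) ^ 2 := by apply sq_le_sq' <;> linarith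
  have q3 : n₁ ^ 2 ≤ (2.002 * p.d) ^ 2 := by apply sq_le_sq' <;> linarith
  have q4 : n₂ ^ 2 ≤ (p.d / 500) ^ 2 := by apply sq_le_sq' <;> linarith
  have q5 : (1.998 * p.d) ^ 2 ≤ n₁ ^ 2 := by apply sq_le_sq' <;> linarith
  have q6 : (c₁ - n₁) ^ 2 ≤ (2.004 * p.d) ^ 2 := by apply sq_le_sq' <;> linarith
  have q7 : (c₂ - n₂) ^ 2 ≤ (1.004 * p.d) ^ 2 := by apply sq_le_sq' <;> linarith
  have q8 : (1.996 * p.d) ^ 2 ≤ (n₁ - c₁) ^ 2 := by apply sq_le_sq' <;> linarith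
  have q9 : (0.996 * p.d) ^ 2 ≤ (c₂ - n₂) ^ 2 := by apply sq_le_sq' <;> linarith
  have hdd : 0 < p.d ^ 2 := by positivity
  constructor
  · rw [eCR, eRN]
    apply Real.sqrt_lt_sqrt (by positivity)
    nlinarith [sq_nonneg n₂]
  · rw [eRN, eCN]
    apply Real.sqrt_lt_sqrt (by positivity)
    nlinarith
  · rw [eCN]
    refine (Real.sqrt_le_sqrt ?_).trans (Real.sqrt_sq (x := 3 * p.d) (by linarith)).le |>.trans hvis
    nlinarith

lemma Straight.recognized {i : Fin 3} {t h y vis : ℝ} (S : Straight p e₁ e₂ C N R i t h y)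
    (hp : p.Good) (hy : y < p.lam) (hvis : 3 * p.d ≤ vis) : Recognized vis C N R := by
  have hl := hp.lam_pos; have hl' := hp.lam_le; have hm := hp.mu_pos
  obtain ⟨F, hC, hN, t0, t1, h0, h1, y0⟩ := S
  have tx : |t * dirX i| ≤ t := by
    rw [abs_mul, abs_of_nonneg t0]; exact mul_le_of_le_one_right t0 (abs_dirX_le i)
  have ty : |t * dirY i| ≤ t := by
    rw [abs_mul, abs_of_nonneg t0]; exact mul_le_of_le_one_right t0 (abs_dirY_le i)
  have hx : |h * dirX i| ≤ h := by
    rw [abs_mul, abs_of_nonneg h0]; exact mul_le_of_le_one_right h0 (abs_dirX_le i)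
  have hy : |h * dirY i| ≤ h := by
    rw [abs_mul, abs_of_nonneg h0]; exact mul_le_of_le_one_right h0 (abs_dirY_le i)
  rw [abs_le] at tx ty hx hy
  refine F.recognized hp (c₁ := t * dirX i - h * dirY i) (c₂ := p.d + (t * dirY i + h * dirX i))
    (n₁ := 2 * p.d - p.lam / 2 + y) (n₂ := 0) ?_ ?_ ?_ ?_ ?_ ?_ hvis
  · rw [hC, dirVec_eq, altVec_eq]; module
  · rw [hN, zero_smul, add_zero]
  all_goals rw [abs_le]; constructor <;> linarith

lemma Shifted.recognized {i : Fin 3} {y a b vis : ℝ} (S : Shifted p e₁ e₂ C N R i y a b)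
    (hp : p.Good) (hvis : 3 * p.d ≤ vis) : Recognized vis C N R := by
  have hl := hp.lam_pos; have hl' := hp.lam_le; have hm := hp.mu_pos
  refine S.frame.recognized hp S.eq_C' S.eq_N' ?_ ?_ ?_ ?_ hvis
  all_goals
    obtain ⟨F, hC, hN, y0, y1, a0, a1, b0, b1⟩ := S
    have ax : |a * dirX i| ≤ a := by
      rw [abs_mul, abs_of_nonneg a0]; exact mul_le_of_le_one_right a0 (abs_dirX_le i)
    have ay : |a * dirY i| ≤ a := by
      rw [abs_mul, abs_of_nonneg a0]; exact mul_le_of_le_one_right a0 (abs_dirY_le i)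
    have bx : |b * dirX i| ≤ b := by
      rw [abs_mul, abs_of_nonneg b0]; exact mul_le_of_le_one_right b0 (abs_dirX_le i)
    have bY : |b * dirY i| ≤ b := by
      rw [abs_mul, abs_of_nonneg b0]; exact mul_le_of_le_one_right b0 (abs_dirY_le i)
    rw [abs_le] at ax ay bx bY ⊢
    constructor <;> linarith

end TuringMobile

end

/-! ### The single stages of a move -/

noncomputable section

namespace TuringMobile

variable {p : Params} {e₁ e₂ : Plane} {upd : ℝ → ℝ} {dir : ℝ → Fin 3}
  {vis δ : ℝ} {fr : Fin 3 → Plane ≃ₗᵢ[ℝ] Plane} {x : Fin 3 → ℝ → Plane} {look : Fin 3 → ℕ → ℝ}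

/-- At time `t` the robots stand still at `C`, `N` and `R`. -/
structure At (x : Fin 3 → ℝ → Plane) (look : Fin 3 → ℕ → ℝ) (t : ℝ) (C N R : Plane) : Prop where
  settled : Robots.Settled x look t
  eq_C : x 0 t = C
  eq_N : x 1 t = N
  eq_R : x 2 t = R

variable {C N R : Plane} {t₀ : ℝ}

lemma lineMap_add (A W : Plane) (s : ℝ) : AffineMap.lineMap A (A + W) s = A + s • W := by
  rw [AffineMap.lineMap_apply_module']; module

/-- Robot `a` took a snapshot near `P` between the times `t₀` and `t₁`. -/
def LookNear (x : Fin 3 → ℝ → Plane) (look : Fin 3 → ℕ → ℝ) (a : Fin 3) (t₀ t₁ : ℝ) (P : Plane)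
    (r : ℝ) : Prop :=
  ∃ k, look a k ∈ Set.Ico t₀ t₁ ∧ dist (x a (look a k)) P ≤ r

lemma LookNear.mono {a : Fin 3} {t₀ t₁ t₀' t₁' r r' : ℝ} {P P' : Plane}
    (h : LookNear x look a t₀ t₁ P r) (h0 : t₀' ≤ t₀) (h1 : t₁ ≤ t₁') (hr : r + dist P P' ≤ r') :
    LookNear x look a t₀' t₁' P' r' := by
  obtain ⟨k, hk, hd⟩ := h
  exact ⟨k, ⟨h0.trans hk.1, hk.2.trans_le h1⟩,
    (dist_triangle _ P _).trans (by linarith)⟩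

section Stages

variable {alg : Multiset Plane → Plane} (ex : Robots.IsExecution alg vis δ fr x look) (hδ : 0 < δ)
  (hAt : At x look t₀ C N R) {W : Plane} (hW : W ≠ 0)
include ex hδ hAt hW

/-- `IsExecution.stage` for one role, with destinations expressed as displacements: after the
fraction `s` of `W`, the part `(1 - s) • W` remains. The recorded snapshot near the start will later
show that the robot sees its surroundings during the move. -/
lemma stage_commander
    (h : ∀ s ∈ Set.Ico (0 : ℝ) 1, ∀ z : Fin 3 → Plane, z 0 = C + s • W → z 1 = N → z 2 = R →
      Robots.target alg vis (fr 0) z 0 = z 0 + (1 - s) • W ∧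
      Robots.target alg vis (fr 1) z 1 = z 1 ∧ Robots.target alg vis (fr 2) z 2 = z 2) :
    ∃ t₁, t₀ < t₁ ∧ At x look t₁ (C + W) N R ∧ LookNear x look 0 t₀ t₁ C ‖W‖ := by
  obtain ⟨t₁, h1, h2, h3, k, hk, s, hs, hx⟩ := ex.stage hδ 0 hAt.settled ![C, N, R]
    (fun j => by fin_cases j; exacts [hAt.eq_C, hAt.eq_N, hAt.eq_R]) (C + W) (by simpa using hW)
    (fun s hs j => by
      obtain ⟨g0, g1, g2⟩ := h s hs (Function.update ![C, N, R] 0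
        (AffineMap.lineMap (![C, N, R] 0) (C + W) s))
        (by rw [Function.update_self]; exact lineMap_add C W s) (by simp) (by simp)
      fin_cases j
      · refine g0.trans ?_
        simp only [Fin.zero_eta, Function.update_self]
        rw [show ![C, N, R] 0 = C from rfl, lineMap_add]
        module
      · exact g1.trans (by simp)
      · exact g2.trans (by simp))
  refine ⟨t₁, h1, ⟨h2, h3 0, h3 1, h3 2⟩, k, hk, ?_⟩
  rw [hx, show ![C, N, R] 0 = C from rfl, lineMap_add, dist_eq_norm, add_sub_cancel_left, norm_smul,
    Real.norm_eq_abs, abs_of_nonneg hs.1]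
  exact mul_le_of_le_one_left (norm_nonneg _) hs.2.le

lemma stage_number
    (h : ∀ s ∈ Set.Ico (0 : ℝ) 1, ∀ z : Fin 3 → Plane, z 0 = C → z 1 = N + s • W → z 2 = R →
      Robots.target alg vis (fr 0) z 0 = z 0 ∧
      Robots.target alg vis (fr 1) z 1 = z 1 + (1 - s) • W ∧
      Robots.target alg vis (fr 2) z 2 = z 2) :
    ∃ t₁, t₀ < t₁ ∧ At x look t₁ C (N + W) R ∧ LookNear x look 1 t₀ t₁ N ‖W‖ := by
  obtain ⟨t₁, h1, h2, h3, k, hk, s, hs, hx⟩ := ex.stage hδ 1 hAt.settled ![C, N, R]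
    (fun j => by fin_cases j; exacts [hAt.eq_C, hAt.eq_N, hAt.eq_R]) (N + W) (by simpa using hW)
    (fun s hs j => by
      obtain ⟨g0, g1, g2⟩ := h s hs (Function.update ![C, N, R] 1
        (AffineMap.lineMap (![C, N, R] 1) (N + W) s)) (by simp)
        (by rw [Function.update_self]; exact lineMap_add N W s) (by simp)
      fin_cases j
      · exact g0.trans (by simp)
      · refine g1.trans ?_
        simp only [Fin.mk_one, Function.update_self]
        rw [show ![C, N, R] 1 = N from rfl, lineMap_add]
        module
      · exact g2.trans (by simp))
  refine ⟨t₁, h1, ⟨h2, h3 0, h3 1, h3 2⟩, k, hk, ?_⟩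
  rw [hx, show ![C, N, R] 1 = N from rfl, lineMap_add, dist_eq_norm, add_sub_cancel_left, norm_smul,
    Real.norm_eq_abs, abs_of_nonneg hs.1]
  exact mul_le_of_le_one_left (norm_nonneg _) hs.2.le

lemma stage_reference
    (h : ∀ s ∈ Set.Ico (0 : ℝ) 1, ∀ z : Fin 3 → Plane, z 0 = C → z 1 = N → z 2 = R + s • W →
      Robots.target alg vis (fr 0) z 0 = z 0 ∧ Robots.target alg vis (fr 1) z 1 = z 1 ∧
      Robots.target alg vis (fr 2) z 2 = z 2 + (1 - s) • W) :
    ∃ t₁, t₀ < t₁ ∧ At x look t₁ C N (R + W) ∧ LookNear x look 2 t₀ t₁ R ‖W‖ := by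
  obtain ⟨t₁, h1, h2, h3, k, hk, s, hs, hx⟩ := ex.stage hδ 2 hAt.settled ![C, N, R]
    (fun j => by fin_cases j; exacts [hAt.eq_C, hAt.eq_N, hAt.eq_R]) (R + W) (by simpa using hW)
    (fun s hs j => by
      obtain ⟨g0, g1, g2⟩ := h s hs (Function.update ![C, N, R] 2
        (AffineMap.lineMap (![C, N, R] 2) (R + W) s)) (by simp) (by simp)
        (by rw [Function.update_self]; exact lineMap_add R W s)
      fin_cases j
      · exact g0.trans (by simp)
      · exact g1.trans (by simp)
      · refine g2.trans ?_
        simp only [Fin.reduceFinMk, Function.update_self]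
        rw [show ![C, N, R] 2 = R from rfl, lineMap_add]
        module)
  refine ⟨t₁, h1, ⟨h2, h3 0, h3 1, h3 2⟩, k, hk, ?_⟩
  rw [hx, show ![C, N, R] 2 = R from rfl, lineMap_add, dist_eq_norm, add_sub_cancel_left, norm_smul,
    Real.norm_eq_abs, abs_of_nonneg hs.1]
  exact mul_le_of_le_one_left (norm_nonneg _) hs.2.le

end Stages

lemma Frame.dirVec_ne_zero (F : Frame e₁ e₂) (i : Fin 3) : dirVec e₁ e₂ i ≠ 0 := fun h => by
  have := (F.dir_alt i).inner₁₁
  rw [h, inner_zero_left] at this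
  exact zero_ne_one this

section Moves

variable (ex : Robots.IsExecution (algorithm p upd dir) vis δ fr x look) (hδ : 0 < δ)
  (hvis : 3 * p.d ≤ vis) (hp : p.Good) (hAt : At x look t₀ C N R) {i : Fin 3}
include ex hδ hvis hp hAt

/-- A move of Commander along or inside a midway triangle. -/
lemma move_commander {a b : ℝ}
    (hW : a • dirVec e₁ e₂ i + b • altVec e₁ e₂ i ≠ 0)
    (h : ∀ s ∈ Set.Ico (0 : ℝ) 1, ∃ t h y,
      Straight p e₁ e₂ (C + s • (a • dirVec e₁ e₂ i + b • altVec e₁ e₂ i)) N R i t h y ∧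
      y < p.lam ∧ ∀ f₁ f₂ C' N' R' : Plane, Straight p f₁ f₂ C' N' R' i t h y →
        commanderDest p upd dir C' N' R' =
          C' + (1 - s) • (a • dirVec f₁ f₂ i + b • altVec f₁ f₂ i) ∧
        numberDest p C' N' R' = N') :
    ∃ t₁, t₀ < t₁ ∧ At x look t₁ (C + (a • dirVec e₁ e₂ i + b • altVec e₁ e₂ i)) N R ∧
      LookNear x look 0 t₀ t₁ C ‖a • dirVec e₁ e₂ i + b • altVec e₁ e₂ i‖ := by
  refine stage_commander ex hδ hAt hW fun s hs z z0 z1 z2 => ?_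
  -- `H` speaks of all machines with the coordinates `t`, `h'`, `y`, because each robot evaluates
  -- the rules in its own coordinates.
  obtain ⟨t, h', y, S, hy, H⟩ := h s hs
  rw [← z0, ← z1, ← z2] at S
  have hrec := S.recognized hp hy hvis
  set W := a • dirVec e₁ e₂ i + b • altVec e₁ e₂ i with hWdef
  have hmap : ∀ g : Plane ≃ₗᵢ[ℝ] Plane, (1 - s) •
      (a • dirVec (g e₁) (g e₂) i + b • altVec (g e₁) (g e₂) i) = g ((1 - s) • W) := fun g => by
    rw [map_dirVec, map_altVec, hWdef]; simp only [map_add, map_smul]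
  have hne : (1 - s) • W ≠ 0 := smul_ne_zero (by linarith [hs.2]) hW
  refine ⟨?_, ?_, ?_⟩
  · refine hrec.target_commander (fr 0) ?_
    rw [(H _ _ _ _ _ (S.map (fr 0) (z 0))).1, hmap]
  · have := hrec.target_number (upd := upd) (dir := dir) (fr 1) (v := 0) (by
      rw [(H _ _ _ _ _ (S.map (fr 1) (z 1))).2, map_zero, add_zero])
    rwa [add_zero] at this
  -- Reference waits because it sees that Commander still has a nonzero displacement to make.
  · have := hrec.target_reference (upd := upd) (dir := dir) (fr 2) (v := 0) (by
      rw [referenceDest_of_commander, map_zero, add_zero]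
      rw [(H _ _ _ _ _ (S.map (fr 2) (z 2))).1, hmap, ne_eq, add_eq_left]
      exact fun h0 => hne ((map_eq_zero_iff _ (fr 2).injective).1 h0))
    rwa [add_zero] at this

/-- Number records the new value. -/
lemma move_number_record {y y' : ℝ} (hy : 0 < y) (hy1 : y < p.lam) (hy' : 0 < y')
    (hy'1 : y' < p.lam) (hne : y ≠ y') (S : Straight p e₁ e₂ C N R i (p.mu / 2) y' y) :
    ∃ t₁, t₀ < t₁ ∧ At x look t₁ C (N + (y' - y) • e₁) R ∧
      LookNear x look 1 t₀ t₁ N ‖(y' - y) • e₁‖ := by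
  have he : e₁ ≠ 0 := fun h => by
    have := S.frame.inner₁₁
    rw [h, inner_zero_left] at this
    exact zero_ne_one this
  have hm := hp.mu_pos
  refine stage_number ex hδ hAt (smul_ne_zero (sub_ne_zero.2 hne.symm) he) fun s hs z z0 z1 z2 => ?_
  obtain ⟨s0, s1⟩ := hs
  have S' : Straight p e₁ e₂ (z 0) (z 1) (z 2) i (p.mu / 2) y' (y + s * (y' - y)) := by
    obtain ⟨h1, h2, h3, h4, h5, h6, h7, h8⟩ := S
    refine ⟨h1, by rw [z0, z2, h2], ?_, h4, h5, h6, h7, by nlinarith⟩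
    rw [z1, z2, add_sub_right_comm, h3]
    module
  have hrec := S'.recognized hp (by nlinarith) hvis
  -- Number reaches the new value only at the end of its segment. Until then Commander finds its
  -- height different from Number's distance to `Q` and waits.
  have hne' : y + s * (y' - y) ≠ y' := fun h => by
    have : (1 - s) * (y' - y) = 0 := by linarith
    rcases mul_eq_zero.1 this with h | h
    · linarith
    · exact hne (by linarith)
  have hnum : ∀ g : Plane ≃ₗᵢ[ℝ] Plane, ∀ X, numberDest p (g (z 0 - X)) (g (z 1 - X))
      (g (z 2 - X)) = g (z 1 - X) + g ((1 - s) • (y' - y) • e₁) := fun g X => by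
    rw [(S'.map g X).numberDest_altitude hp rfl, smul_smul, map_smul]
    congr 2
    ring
  refine ⟨?_, ?_, ?_⟩
  · have := hrec.target_commander (upd := upd) (dir := dir) (fr 0) (v := 0) (by
      rw [(S'.map (fr 0) (z 0)).commanderDest_wait hp rfl hne', map_zero, add_zero])
    rwa [add_zero] at this
  · exact hrec.target_number (fr 1) (hnum _ _)
  · have := hrec.target_reference (upd := upd) (dir := dir) (fr 2) (v := 0) (by
      rw [referenceDest_of_number, map_zero, add_zero]
      rw [hnum, ne_eq, add_eq_left]
      intro h0
      have h0 := (map_eq_zero_iff _ (fr 2).injective).1 h0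
      exact smul_ne_zero (by linarith) (smul_ne_zero (sub_ne_zero.2 hne.symm) he) h0)
    rwa [add_zero] at this

/-- Number moves to its final destination. -/
lemma move_number_final {y : ℝ} (S : Shifted p e₁ e₂ C N R i y p.mu 0) :
    ∃ t₁, t₀ < t₁ ∧ At x look t₁ C (N + p.mu • dirVec e₁ e₂ i) R ∧
      LookNear x look 1 t₀ t₁ N ‖p.mu • dirVec e₁ e₂ i‖ := by
  have hm := hp.mu_pos
  have hu := S.frame.dirVec_ne_zero i
  refine stage_number ex hδ hAt (smul_ne_zero hm.ne' hu) fun s hs z z0 z1 z2 => ?_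
  obtain ⟨s0, s1⟩ := hs
  have S' : Shifted p e₁ e₂ (z 0) (z 1) (z 2) i y p.mu (s * p.mu) := by
    obtain ⟨h1, h2, h3, h4, h5, h6, h7, h8, h9⟩ := S
    refine ⟨h1, by rw [z0, z2, h2], ?_, h4, h5, h6, h7, by positivity, by nlinarith⟩
    rw [z1, z2, add_sub_right_comm, h3]
    module
  have hrec := S'.recognized hp hvis
  have hnum : ∀ g : Plane ≃ₗᵢ[ℝ] Plane, ∀ X, numberDest p (g (z 0 - X)) (g (z 1 - X))
      (g (z 2 - X)) = g (z 1 - X) + g ((1 - s) • p.mu • dirVec e₁ e₂ i) := fun g X => by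
    rw [(S'.map g X).numberDest_final hp rfl, smul_smul, map_smul, map_dirVec]
    congr 2
    ring
  refine ⟨?_, ?_, ?_⟩
  · have := hrec.target_commander (upd := upd) (dir := dir) (fr 0) (v := 0) (by
      rw [(S'.map (fr 0) (z 0)).commanderDest_final hp rfl, map_zero, add_zero])
    rwa [add_zero] at this
  · exact hrec.target_number (fr 1) (hnum _ _)
  · have := hrec.target_reference (upd := upd) (dir := dir) (fr 2) (v := 0) (by
      rw [referenceDest_of_number, map_zero, add_zero]
      rw [hnum, ne_eq, add_eq_left]
      intro h0
      have h0 := (map_eq_zero_iff _ (fr 2).injective).1 h0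
      exact smul_ne_zero (by linarith) (smul_ne_zero hm.ne' hu) h0)
    rwa [add_zero] at this

/-- Reference follows. -/
lemma move_reference {y : ℝ} (S : Shifted p e₁ e₂ C N R i y p.mu p.mu) :
    ∃ t₁, t₀ < t₁ ∧ At x look t₁ C N (R + p.mu • dirVec e₁ e₂ i) ∧
      LookNear x look 2 t₀ t₁ R ‖p.mu • dirVec e₁ e₂ i‖ := by
  have hm := hp.mu_pos
  have hu := S.frame.dirVec_ne_zero i
  refine stage_reference ex hδ hAt (smul_ne_zero hm.ne' hu) fun s hs z z0 z1 z2 => ?_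
  obtain ⟨s0, s1⟩ := hs
  have hτ : 0 < (1 - s) * p.mu := mul_pos (by linarith) hm
  -- Relative to the moving Reference, Commander and Number are displaced by the part of the move
  -- that Reference still has before it.
  have S' : Shifted p e₁ e₂ (z 0) (z 1) (z 2) i y ((1 - s) * p.mu) ((1 - s) * p.mu) := by
    obtain ⟨h1, h2, h3, h4, h5, h6, h7, h8, h9⟩ := S
    refine ⟨h1, ?_, ?_, h4, h5, hτ.le, by nlinarith, hτ.le, by nlinarith⟩
    · rw [z0, z2, ← sub_sub, h2]
      module
    · rw [z1, z2, ← sub_sub, h3]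
      module
  have hrec := S'.recognized hp hvis
  refine ⟨?_, ?_, ?_⟩
  · have := hrec.target_commander (upd := upd) (dir := dir) (fr 0) (v := 0) (by
      rw [(S'.map (fr 0) (z 0)).commanderDest_follow hp hτ, map_zero, add_zero])
    rwa [add_zero] at this
  · have := hrec.target_number (upd := upd) (dir := dir) (fr 1) (v := 0) (by
      rw [(S'.map (fr 1) (z 1)).numberDest_follow hp hτ, map_zero, add_zero])
    rwa [add_zero] at this
  · refine hrec.target_reference (fr 2) ?_
    rw [(S'.map (fr 2) (z 2)).referenceDest_follow hp hτ, smul_smul, map_smul, map_dirVec]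

end Moves

end TuringMobile

end

/-! ### The complete move and the exploration of the plane -/

noncomputable section

namespace TuringMobile

variable {p : Params} {e₁ e₂ C N R : Plane} {t₀ vis δ : ℝ}
  {fr : Fin 3 → Plane ≃ₗᵢ[ℝ] Plane} {x : Fin 3 → ℝ → Plane} {look : Fin 3 → ℕ → ℝ}

/-- The distance of Number from `Q` when the machine stores `r`. -/
def Params.offset (p : Params) (r : ℝ) : ℝ := p.lam / 2 + Real.arctan r * p.lam / Real.pi

lemma Params.code_eq (p : Params) (r : ℝ) : p.code r = 2 * p.d - p.lam / 2 + p.offset r := by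
  rw [Params.code, Params.offset]; ring

lemma Params.Good.offset_pos (hp : p.Good) (r : ℝ) : 0 < p.offset r := by
  have h1 := Real.neg_pi_div_two_lt_arctan r
  have h2 := hp.lam_pos
  have h3 := Real.pi_pos
  have : p.offset r = (Real.pi / 2 + Real.arctan r) * p.lam / Real.pi := by
    rw [Params.offset]; field_simp
  rw [this]
  have : 0 < Real.pi / 2 + Real.arctan r := by linarith
  positivity

lemma Params.Good.offset_lt (hp : p.Good) (r : ℝ) : p.offset r < p.lam := by
  have h1 := Real.arctan_lt_pi_div_two r
  have h2 := hp.lam_pos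
  have h3 := Real.pi_pos
  have : p.lam - p.offset r = (Real.pi / 2 - Real.arctan r) * p.lam / Real.pi := by
    rw [Params.offset]; field_simp; ring
  have h4 : 0 < Real.pi / 2 - Real.arctan r := by linarith
  have : 0 < p.lam - p.offset r := by rw [this]; positivity
  linarith

lemma Params.Good.decode_offset (hp : p.Good) (r : ℝ) : p.decode (p.offset r) = r := by
  have h2 := hp.lam_pos
  have h3 := Real.pi_pos
  rw [Params.decode, if_pos ⟨hp.offset_pos r, hp.offset_lt r⟩, Params.offset, add_sub_cancel_left,
    show Real.arctan r * p.lam / Real.pi * Real.pi / p.lam = Real.arctan r by field_simp,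
    Real.tan_arctan]

lemma Params.Good.shift_offset (hp : p.Good) (upd : ℝ → ℝ) (r : ℝ) :
    p.shift upd (p.offset r) = p.offset (upd r) := by
  rw [Params.shift, hp.decode_offset, Params.code_eq]; ring

lemma Params.Good.offset_injective (hp : p.Good) : Function.Injective p.offset := fun a b h => by
  rw [← hp.decode_offset a, h, hp.decode_offset]

lemma Frame.norm_dirVec (F : Frame e₁ e₂) (i : Fin 3) : ‖dirVec e₁ e₂ i‖ = 1 := by
  rw [norm_eq_sqrt_real_inner, (F.dir_alt i).inner₁₁, Real.sqrt_one]

lemma Frame.norm_left (F : Frame e₁ e₂) : ‖e₁‖ = 1 := by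
  rw [norm_eq_sqrt_real_inner, F.inner₁₁, Real.sqrt_one]

lemma Frame.norm_right (F : Frame e₁ e₂) : ‖e₂‖ = 1 := by
  rw [norm_eq_sqrt_real_inner, F.inner₂₂, Real.sqrt_one]

lemma Frame.comb_ne_zero (F : Frame e₁ e₂) {a b : ℝ} (ha : a ≠ 0) : a • e₁ + b • e₂ ≠ 0 := by
  intro h
  have := F.inner_comb_left a b
  rw [h, inner_zero_left] at this
  exact ha this.symm

/-- A complete move of the machine. -/
lemma complete_move {upd : ℝ → ℝ} {dir : ℝ → Fin 3}
    (ex : Robots.IsExecution (algorithm p upd dir) vis δ fr x look) (hδ : 0 < δ)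
    (hvis : 3 * p.d ≤ vis) (hp : p.Good) (F : Frame e₁ e₂) (r : ℝ) (hr : upd r ≠ r)
    (hAt : At x look t₀ (R + p.d • e₂) (R + p.code r • e₁) R) :
    ∃ t₁, t₀ < t₁ ∧
      At x look t₁ (R + p.mu • dirVec e₁ e₂ (dir r) + p.d • e₂)
        (R + p.mu • dirVec e₁ e₂ (dir r) + p.code (upd r) • e₁)
        (R + p.mu • dirVec e₁ e₂ (dir r)) ∧
      ∀ a, LookNear x look a t₀ t₁ R (4 * p.d) := by
  have hm := hp.mu_pos; have hd := hp.d_pos; have hl := hp.lam_pos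
  have hl' := hp.lam_le; have hm' := hp.mu_le
  set i := dir r with hi
  set y := p.offset r with hy
  set y' := p.offset (upd r) with hy'
  have y0 : 0 < y := hp.offset_pos r
  have y1 : y < p.lam := hp.offset_lt r
  have y0' : 0 < y' := hp.offset_pos _
  have y1' : y' < p.lam := hp.offset_lt _
  -- A stage needs a nonzero displacement; this is where `upd r ≠ r` is used.
  have hne : y ≠ y' := fun h => hr (hp.offset_injective h).symm
  have hshift : p.shift upd y = y' := hp.shift_offset upd r
  have hdec : p.decode y = r := hp.decode_offset r
  set u := dirVec e₁ e₂ i with hu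
  set w := altVec e₁ e₂ i with hw
  have Fi : Frame u w := F.dir_alt i
  have hN : ∀ z, R + p.code z • e₁ - R = (2 * p.d - p.lam / 2 + p.offset z) • e₁ := fun z => by
    rw [add_sub_cancel_left, p.code_eq]
  -- Commander moves to `A`
  obtain ⟨t₁, h01, hAt1, hl1⟩ := move_commander ex hδ hvis hp hAt (i := i) (e₁ := e₁) (e₂ := e₂)
    (a := (p.mu - p.lam) / 2) (b := 0) (Fi.comb_ne_zero (by linarith)) (fun s hs => by
      obtain ⟨s0, s1⟩ := hs
      have a0 : 0 ≤ s * ((p.mu - p.lam) / 2) := mul_nonneg s0 (by linarith)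
      have a1 : s * ((p.mu - p.lam) / 2) < (p.mu - p.lam) / 2 := by nlinarith
      refine ⟨s * ((p.mu - p.lam) / 2), 0, y, ⟨F, ?_, hN r, a0, by linarith, le_rfl, hl.le, y0⟩,
        y1, fun f₁ f₂ C' N' R' S => ⟨?_, ?_⟩⟩
      · module
      · rw [S.commanderDest_approach hp (fun _ => by rw [hdec]) a1 rfl]
        module
      · exact S.numberDest_eq hp (Or.inl ⟨rfl, a0, by linarith⟩) (by linarith))
  -- Commander moves to the altitude
  obtain ⟨t₂, h12, hAt2, -⟩ := move_commander ex hδ hvis hp hAt1 (i := i) (e₁ := e₁) (e₂ := e₂)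
    (a := p.lam / 2) (b := y') (Fi.comb_ne_zero (by linarith)) (fun s hs => by
      obtain ⟨s0, s1⟩ := hs
      have a0 : 0 ≤ s * (p.lam / 2) := by positivity
      have a1 : s * (p.lam / 2) < p.lam / 2 := by nlinarith
      have a2 : 0 ≤ s * y' := by positivity
      have a3 : s * y' ≤ p.lam := by nlinarith
      refine ⟨(p.mu - p.lam) / 2 + s * (p.lam / 2), s * y', y,
        ⟨F, ?_, hN r, by linarith, by linarith, a2, a3, y0⟩, y1, fun f₁ f₂ C' N' R' S => ⟨?_, ?_⟩⟩
      · module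
      · exact S.commanderDest_first hp s0 s1 rfl rfl hshift y0' y1'
      · exact S.numberDest_eq hp (Or.inr ⟨by linarith, by linarith, a2, a3⟩) (by linarith))
  -- Number records the new value
  obtain ⟨t₃, h23, hAt3, hl3⟩ := move_number_record ex hδ hvis hp hAt2 (i := i) (e₁ := e₁)
    (e₂ := e₂) y0 y1 y0' y1' hne
    ⟨F, by module, hN r, by linarith, by linarith, y0'.le, y1'.le, y0⟩
  rw [show R + p.code r • e₁ + (y' - y) • e₁ = R + p.code (upd r) • e₁ by
    rw [p.code_eq, p.code_eq]; module] at hAt3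
  -- Commander moves to `B`
  obtain ⟨t₄, h34, hAt4, -⟩ := move_commander ex hδ hvis hp hAt3 (i := i) (e₁ := e₁) (e₂ := e₂)
    (a := p.lam / 2) (b := -y') (Fi.comb_ne_zero (by linarith)) (fun s hs => by
      obtain ⟨s0, s1⟩ := hs
      have a0 : 0 ≤ s * (p.lam / 2) := by positivity
      have a1 : s * (p.lam / 2) < p.lam / 2 := by nlinarith
      have a2 : 0 ≤ (1 - s) * y' := mul_nonneg (by linarith) y0'.le
      have a3 : (1 - s) * y' ≤ p.lam := by nlinarith
      refine ⟨p.mu / 2 + s * (p.lam / 2), (1 - s) * y', y',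
        ⟨F, ?_, hN _, by linarith, by linarith, a2, a3, y0'⟩, y1', fun f₁ f₂ C' N' R' S => ⟨?_, ?_⟩⟩
      · module
      · exact S.commanderDest_second hp s0 s1 rfl rfl rfl y1'
      -- At `s = 0` Commander is still on the altitude and Number's recording rule applies, but
      -- Number is already at the recorded place.
      · rcases s0.eq_or_lt with rfl | s0
        · rw [S.numberDest_altitude hp (by ring)]
          module
        · have a4 : 0 < s * (p.lam / 2) := by positivity
          exact S.numberDest_eq hp (Or.inr ⟨by linarith, by linarith, a2, a3⟩) (by linarith))
  -- Commander moves to `D`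
  obtain ⟨t₅, h45, hAt5, -⟩ := move_commander ex hδ hvis hp hAt4 (i := i) (e₁ := e₁) (e₂ := e₂)
    (a := (p.mu - p.lam) / 2) (b := 0) (Fi.comb_ne_zero (by linarith)) (fun s hs => by
      obtain ⟨s0, s1⟩ := hs
      have a0 : 0 ≤ s * ((p.mu - p.lam) / 2) := mul_nonneg s0 (by linarith)
      have a1 : s * ((p.mu - p.lam) / 2) < (p.mu - p.lam) / 2 := by nlinarith
      refine ⟨(p.mu + p.lam) / 2 + s * ((p.mu - p.lam) / 2), 0, y',
        ⟨F, ?_, hN _, by linarith, by linarith, le_rfl, hl.le, y0'⟩,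
        y1', fun f₁ f₂ C' N' R' S => ⟨?_, ?_⟩⟩
      · module
      · rw [S.commanderDest_leave hp (by linarith) (by linarith) rfl]
        module
      · exact S.numberDest_eq hp (Or.inl ⟨rfl, by linarith, by linarith⟩) (by linarith))
  have eC : R + p.d • e₂ + (((p.mu - p.lam) / 2) • u + (0 : ℝ) • w) + ((p.lam / 2) • u + y' • w) +
      ((p.lam / 2) • u + (-y') • w) + (((p.mu - p.lam) / 2) • u + (0 : ℝ) • w) =
      R + p.mu • u + p.d • e₂ := by module
  rw [eC] at hAt5
  -- Number moves to its final destination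
  obtain ⟨t₆, h56, hAt6, -⟩ := move_number_final ex hδ hvis hp hAt5 (i := i) (e₁ := e₁) (e₂ := e₂)
    (y := y') ⟨F, by module, by rw [hN]; module, y0', y1', hm.le, le_rfl, le_rfl, hm.le⟩
  -- Reference follows
  obtain ⟨t₇, h67, hAt7, hl7⟩ := move_reference ex hδ hvis hp hAt6 (i := i) (e₁ := e₁) (e₂ := e₂)
    (y := y') ⟨F, by module, by rw [add_sub_right_comm, hN], y0', y1', hm.le, le_rfl, hm.le, le_rfl⟩
  refine ⟨t₇, by linarith, ?_, fun a => ?_⟩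
  · convert hAt7 using 1; exact add_right_comm _ _ _
  -- The first stage of Commander starts at distance `d` from `R`, the recording of Number at most
  -- `2 d + lam / 2` away, and the last stage at `R` itself; each stage is shorter than `d`.
  · fin_cases a
    · refine hl1.mono le_rfl (by linarith) ?_
      rw [dist_eq_norm, add_sub_cancel_left, zero_smul, add_zero, norm_smul, norm_smul,
        F.norm_dirVec, F.norm_right, Real.norm_eq_abs, Real.norm_eq_abs, abs_of_pos hd,
        abs_of_nonneg (by linarith)]
      linarith
    · refine hl3.mono (by linarith) (by linarith) ?_
      rw [dist_eq_norm, hN, norm_smul, norm_smul, F.norm_left, Real.norm_eq_abs,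
        Real.norm_eq_abs, abs_of_nonneg (show 0 ≤ 2 * p.d - p.lam / 2 + y by linarith)]
      have : |y' - y| ≤ p.lam := abs_le.2 ⟨by linarith, by linarith⟩
      linarith
    · refine hl7.mono (by linarith) le_rfl ?_
      rw [dist_self, norm_smul, F.norm_dirVec, Real.norm_eq_abs, abs_of_pos hm]
      linarith

lemma Frame.dirVec_sum (e₁ e₂ : Plane) :
    dirVec e₁ e₂ 0 + dirVec e₁ e₂ 1 + dirVec e₁ e₂ 2 = 0 := by
  simp only [dirVec_eq, dirX, dirY, Matrix.cons_val]
  module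

/-- Every point of the plane is close to the spiral. -/
lemma Frame.exists_spiralPos_near (F : Frame e₁ e₂) {m : ℝ} (hm : 0 < m) (O X : Plane) :
    ∃ n, dist (O + m • spiralPos (dirVec e₁ e₂) n) X ≤ 2 * m := by
  set a := inner ℝ (X - O) e₁ / m with ha
  set b := inner ℝ (X - O) e₂ / m with hb
  have hs := sq_sqrt_three
  have hs0 : 0 < √(3 : ℝ) := by positivity
  -- the coordinates with respect to the first two directions
  set v := -(2 * a / √3) with hv
  set u := b + v / 2 with hu
  -- Rounding both lattice coordinates down moves the point by less than one step in each of two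
  -- unit directions.
  obtain ⟨n, hn⟩ := exists_spiralPos_eq (dirVec e₁ e₂) (Frame.dirVec_sum e₁ e₂) ⌊u⌋ ⌊v⌋
  refine ⟨n, ?_⟩
  have hX : X = O + m • (u • dirVec e₁ e₂ 0 + v • dirVec e₁ e₂ 1) := by
    have h1 : X - O = (m * a) • e₁ + (m * b) • e₂ := by
      rw [ha, hb, mul_div_cancel₀ _ hm.ne', mul_div_cancel₀ _ hm.ne']
      exact F.expand _
    have h2 : v * -(√3 / 2) = a := by rw [hv]; field_simp
    have h3 : u • dirVec e₁ e₂ 0 + v • dirVec e₁ e₂ 1 = a • e₁ + b • e₂ := by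
      rw [dirVec_eq, dirVec_eq, ← h2, hu]
      simp only [dirX, dirY, Matrix.cons_val]
      module
    rw [h3, smul_add, smul_smul, smul_smul, ← h1, add_sub_cancel]
  have hdiff : O + m • spiralPos (dirVec e₁ e₂) n - X =
      m • ((-Int.fract u) • dirVec e₁ e₂ 0 + (-Int.fract v) • dirVec e₁ e₂ 1) := by
    conv_lhs => rw [hn, hX]
    rw [Int.fract, Int.fract]
    module
  rw [dist_eq_norm, hdiff, norm_smul, Real.norm_eq_abs, abs_of_pos hm, mul_comm 2 m]
  refine mul_le_mul_of_nonneg_left ((norm_add_le _ _).trans ?_) hm.le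
  rw [norm_smul, norm_smul, F.norm_dirVec, F.norm_dirVec, norm_neg, norm_neg, Real.norm_eq_abs,
    Real.norm_eq_abs, Int.abs_fract, Int.abs_fract]
  linarith [Int.fract_lt_one u, Int.fract_lt_one v]

/-- The machine at rest. -/
lemma AtRest.frame (hp : p.Good) (h : AtRest p C N R) (hs : dist R N = p.code 0) :
    C = R + p.d • axis₂ C N R ∧ N = R + p.code 0 • axis₁ N R ∧
      Frame (axis₁ N R) (axis₂ C N R) := by
  have hm := hp.mu_pos; have hd := hp.d_pos; have hl := hp.lam_pos
  have hl' := hp.lam_le; have hm' := hp.mu_le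
  have hc : p.code 0 = 2 * p.d := by simp [Params.code]
  have hnorm : ‖N - R‖ = p.code 0 := by rw [← dist_eq_norm, dist_comm, hs]
  have hNR : N ≠ R := by
    rintro rfl
    rw [sub_self, norm_zero, hc] at hnorm
    linarith
  have F := frame_axis (C := C) hNR
  have hN : N - R = p.code 0 • axis₁ N R := by
    rw [axis₁, unit, smul_smul, hnorm, mul_inv_cancel₀ (by linarith), one_smul]
  refine ⟨?_, (eq_add_of_sub_eq hN).trans (add_comm _ _), F⟩
  have hang := h.right_angle
  rw [EuclideanGeometry.angle, vsub_eq_sub, vsub_eq_sub,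
    ← InnerProductGeometry.inner_eq_zero_iff_angle_eq_pi_div_two, hN, real_inner_smul_left,
    mul_eq_zero] at hang
  have h1 : (inner ℝ (C - R) (axis₁ N R) : ℝ) = 0 := by
    rw [real_inner_comm]
    exact hang.resolve_left (by linarith)
  have hexp := F.expand (C - R)
  rw [h1, zero_smul, zero_add] at hexp
  set b : ℝ := inner ℝ (C - R) (axis₂ C N R) with hb
  -- `axis₂` is chosen on the side of Commander, so the remaining coordinate is nonnegative and
  -- equals the distance `d`.
  have hb0 : 0 ≤ b := by
    rw [hb, axis₂, real_inner_smul_right, inner_plane, rot_apply_zero, rot_apply_one, side]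
    split_ifs with h
    · linarith
    · linarith [not_le.1 h]
  have hbd : b = p.d := by
    have := h.dist_CR
    rw [dist_eq_norm, hexp, norm_smul, F.norm_right, Real.norm_eq_abs, abs_of_nonneg hb0,
      mul_one] at this
    exact this
  rw [hbd] at hexp
  exact (eq_add_of_sub_eq hexp).trans (add_comm _ _)

lemma Frame.atRest (F : Frame e₁ e₂) (hp : p.Good) (r : ℝ) (R : Plane) :
    AtRest p (R + p.d • e₂) (R + p.code r • e₁) R := by
  have hm := hp.mu_pos; have hd := hp.d_pos; have hl := hp.lam_pos
  have hl' := hp.lam_le; have hm' := hp.mu_le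
  have y0 := hp.offset_pos r
  have y1 := hp.offset_lt r
  have hdist : dist R (R + p.code r • e₁) = p.code r := by
    rw [dist_self_add_right, norm_smul, F.norm_left, Real.norm_eq_abs, mul_one, abs_of_nonneg]
    rw [p.code_eq]; linarith
  refine ⟨?_, ?_, ?_, ?_⟩
  · rw [dist_comm, dist_self_add_right, norm_smul, F.norm_right, Real.norm_eq_abs, mul_one,
      abs_of_pos hd]
  · rw [EuclideanGeometry.angle, vsub_eq_sub, vsub_eq_sub, add_sub_cancel_left,
      add_sub_cancel_left, ← InnerProductGeometry.inner_eq_zero_iff_angle_eq_pi_div_two,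
      real_inner_smul_left, real_inner_smul_right, F.inner₁₂, mul_zero, mul_zero]
  · rw [hdist, p.code_eq]; linarith
  · rw [hdist, p.code_eq]; linarith

/-- The execution from a rest position that stores `0`. -/
theorem explore_execution (hp : p.Good) (hV : 5 * p.d ≤ vis) (hδ : 0 < δ)
    (ex : Robots.IsExecution (explore p) vis δ fr x look)
    (hrest : AtRest p (x 0 0) (x 1 0) (x 2 0)) (hs : dist (x 2 0) (x 1 0) = p.code 0) :
    Robots.Explores vis x look ∧
      ∃ T : ℕ → ℝ, T 0 = 0 ∧ StrictMono T ∧ Filter.Tendsto T Filter.atTop Filter.atTop ∧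
        ∀ n : ℕ,
          AtRest p (x 0 (T n)) (x 1 (T n)) (x 2 (T n)) ∧
          x 0 (T n) = x 0 0 + p.mu • ∑ j ∈ Finset.range n, uu (x 0 0) (x 1 0) (x 2 0) (spiralDir j) ∧
          x 2 (T n) = x 2 0 + p.mu • ∑ j ∈ Finset.range n, uu (x 0 0) (x 1 0) (x 2 0) (spiralDir j) ∧
          x 1 (T n) = x 2 (T n) + p.code n • axis₁ (x 1 0) (x 2 0) := by
  have hvis : 3 * p.d ≤ vis := by linarith [hp.d_pos]
  obtain ⟨hC, hN, F⟩ := hrest.frame hp hs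
  have huu : ∀ n, ∑ j ∈ Finset.range n, uu (x 0 0) (x 1 0) (x 2 0) (spiralDir j) =
      spiralPos (dirVec (axis₁ (x 1 0) (x 2 0)) (axis₂ (x 0 0) (x 1 0) (x 2 0))) n := fun n => rfl
  simp only [huu]
  set e₁ := axis₁ (x 1 0) (x 2 0) with he₁
  set e₂ := axis₂ (x 0 0) (x 1 0) (x 2 0) with he₂
  set P : ℕ → Plane := fun n => x 2 0 + p.mu • spiralPos (dirVec e₁ e₂) n with hP
  have hm := hp.mu_pos; have hm' := hp.mu_le
  have step : ∀ (n : ℕ) (t : ℝ),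
      At x look t (P n + p.d • e₂) (P n + p.code n • e₁) (P n) → ∃ t', t < t' ∧
        At x look t' (P (n + 1) + p.d • e₂) (P (n + 1) + p.code (n + 1 : ℕ) • e₁) (P (n + 1)) ∧
        ∀ a, LookNear x look a t t' (P n) (4 * p.d) := by
    intro n t hAt
    obtain ⟨t', h1, h2, h3⟩ := complete_move (upd := fun r => r + 1)
      (dir := fun r => spiralDir ⌊r⌋₊) ex hδ hvis hp F (n : ℝ) (by simp) hAt
    refine ⟨t', h1, ?_, h3⟩
    have e : P n + p.mu • dirVec e₁ e₂ (spiralDir ⌊(n : ℝ)⌋₊) = P (n + 1) := by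
      rw [Nat.floor_natCast]
      simp only [hP, spiralPos]
      rw [Finset.sum_range_succ]
      module
    rw [e] at h2
    rwa [Nat.cast_succ]
  have init : At x look 0 (P 0 + p.d • e₂) (P 0 + p.code (0 : ℕ) • e₁) (P 0) := by
    have hP0 : P 0 = x 2 0 := by simp [hP, spiralPos]
    rw [hP0, Nat.cast_zero]
    refine ⟨fun i t' ht' hno => ?_, hC, hN, rfl⟩
    refine ex.wait i t' ⟨ht', ?_⟩
    by_contra hlt
    exact hno 0 ⟨ex.look_nonneg i, not_le.1 hlt⟩
  -- The times are chosen recursively, each together with the proof that the machine rests there,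
  -- which the next choice needs.
  let T' : (n : ℕ) → {t : ℝ // At x look t (P n + p.d • e₂) (P n + p.code n • e₁) (P n)} :=
    fun n => Nat.rec ⟨0, init⟩ (fun n t => ⟨(step n t.1 t.2).choose,
      (step n t.1 t.2).choose_spec.2.1⟩) n
  set T : ℕ → ℝ := fun n => (T' n).1 with hT
  have hlt : ∀ n, T n < T (n + 1) := fun n => (step n (T' n).1 (T' n).2).choose_spec.1
  have hlook : ∀ n a, LookNear x look a (T n) (T (n + 1)) (P n) (4 * p.d) := fun n =>
    (step n (T' n).1 (T' n).2).choose_spec.2.2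
  have hmono : StrictMono T := strictMono_nat_of_lt_succ hlt
  refine ⟨fun a X => ?_, T, rfl, hmono, ?_, fun n => ?_⟩
  -- A snapshot within `4 * d` of `P n`, which is within `2 * mu` of `X`, is within `5 * d ≤ vis` of
  -- `X`.
  · obtain ⟨n, hn⟩ := F.exists_spiralPos_near hm (x 2 0) X
    obtain ⟨k, -, hk⟩ := hlook n a
    exact ⟨k, (dist_triangle _ (P n) _).trans (by linarith)⟩
  -- Commander takes at least one snapshot in every move, so `T (n + 1)` exceeds the time of its
  -- snapshot number `n`, and these times tend to infinity.
  · have key : ∀ n, ∃ k, n ≤ k ∧ look 0 k ∈ Set.Ico (T n) (T (n + 1)) := by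
      intro n
      induction n with
      | zero =>
        obtain ⟨k, hk, -⟩ := hlook 0 0
        exact ⟨k, Nat.zero_le k, hk⟩
      | succ n ih =>
        obtain ⟨k, hk, hk'⟩ := ih
        obtain ⟨l, hl, -⟩ := hlook (n + 1) 0
        refine ⟨l, ?_, hl⟩
        have := (ex.look_strictMono 0).lt_iff_lt.1 (hk'.2.trans_le hl.1)
        omega
    rw [← Filter.tendsto_add_atTop_iff_nat 1]
    refine Filter.tendsto_atTop_mono (fun n => ?_) (ex.look_tendsto 0)
    obtain ⟨k, hk, hk'⟩ := key n
    exact ((ex.look_strictMono 0).monotone hk).trans hk'.2.le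
  · obtain ⟨-, h0, h1, h2⟩ := (T' n).2
    have h0' : x 0 (T n) = P n + p.d • e₂ := h0
    have h1' : x 1 (T n) = P n + p.code n • e₁ := h1
    have h2' : x 2 (T n) = P n := h2
    refine ⟨?_, ?_, h2', ?_⟩
    · rw [h0', h1', h2']
      exact F.atRest hp n _
    · rw [h0', hC]
      simp only [hP]
      module
    · rw [h1', h2']

end TuringMobile

end

/-! ### Computability of the algorithm -/

noncomputable section

namespace TuringMobile

open RealRAM

variable {ι : Type}

/-- A point of the plane with computable coordinates. -/
def CompV (q : (ι → ℝ) → Plane) : Prop := Comp (fun v => q v 0) ∧ Comp fun v => q v 1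

variable {a b : (ι → ℝ) → Plane} {f : (ι → ℝ) → ℝ} {P : (ι → ℝ) → Prop}

lemma CompV.congr (ha : CompV a) (h : ∀ v, b v = a v) : CompV b := by
  rwa [show b = a from funext h]

lemma CompV.zero : CompV fun _ : ι → ℝ => (0 : Plane) := ⟨Comp.zero, Comp.zero⟩

lemma CompV.add (ha : CompV a) (hb : CompV b) : CompV fun v => a v + b v :=
  ⟨ha.1.add hb.1, ha.2.add hb.2⟩

lemma CompV.sub (ha : CompV a) (hb : CompV b) : CompV fun v => a v - b v :=
  ⟨ha.1.sub hb.1, ha.2.sub hb.2⟩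

lemma CompV.smul (hf : Comp f) (ha : CompV a) : CompV fun v => f v • a v :=
  ⟨hf.mul ha.1, hf.mul ha.2⟩

lemma CompV.inner (ha : CompV a) (hb : CompV b) : Comp fun v => (inner ℝ (a v) (b v) : ℝ) :=
  ((ha.1.mul hb.1).add (ha.2.mul hb.2)).congr fun _ => inner_plane _ _

lemma CompV.norm (ha : CompV a) : Comp fun v => ‖a v‖ :=
  (ha.inner ha).sqrt.congr fun _ => norm_eq_sqrt_real_inner _

lemma CompV.dist (ha : CompV a) (hb : CompV b) : Comp fun v => dist (a v) (b v) :=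
  (ha.sub hb).norm.congr fun _ => dist_eq_norm _ _

lemma CompV.eq (ha : CompV a) (hb : CompV b) : CompP fun v => a v = b v :=
  (CompP.eq (ha.dist hb) Comp.zero).congr fun _ => dist_eq_zero.symm

open scoped Classical in
lemma CompV.ite (hP : CompP P) (ha : CompV a) (hb : CompV b) :
    CompV fun v => if P v then a v else b v :=
  ⟨(Comp.ite hP ha.1 hb.1).congr fun v => by by_cases h : P v <;> simp [h],
    (Comp.ite hP ha.2 hb.2).congr fun v => by by_cases h : P v <;> simp [h]⟩

lemma CompV.rot (ha : CompV a) : CompV fun v => rot (a v) :=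
  ⟨ha.2.neg.congr fun _ => rot_apply_zero _, ha.1.congr fun _ => rot_apply_one _⟩

lemma CompV.side (ha : CompV a) (hb : CompV b) : Comp fun v => side (a v) (b v) :=
  Comp.ite' (CompP.le Comp.zero ((ha.1.mul hb.2).sub (ha.2.mul hb.1))) Comp.one Comp.one.neg

lemma CompV.unit (ha : CompV a) : CompV fun v => unit (a v) := CompV.smul ha.norm.inv ha

lemma Comp.dirX (i : Fin 3) : Comp fun _ : ι → ℝ => dirX i := by
  have h := (Comp.ofNat (ι := ι) 3).sqrt.div (Comp.ofNat 2)
  fin_cases i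
  · exact Comp.zero
  · exact h.neg
  · exact h

lemma Comp.dirY (i : Fin 3) : Comp fun _ : ι → ℝ => dirY i := by
  have h := (Comp.one (ι := ι)).div (Comp.ofNat 2)
  fin_cases i
  · exact Comp.one
  · exact h.neg
  · exact h.neg

open scoped Classical in
/-- The first of three cases that applies. -/
def pick {α : Type*} (Q : Fin 3 → Prop) (F : Fin 3 → α) (G : α) : α :=
  if Q 0 then F 0 else if Q 1 then F 1 else if Q 2 then F 2 else G

lemma CompV.pick {Q : (ι → ℝ) → Fin 3 → Prop} {F : (ι → ℝ) → Fin 3 → Plane}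
    (hQ : ∀ i, CompP fun v => Q v i) (hF : ∀ i, CompV fun v => F v i) (ha : CompV a) :
    CompV fun v => pick (Q v) (F v) (a v) :=
  CompV.ite (hQ 0) (hF 0) (CompV.ite (hQ 1) (hF 1) (CompV.ite (hQ 2) (hF 2) ha))

/-- A program cannot evaluate `choose`, but if at most one index qualifies it may try the three in
turn. -/
lemma dite_choose_eq_pick {α : Type*} {Q : Fin 3 → Prop} [Decidable (∃ j, Q j)]
    (F : Fin 3 → α) (hQ : ∀ i j, Q i → Q j → i = j) (G : α) :
    (if h : ∃ j, Q j then F h.choose else G) = pick Q F G := by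
  rw [pick]
  by_cases h : ∃ j, Q j
  · have hspec := h.choose_spec
    have e : ∀ j, Q j → F h.choose = F j := fun j hj => by rw [hQ _ _ hspec hj]
    rw [dif_pos h]
    split_ifs with h0 h1 h2
    · exact e 0 h0
    · exact e 1 h1
    · exact e 2 h2
    · obtain ⟨j, hj⟩ := h
      fin_cases j
      exacts [absurd hj h0, absurd hj h1, absurd hj h2]
  · rw [dif_neg h, if_neg fun h0 => h ⟨0, h0⟩, if_neg fun h0 => h ⟨1, h0⟩,
      if_neg fun h0 => h ⟨2, h0⟩]

/-- The direction of the move along the spiral is computable. -/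
lemma CompP.spiralDir_eq (hf : Comp f) (j : Fin 3) :
    CompP fun v => spiralDir ⌊f v⌋₊ = j := by
  classical
  -- The leg is the least `k` with `f v < (k + 1) (k + 2) / 2`. Comparing `f v` itself with integers
  -- avoids computing the floor, and a negative value falls into leg `0`, as it should.
  have h1 : CompP fun w : Option ι → ℝ =>
      f (fun i => w (some i)) < (w none + 1) * (w none + 2) / 2 :=
    CompP.lt (hf.rename some) ((((Comp.var none).add Comp.one).mul
      ((Comp.var none).add (Comp.ofNat 2))).div (Comp.ofNat 2))
  have ex1 : ∀ v : ι → ℝ, ∃ k : ℕ, (fun w : Option ι → ℝ =>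
      f (fun i => w (some i)) < (w none + 1) * (w none + 2) / 2) (cons k v) := fun v => by
    obtain ⟨k, hk⟩ := exists_nat_gt (f v)
    refine ⟨k, ?_⟩
    change f v < ((k : ℝ) + 1) * (k + 2) / 2
    have : (0 : ℝ) ≤ k := Nat.cast_nonneg k
    nlinarith
  have hk := Comp.find h1 ex1
  set leg : (ι → ℝ) → ℕ := fun v => Nat.find (ex1 v) with hleg
  -- A second search finds the quotient of the leg by three; the remainder is the direction.
  have h2 : CompP fun w : Option ι → ℝ =>
      (leg (fun i => w (some i)) : ℝ) < 3 * (w none + 1) :=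
    CompP.lt (hk.rename some) ((Comp.ofNat 3).mul ((Comp.var none).add Comp.one))
  have ex2 : ∀ v : ι → ℝ, ∃ k : ℕ, (fun w : Option ι → ℝ =>
      (leg (fun i => w (some i)) : ℝ) < 3 * (w none + 1)) (cons k v) := fun v => by
    refine ⟨leg v, ?_⟩
    change (leg v : ℝ) < 3 * (leg v + 1)
    have : (0 : ℝ) ≤ leg v := Nat.cast_nonneg _
    linarith
  have hq := Comp.find h2 ex2
  refine (CompP.eq (hk.sub ((Comp.ofNat 3).mul hq)) (Comp.nat (j : ℕ))).congr fun v => ?_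
  have q1 := Nat.find_spec (ex2 v)
  have q2 : ∀ m < Nat.find (ex2 v), ¬ (leg v : ℝ) < 3 * (m + 1) := fun m hm =>
    Nat.find_min (ex2 v) hm
  change (leg v : ℝ) < 3 * ((Nat.find (ex2 v) : ℕ) + 1) at q1
  set q := Nat.find (ex2 v) with hqdef
  have q1' : leg v < 3 * (q + 1) := by exact_mod_cast q1
  have q2' : 3 * q ≤ leg v := by
    rcases Nat.eq_zero_or_pos q with h | h
    · omega
    · have := not_lt.1 (q2 (q - 1) (by omega))
      rw [Nat.cast_sub h, Nat.cast_one, sub_add_cancel] at this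
      exact_mod_cast this
  have l1 : f v < ((leg v : ℕ) + 1) * ((leg v : ℕ) + 2) / 2 := Nat.find_spec (ex1 v)
  have l2 : ∀ m < leg v, ¬ f v < ((m : ℝ) + 1) * (m + 2) / 2 := fun m hm =>
    Nat.find_min (ex1 v) hm
  have tri : ∀ m : ℕ, (((m * (m + 1) / 2 : ℕ)) : ℝ) = (m : ℝ) * (m + 1) / 2 := fun m => by
    rw [Nat.cast_div (Nat.even_mul_succ_self m).two_dvd (by norm_num)]
    push_cast; ring
  have hdir : spiralDir ⌊f v⌋₊ = Fin.ofNat 3 (leg v) := by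
    refine TuringMobile.spiralDir_eq ?_ ?_
    · rcases hm : leg v with _ | m
      · simp
      · have := not_lt.1 (l2 m (by omega))
        refine Nat.le_floor ?_
        rw [tri]
        push_cast
        linarith
    · have := tri (leg v + 1)
      rw [Nat.floor_lt' (by
        have := triangle_succ (leg v)
        omega)]
      refine l1.trans_eq ?_
      rw [show (leg v + 1) * (leg v + 2) = (leg v + 1) * (leg v + 1 + 1) by ring, this]
      push_cast; ring
  rw [hdir, Fin.ext_iff]
  simp only [Fin.ofNat]
  have : (leg v : ℝ) - 3 * (q : ℝ) = ((leg v - 3 * q : ℕ) : ℝ) := by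
    rw [Nat.cast_sub q2']; push_cast; rfl
  rw [this, Nat.cast_inj]
  omega

section Algorithm

variable {p : Params} (hd : Comp fun _ : ι → ℝ => p.d) (hm : Comp fun _ : ι → ℝ => p.mu)
  (hl : Comp fun _ : ι → ℝ => p.lam)

lemma Comp.code (hd : Comp fun _ : ι → ℝ => p.d) (hl : Comp fun _ : ι → ℝ => p.lam)
    (hf : Comp f) : Comp fun v => p.code (f v) :=
  ((Comp.ofNat 2).mul hd).add ((hf.arctan.mul hl).div Comp.pi)

lemma Comp.decode (hp : p.Good) (hl : Comp fun _ : ι → ℝ => p.lam) (hf : Comp f) :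
    Comp fun v => p.decode (f v) := by
  have h2 := (Comp.ofNat (ι := ι) 2)
  refine (Comp.ite ((CompP.lt Comp.zero hf).and (CompP.lt hf hl))
    (Comp.tan (((hf.sub (hl.div h2)).mul Comp.pi).div hl)) Comp.zero).congr fun v => ?_
  rw [Params.decode]
  by_cases h : 0 < f v ∧ f v < p.lam
  · have hlam := hp.lam_pos
    have hpi := Real.pi_pos
    rw [if_pos h, if_pos h, if_pos]
    constructor
    · rw [lt_div_iff₀ hlam]
      have := mul_pos h.1 hpi
      linarith
    · rw [div_lt_iff₀ hlam]
      have := mul_pos (sub_pos.2 h.2) hpi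
      linarith
  · rw [if_neg h, if_neg h]

variable {C N R : (ι → ℝ) → Plane} (hC : CompV C) (hN : CompV N) (hR : CompV R)

lemma CompV.axis₁ (hN : CompV N) (hR : CompV R) : CompV fun v => axis₁ (N v) (R v) :=
  (hN.sub hR).unit

lemma CompV.axis₂ (hC : CompV C) (hN : CompV N) (hR : CompV R) :
    CompV fun v => axis₂ (C v) (N v) (R v) :=
  CompV.smul ((hN.axis₁ hR).side (hC.sub hR)) (hN.axis₁ hR).rot

include hC hN hR in
lemma CompV.uu (i : Fin 3) : CompV fun v => uu (C v) (N v) (R v) i :=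
  ((CompV.smul (Comp.dirX i) (hN.axis₁ hR)).add
    (CompV.smul (Comp.dirY i) (hC.axis₂ hN hR))).congr fun _ => dirVec_eq _ _ _

include hC hN hR in
lemma CompV.ww (i : Fin 3) : CompV fun v => ww (C v) (N v) (R v) i :=
  ((CompV.smul (Comp.dirY i).neg (hN.axis₁ hR)).add
    (CompV.smul (Comp.dirX i) (hC.axis₂ hN hR))).congr fun _ => altVec_eq _ _ _

include hd hC hN hR in
lemma CompV.virt : CompV fun v => virt p (C v) (N v) (R v) :=
  hR.add (CompV.smul hd (hC.axis₂ hN hR))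

include hd hl hN hR in
lemma CompV.ptQ : CompV fun v => ptQ p (N v) (R v) :=
  hR.add (CompV.smul (((Comp.ofNat 2).mul hd).sub (hl.div (Comp.ofNat 2))) (hN.axis₁ hR))

/-- Two positions of Commander in regions belong to the same direction. -/
lemma region_unique (hp : p.Good) {C N R : Plane} (hNR : N ≠ R) (hne : C ≠ TuringMobile.virt p C N R)
    (i j : Fin 3) (hi : p.Region (tt p C N R i) (hh p C N R i))
    (hj : p.Region (tt p C N R j) (hh p C N R j)) : i = j := by
  by_contra hij
  have hci := hi.cone hp
  have hcj := hj.cone hp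
  rcases hci.1.eq_or_lt with h | h
  · exact hne ((eq_virt_iff hNR i).2 ⟨h.symm, le_antisymm (by linarith [hci.2.2]) hci.2.1⟩)
  · have := tt_neg (p := p) hNR (Ne.symm hij) h hci.2.1 hci.2.2
    linarith [hcj.1]

include hd hm hl hC hN hR in
/-- The destination of Commander is computable. -/
lemma CompV.commanderDest (hp : p.Good) {upd : ℝ → ℝ} {dir : ℝ → Fin 3}
    (hupd : ∀ f : (ι → ℝ) → ℝ, Comp f → Comp fun v => upd (f v))
    (hdir : ∀ f : (ι → ℝ) → ℝ, Comp f → ∀ j, CompP fun v => dir (f v) = j) :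
    ∃ g : (ι → ℝ) → Plane, CompV g ∧
      ∀ v, N v ≠ R v → commanderDest p upd dir (C v) (N v) (R v) = g v := by
  classical
  have two : Comp fun _ : ι → ℝ => (2 : ℝ) := Comp.ofNat 2
  have hV := CompV.virt hd hC hN hR
  have hu := CompV.uu hC hN hR
  have hw := CompV.ww hC hN hR
  have hNQ := hN.dist (CompV.ptQ hd hl hN hR)
  have hdec := Comp.decode hp hl hNQ
  have ht : ∀ i, Comp fun v => tt p (C v) (N v) (R v) i := fun i => (hC.sub hV).inner (hu i)
  have hh : ∀ i, Comp fun v => hh p (C v) (N v) (R v) i := fun i => (hC.sub hV).inner (hw i)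
  have hA : ∀ i, CompV fun v => ptA p (C v) (N v) (R v) i := fun i =>
    hV.add (CompV.smul ((hm.sub hl).div two) (hu i))
  have hS : ∀ i, CompV fun v => ptS p (C v) (N v) (R v) i := fun i =>
    hV.add (CompV.smul (hm.div two) (hu i))
  have hB : ∀ i, CompV fun v => ptB p (C v) (N v) (R v) i := fun i =>
    hV.add (CompV.smul ((hm.add hl).div two) (hu i))
  have hD : ∀ i, CompV fun v => ptD p (C v) (N v) (R v) i := fun i =>
    hV.add (CompV.smul hm (hu i))
  have hshift : Comp fun v => p.shift upd (Dist.dist (N v) (TuringMobile.ptQ p (N v) (R v))) :=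
    (Comp.code hd hl (hupd _ hdec)).sub ((two.mul hd).sub (hl.div two))
  have pApp : ∀ i, CompP fun v => p.Approach (tt p (C v) (N v) (R v) i)
      (TuringMobile.hh p (C v) (N v) (R v) i) := fun i =>
    (CompP.eq (hh i) Comp.zero).and ((CompP.le Comp.zero (ht i)).and
      (CompP.lt (ht i) ((hm.sub hl).div two)))
  have pStart : ∀ i, CompP fun v => p.Start (tt p (C v) (N v) (R v) i)
      (TuringMobile.hh p (C v) (N v) (R v) i) := fun i =>
    (CompP.eq (ht i) ((hm.sub hl).div two)).and (CompP.eq (hh i) Comp.zero)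
  have pFirst : ∀ i, CompP fun v => p.First (tt p (C v) (N v) (R v) i)
      (TuringMobile.hh p (C v) (N v) (R v) i) := fun i =>
    (CompP.lt (ht i) (hm.div two)).and ((CompP.le Comp.zero (hh i)).and
      (CompP.le (hh i) (two.mul ((ht i).sub ((hm.sub hl).div two)))))
  have pAlt : ∀ i, CompP fun v => p.Altitude (tt p (C v) (N v) (R v) i)
      (TuringMobile.hh p (C v) (N v) (R v) i) := fun i =>
    (CompP.eq (ht i) (hm.div two)).and ((CompP.le Comp.zero (hh i)).and (CompP.le (hh i) hl))
  have pSecond : ∀ i, CompP fun v => p.Second (tt p (C v) (N v) (R v) i)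
      (TuringMobile.hh p (C v) (N v) (R v) i) := fun i =>
    (CompP.lt (hm.div two) (ht i)).and ((CompP.le Comp.zero (hh i)).and
      ((CompP.le (hh i) (two.mul (((hm.add hl).div two).sub (ht i)))).and
        (CompP.eq (ht i) ((hm.add hl).div two)).not))
  have pLeave : ∀ i, CompP fun v => p.Leave (tt p (C v) (N v) (R v) i)
      (TuringMobile.hh p (C v) (N v) (R v) i) := fun i =>
    (CompP.eq (hh i) Comp.zero).and ((CompP.le ((hm.add hl).div two) (ht i)).and
      (CompP.lt (ht i) hm))
  -- The rules keep their order, with membership in segments and triangles replaced by the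
  -- inequalities of the regions. This is valid only for `N v ≠ R v`, where a frame exists;
  -- recognized roles guarantee that.
  refine ⟨_, CompV.ite (hC.eq hV)
    (CompV.pick (fun i => hdir _ hdec i) hA CompV.zero)
    (CompV.pick pApp hA
      (CompV.pick pStart (fun i => (hS i).add (CompV.smul hshift (hw i)))
        (CompV.pick pFirst (fun i => (hA i).add (CompV.smul
            ((hl.div two).div ((hC.sub (hA i)).inner (hu i))) (hC.sub (hA i))))
          (CompV.pick (fun i => (pAlt i).and (CompP.eq hNQ (hC.dist (hS i)))) hB
            (CompV.pick pSecond hB (CompV.pick pLeave hD hC)))))), fun v hNR => ?_⟩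
  dsimp only [TuringMobile.commanderDest]
  by_cases h : C v = TuringMobile.virt p (C v) (N v) (R v)
  · rw [if_pos h, if_pos h]
    generalize dir _ = i
    rw [TuringMobile.pick]
    fin_cases i <;> simp
  · have uniq := region_unique hp hNR h
    rw [if_neg h, if_neg h,
      dite_choose_eq_pick (fun j => ptA p (C v) (N v) (R v) j) fun i j hi hj => uniq i j
        (((mem_approach_iff hp hNR i).1 hi).region hp)
        (((mem_approach_iff hp hNR j).1 hj).region hp),
      dite_choose_eq_pick (fun j => ptS p (C v) (N v) (R v) j + p.shift upd
          (Dist.dist (N v) (TuringMobile.ptQ p (N v) (R v))) • TuringMobile.ww (C v) (N v) (R v) j)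
        fun i j hi hj => uniq i j (((eq_ptA_iff hNR i).1 hi).region hp)
          (((eq_ptA_iff hNR j).1 hj).region hp),
      dite_choose_eq_pick (fun j => ptA p (C v) (N v) (R v) j + (p.lam / 2 /
          Inner.inner ℝ (C v - ptA p (C v) (N v) (R v) j) (TuringMobile.uu (C v) (N v) (R v) j)) •
          (C v - ptA p (C v) (N v) (R v) j))
        fun i j hi hj => uniq i j (((mem_first_iff hp hNR i).1 hi).region hp)
          (((mem_first_iff hp hNR j).1 hj).region hp),
      dite_choose_eq_pick (fun j => ptB p (C v) (N v) (R v) j) fun i j hi hj => uniq i j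
        (((mem_altitude_iff hp hNR i).1 hi.1).region hp)
        (((mem_altitude_iff hp hNR j).1 hj.1).region hp),
      dite_choose_eq_pick (fun j => ptB p (C v) (N v) (R v) j) fun i j hi hj => uniq i j
        (((mem_second_iff hp hNR i).1 hi).region hp)
        (((mem_second_iff hp hNR j).1 hj).region hp),
      dite_choose_eq_pick (fun j => ptD p (C v) (N v) (R v) j) fun i j hi hj => uniq i j
        (((mem_leave_iff hp hNR i).1 hi).region hp)
        (((mem_leave_iff hp hNR j).1 hj).region hp)]
    simp only [mem_approach_iff hp hNR, eq_ptA_iff hNR, mem_first_iff hp hNR,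
      mem_second_iff hp hNR, mem_leave_iff hp hNR]
    simp only [mem_altitude_iff hp hNR]

include hC hN hR in
lemma CompV.ptD' {C' : (ι → ℝ) → Plane} (hC' : CompV C') :
    CompV fun v => ptD' (C' v) (C v) (N v) (R v) :=
  (hN.sub (CompV.smul (((hN.sub hR).inner (hC'.sub hR)).div
    ((hC.sub hC').inner (hC'.sub hR))) (hC.sub hC'))).add (hC.sub hC')

include hd hm in
lemma Comp.dmin : Comp fun _ : ι → ℝ => p.dmin := ((hd.sq.add hm.sq).sub (hd.mul hm)).sqrt

include hd hm hl hC hN hR in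
/-- The destination of Number is computable. -/
lemma CompV.numberDest (hp : p.Good) :
    ∃ g : (ι → ℝ) → Plane, CompV g ∧ ∀ v, N v ≠ R v → numberDest p (C v) (N v) (R v) = g v := by
  classical
  have two : Comp fun _ : ι → ℝ => (2 : ℝ) := Comp.ofNat 2
  have hV := CompV.virt hd hC hN hR
  have hu := CompV.uu hC hN hR
  have hw := CompV.ww hC hN hR
  have ht : ∀ i, Comp fun v => tt p (C v) (N v) (R v) i := fun i => (hC.sub hV).inner (hu i)
  have hh : ∀ i, Comp fun v => hh p (C v) (N v) (R v) i := fun i => (hC.sub hV).inner (hw i)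
  have hS : ∀ i, CompV fun v => ptS p (C v) (N v) (R v) i := fun i =>
    hV.add (CompV.smul (hm.div two) (hu i))
  have pAlt : ∀ i, CompP fun v => p.Altitude (tt p (C v) (N v) (R v) i)
      (TuringMobile.hh p (C v) (N v) (R v) i) := fun i =>
    (CompP.eq (ht i) (hm.div two)).and ((CompP.le Comp.zero (hh i)).and (CompP.le (hh i) hl))
  have hfar : CompV fun v => virtFar p (C v) (R v) :=
    hR.add (CompV.smul (hd.div (hd.add hm)) (hC.sub hR))
  have hnear : ∀ (σ : ℝ), Comp (fun _ : ι → ℝ => σ) →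
      CompV fun v => virtNear p σ (C v) (N v) (R v) := fun σ hσ =>
    (hR.add (CompV.smul ((hd.mul (hd.sub (hm.div two))).div (Comp.dmin hd hm).sq)
      (hC.sub hR))).add (CompV.smul ((hσ.mul ((hC.sub hR).side (hN.sub hR))).mul
        (((((Comp.ofNat 3).sqrt.div two).mul hd).mul hm).div (Comp.dmin hd hm).sq))
        (hC.sub hR).rot)
  have hCR := hC.dist hR
  have hin := (hN.sub hR).inner (hC.sub hR)
  have p1 := CompP.eq hCR (hd.add hm)
  have p2 := CompP.eq hCR (Comp.dmin hd hm)
  refine ⟨_, CompV.ite (p1.or p2) (CompV.ite p1 (CompV.ptD' hC hN hR hfar)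
    (CompV.ite (CompP.lt hin Comp.zero) (CompV.ptD' hC hN hR (hnear 1 Comp.one))
      (CompV.ite (CompP.lt Comp.zero hin)
        (CompV.ptD' hC hN hR (hnear (-1) Comp.one.neg)) hN)))
    (CompV.pick pAlt (fun i => (CompV.ptQ hd hl hN hR).add
      (CompV.smul (hC.dist (hS i)) (hN.axis₁ hR))) hN), fun v hNR => ?_⟩
  dsimp only [TuringMobile.numberDest]
  -- The comparison of the angle with a right angle is the sign of an inner product, so no inverse
  -- cosine is needed.
  simp only [pi_div_two_lt_angle_iff, angle_lt_pi_div_two_iff]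
  congr 1
  rw [dite_choose_eq_pick (fun j => TuringMobile.ptQ p (N v) (R v) +
    Dist.dist (C v) (ptS p (C v) (N v) (R v) j) • TuringMobile.axis₁ (N v) (R v)) fun i j hi hj => ?_]
  · simp only [mem_altitude_iff hp hNR]
  · have hi' := (mem_altitude_iff hp hNR i).1 hi
    refine region_unique hp hNR (fun e => ?_) i j (hi'.region hp)
      (((mem_altitude_iff hp hNR j).1 hj).region hp)
    have := ((eq_virt_iff hNR i).1 e).1
    linarith [hi'.1, hp.mu_pos]

include hd hC hN hR in
lemma CompV.circleMeet : CompV fun v => circleMeet p (C v) (N v) (R v) :=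
  have hCN := hC.dist hN
  (hC.add (CompV.smul (hd.sq.div hCN.sq) (hN.sub hC))).add
    (CompV.smul (((hN.sub hC).side (hR.sub hC)).mul
      ((hd.mul (hCN.sq.sub hd.sq).sqrt).div hCN.sq)) (hN.sub hC).rot)

include hd hm hl hC hN hR in
/-- What a robot does is computable, given the roles. -/
lemma CompV.body (hp : p.Good) {upd : ℝ → ℝ} {dir : ℝ → Fin 3}
    (hupd : ∀ f : (ι → ℝ) → ℝ, Comp f → Comp fun v => upd (f v))
    (hdir : ∀ f : (ι → ℝ) → ℝ, Comp f → ∀ j, CompP fun v => dir (f v) = j) :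
    ∃ g : (ι → ℝ) → Plane, CompV g ∧ ∀ v (s : Multiset Plane), Roles s (C v) (N v) (R v) →
      algorithm p upd dir s = g v := by
  classical
  obtain ⟨g₁, hg₁, e₁⟩ := CompV.commanderDest hd hm hl hC hN hR hp hupd hdir
  obtain ⟨g₂, hg₂, e₂⟩ := CompV.numberDest hd hm hl hC hN hR hp
  refine ⟨_, CompV.ite (hC.eq CompV.zero) hg₁ (CompV.ite (hN.eq CompV.zero) hg₂
    (CompV.ite (hR.eq CompV.zero) (CompV.ite ((hg₁.eq hC).and ((hg₂.eq hN).and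
      (CompP.le hd (hC.dist hN)))) (CompV.circleMeet hd hC hN hR) hR) CompV.zero)),
    fun v s hs => ?_⟩
  have hNR : N v ≠ R v := fun h => by
    have := hs.2.1
    rw [h, dist_self] at this
    exact absurd this (not_lt.2 dist_nonneg)
  rw [algorithm_eq hs, referenceDest, e₁ v hNR, e₂ v hNR]
  congr!

end Algorithm

lemma Roles.perm {a b c C N R : Plane} (h : Roles ↑[a, b, c] C N R) :
    (C, N, R) = (a, b, c) ∨ (C, N, R) = (a, c, b) ∨ (C, N, R) = (b, a, c) ∨
      (C, N, R) = (b, c, a) ∨ (C, N, R) = (c, a, b) ∨ (C, N, R) = (c, b, a) := by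
  have h1 : ((↑[a, b, c] : Multiset Plane)) = ↑[C, N, R] := h.1
  have h2 : [C, N, R] ∈ List.permutations' [a, b, c] :=
    List.mem_permutations'.2 (Multiset.coe_eq_coe.1 h1.symm)
  simp [List.permutations', List.permutations'Aux] at h2
  simp only [Prod.mk.injEq]
  tauto

/-- The coordinates of the `j`-th of three points. -/
def point (j : Fin 3) (v : Fin 6 → ℝ) : Plane :=
  !₂[v ⟨2 * j, by omega⟩, v ⟨2 * j + 1, by omega⟩]

lemma CompV.point (j : Fin 3) : CompV (point j) :=
  ⟨(Comp.var _).congr fun _ => rfl, (Comp.var _).congr fun _ => rfl⟩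

open scoped Classical in
/-- The exploration algorithm is computed by a real RAM. -/
theorem exists_program_explore {p : Params} (hp : p.Good)
    (hrat : ∃ a b e : ℚ, p.d = a ∧ p.mu = b ∧ p.lam = e) :
    ∃ P : List Instr, Computes P 3 (explore p) := by
  obtain ⟨ra, rb, re, ha, hb, he⟩ := hrat
  have hd : Comp fun _ : Fin 6 → ℝ => p.d := (Comp.rat ra).congr fun _ => ha
  have hm : Comp fun _ : Fin 6 → ℝ => p.mu := (Comp.rat rb).congr fun _ => hb
  have hl : Comp fun _ : Fin 6 → ℝ => p.lam := (Comp.rat re).congr fun _ => he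
  have body : ∀ i j k : Fin 3, ∃ g : (Fin 6 → ℝ) → Plane, CompV g ∧
      ∀ v (s : Multiset Plane), Roles s (point i v) (point j v) (point k v) →
        explore p s = g v := fun i j k =>
    CompV.body hd hm hl (CompV.point i) (CompV.point j) (CompV.point k) hp
      (fun f hf => hf.add Comp.one) fun f hf j => CompP.spiralDir_eq hf j
  choose g hg eg using body
  have ord : ∀ i j k : Fin 3, CompP fun v => dist (point i v) (point k v) <
      dist (point k v) (point j v) ∧ dist (point k v) (point j v) <
        dist (point i v) (point j v) := fun i j k =>
    (CompP.lt ((CompV.point i).dist (CompV.point k)) ((CompV.point k).dist (CompV.point j))).and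
      (CompP.lt ((CompV.point k).dist (CompV.point j)) ((CompV.point i).dist (CompV.point j)))
  have perm : ∀ (v : Fin 6 → ℝ) (i j k : Fin 3), [point i v, point j v, point k v] ∈
        List.permutations' [point 0 v, point 1 v, point 2 v] →
      (dist (point i v) (point k v) < dist (point k v) (point j v) ∧
        dist (point k v) (point j v) < dist (point i v) (point j v)) →
      explore p ↑[point 0 v, point 1 v, point 2 v] = g i j k v := fun v i j k hperm h =>
    eg i j k v _ ⟨(Multiset.coe_eq_coe.2 (List.mem_permutations'.1 hperm)).symm, h.1, h.2⟩
  obtain ⟨f, hf, ef⟩ : ∃ f : (Fin 6 → ℝ) → Plane, CompV f ∧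
      ∀ v, explore p ↑[point 0 v, point 1 v, point 2 v] = f v := by
    -- The input is an arbitrary listing of the snapshot, so the program tries all six assignments
    -- of roles.
    refine ⟨_, CompV.ite (ord 0 1 2) (hg 0 1 2) (CompV.ite (ord 0 2 1) (hg 0 2 1)
      (CompV.ite (ord 1 0 2) (hg 1 0 2) (CompV.ite (ord 1 2 0) (hg 1 2 0)
        (CompV.ite (ord 2 0 1) (hg 2 0 1) (CompV.ite (ord 2 1 0) (hg 2 1 0) CompV.zero))))),
      fun v => ?_⟩
    split_ifs with h1 h2 h3 h4 h5 h6
    · exact perm v 0 1 2 (by simp) h1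
    · exact perm v 0 2 1 (by simp) h2
    · exact perm v 1 0 2 (by simp) h3
    · exact perm v 1 2 0 (by simp) h4
    · exact perm v 2 0 1 (by simp) h5
    · exact perm v 2 1 0 (by simp) h6
    -- If none of the six orderings of the distances holds, no roles exist, and the destination is
    -- the robot's own position.
    · rw [explore, algorithm, dif_neg]
      rintro ⟨⟨C, N, R⟩, h⟩
      have hlt := h.2
      rcases h.perm with e | e | e | e | e | e <;>
        (simp only [Prod.mk.injEq] at e; obtain ⟨rfl, rfl, rfl⟩ := e; tauto)
  obtain ⟨P, hP⟩ := exists_program hf.1 hf.2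
  refine ⟨P, fun L hL _ => ?_⟩
  obtain ⟨m, h1, h2, h3⟩ := hP (input L)
  refine ⟨m, h1, ?_⟩
  rw [h2, h3]
  obtain ⟨a, b, c, rfl⟩ := List.length_eq_three.1 hL
  rw [← ef]
  have p0 : point 0 (fun i => input [a, b, c] (i + 1)) = a := by ext i; fin_cases i <;> rfl
  have p1 : point 1 (fun i => input [a, b, c] (i + 1)) = b := by ext i; fin_cases i <;> rfl
  have p2 : point 2 (fun i => input [a, b, c] (i + 1)) = c := by ext i; fin_cases i <;> rfl
  rw [p0, p1, p2]
  exact ⟨rfl, rfl⟩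

end TuringMobile

end

theorem theorem4 :
    ∃ c : ℝ, 0 < c ∧ ∀ (V ε : ℝ) (p : TuringMobile.Params),
      0 < p.lam → p.lam ≤ c * p.mu → p.mu ≤ c * p.d → p.d ≤ c * ε → ε ≤ c * V →
      -- all executions from a rest position that stores `0` (robot `0` is Commander,
      -- robot `1` is Number, robot `2` is Reference)
      (∀ (δ : ℝ) (fr : Fin 3 → Plane ≃ₗᵢ[ℝ] Plane) (x : Fin 3 → ℝ → Plane) (look : Fin 3 → ℕ → ℝ),
        0 < δ →
        Robots.IsExecution (TuringMobile.explore p) (V + ε) δ fr x look →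
        TuringMobile.AtRest p (x 0 0) (x 1 0) (x 2 0) →
        dist (x 2 0) (x 1 0) = p.code 0 →
        -- every robot sees every point
        Robots.Explores (V + ε) x look ∧
        -- the stored number counts the moves, and the moves follow the spiral
        ∃ T : ℕ → ℝ, T 0 = 0 ∧ StrictMono T ∧ Filter.Tendsto T Filter.atTop Filter.atTop ∧
          ∀ n : ℕ,
            TuringMobile.AtRest p (x 0 (T n)) (x 1 (T n)) (x 2 (T n)) ∧
            x 0 (T n) = x 0 0 + p.mu • ∑ j ∈ Finset.range n,
              TuringMobile.uu (x 0 0) (x 1 0) (x 2 0) (TuringMobile.spiralDir j) ∧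
            x 2 (T n) = x 2 0 + p.mu • ∑ j ∈ Finset.range n,
              TuringMobile.uu (x 0 0) (x 1 0) (x 2 0) (TuringMobile.spiralDir j) ∧
            x 1 (T n) = x 2 (T n) + p.code n • TuringMobile.axis₁ (x 1 0) (x 2 0)) ∧
      -- the algorithm is the program of a real RAM if the lengths are rational
      ((∃ a b e : ℚ, p.d = a ∧ p.mu = b ∧ p.lam = e) →
        ∃ P : List RealRAM.Instr, RealRAM.Computes P 3 (TuringMobile.explore p)) := by
  -- The value `1 / 1000` provides the ratios in `Params.Good` and leaves ample room for `5 * d ≤ V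
  -- + ε`.
  refine ⟨1 / 1000, by norm_num, fun V ε p hlam h1 h2 h3 h4 => ?_⟩
  have hp : p.Good := ⟨hlam, by linarith, by linarith⟩
  exact ⟨fun δ fr x look hδ ex hrest hs => TuringMobile.explore_execution hp
    (by linarith) hδ ex hrest hs, TuringMobile.exists_program_explore hp⟩
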